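/- **Theorem (advection-dispersion equation with the Hilfer-Prabhakar derivative).** Let $\alpha>0$, $\gamma>0$, $\rho\in(0,1)$, $\nu\in[0,1]$, $\lambda\in(0,2)$, $\omega,p\in\mathbb R$, $\vartheta\ge 0$. *Notation.* Let $E^{c}_{\alpha,\beta}(z)=\sum_{j\ge0}\frac{(c)_j}{\Gamma(\alpha j+\beta)}\frac{z^j}{j!}$ with $(c)_j$ the rising factorial, and $$\mathcal I^{c}_{\alpha,\beta,\omega,0+}f(t)=\int_0^t (t-\tau)^{\beta-1}E^{c}_{\alpha,\beta}\big(\omega(t-\tau)^\alpha\big)f(\tau)\,d\tau\quad(\beta>0),\qquad \mathcal I^{0}_{\alpha,0,\omega,0+}f=f .$$ The Hilfer-Prabhakar derivative is $$\mathcal D^{\gamma,\rho,\nu}_{\alpha,\omega,0+}f=\mathcal I^{-\gamma\nu}_{\alpha,\nu(1-\rho),\omega,0+}\,\frac{d}{dt}\,\mathcal I^{-\gamma(1-\nu)}_{\alpha,(1-\nu)(1-\rho),\omega,0+}f .$$ The operator $\Delta^{\lambda/2}$ is the fractional Laplacian on $\mathbb R$ with Fourier symbol $-|k|^\lambda$,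 that is, $$\Delta^{\lambda/2}f(x)=\frac1{N_\lambda}\int_0^\infty\frac{f(x+y)+f(x-y)-2f(x)}{y^{1+\lambda}}\,dy,\qquad N_\lambda=\int_0^\infty\frac{2-2\cos y}{y^{1+\lambda}}\,dy .$$ For $g:\mathbb R\to\mathbb C$ let $g^*(k)=\int_{\mathbb R}g(x)e^{ikx}\,dx$. *Statement.* Let $g:\mathbb R\to\mathbb C$ be continuous and integrable with $\int_{\mathbb R}(1+|k|+|k|^\lambda)\,|g^*(k)|\,dk<\infty$. For $x\in\mathbb R$ and $t>0$ put $$\psi(x,t)=\frac1{2\pi}\int_{-\infty}^{\infty}e^{-ikx}g^*(k)\sum_{n=0}^{\infty}t^{\nu(1-\rho)+n\rho+\rho-1}\,(ipk-\vartheta|k|^\lambda)^n\,E^{\gamma(n+1)-\gamma\nu}_{\alpha,\nu(1-\rho)+\rho(n+1)}(\omega t^\alpha)\,dk .$$ Then the series converges absolutely for all $k\in\mathbb R$, $t>0$, the integrand is integrable in $k$ for all $x\in\mathbb R$, $t>0$, and $\psi$ is a classical solution of the Cauchy problem $$\mathcal D^{\gamma,\rho,\nu}_{\alpha,\omega,0+}\psi(x,t)=-p\,\partial_x\psi(x,t)+\vartheta\,\Delta^{\lambda/2}\psi(x,t)\qquad(x\in\mathbb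 R,\ t>0),$$ $$\lim_{t\to0+}\mathcal I^{-\gamma(1-\nu)}_{\alpha,(1-\nu)(1-\rho),\omega,0+}\psi(x,t)=g(x)\quad(x\in\mathbb R),\qquad \lim_{|x|\to\infty}\psi(x,t)=0\quad(t>0).$$ Here "classical solution" includes the following. For every $x$, $\psi(x,\cdot)$ is integrable on $(0,T]$ for all $T>0$. The function $\mathcal I^{-\gamma(1-\nu)}_{\alpha,(1-\nu)(1-\rho),\omega,0+}\psi(x,\cdot)$ is differentiable on $(0,\infty)$ with derivative integrable on each $(0,T]$. All Prabhakar integrals involved converge absolutely. For every $t>0$, $\psi(\cdot,t)$ is differentiable and the integral defining $\Delta^{\lambda/2}\psi(\cdot,t)(x)$ converges absolutely at every $x$. -/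

import Mathlib

open MeasureTheory Set Filter Topology

noncomputable section

/-- The three-parameter Mittag-Leffler (Prabhakar) function
`E^γ_{α,β}(z) = ∑_j (γ)_j z^j / (Γ(α j + β) j!)`, where `(γ)_j` is the rising factorial. -/
def prabhakarE (α β γ z : ℝ) : ℝ :=
  ∑' j : ℕ, (ascPochhammer ℝ j).eval γ / Real.Gamma (α * j + β) * (z ^ j / (j.factorial : ℝ))

/-- The Prabhakar kernel `e^γ_{α,β,ω}(t) = t^{β-1} E^γ_{α,β}(ω t^α)`, for `t > 0`. -/
def prabhakarKernel (α β γ ω t : ℝ) : ℝ :=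
  t ^ (β - 1) * prabhakarE α β γ (ω * t ^ α)

/-- The Prabhakar fractional integral
`(I^γ_{α,β,ω,0+} f)(t) = ∫_0^t (t-τ)^{β-1} E^γ_{α,β}(ω (t-τ)^α) f(τ) dτ` for `β > 0`,
with the usual convention that the integral with `β = 0` and `γ = 0` is the identity. -/
def prabhakarIntegral (α β γ ω : ℝ) (f : ℝ → ℂ) (t : ℝ) : ℂ :=
  if β = 0 ∧ γ = 0 then f t
  else ∫ τ in (0 : ℝ)..t, (prabhakarKernel α β γ ω (t - τ) : ℂ) * f τ

/-- The integral defining `prabhakarIntegral α β γ ω f t` converges absolutely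
(no condition when the operator is the identity). -/
def PrabhakarIntegrableAt (α β γ ω : ℝ) (f : ℝ → ℂ) (t : ℝ) : Prop :=
  (β = 0 ∧ γ = 0) ∨
    IntervalIntegrable (fun τ => (prabhakarKernel α β γ ω (t - τ) : ℂ) * f τ) volume 0 t

/-- The inner integral `I^{-γ(1-ν)}_{α,(1-ν)(1-ρ),ω,0+} f` of the Hilfer-Prabhakar derivative;
its value at `0+` is prescribed by the initial condition. -/
def hilferPrabhakarInner (α γ ρ ν ω : ℝ) (f : ℝ → ℂ) : ℝ → ℂ :=
  prabhakarIntegral α ((1 - ν) * (1 - ρ)) (-γ * (1 - ν)) ω f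

/-- The Hilfer-Prabhakar fractional derivative
`D^{γ,ρ,ν}_{α,ω,0+} f = I^{-γν}_{α,ν(1-ρ),ω,0+} (d/dt) I^{-γ(1-ν)}_{α,(1-ν)(1-ρ),ω,0+} f`. -/
def hilferPrabhakarDeriv (α γ ρ ν ω : ℝ) (f : ℝ → ℂ) : ℝ → ℂ :=
  prabhakarIntegral α (ν * (1 - ρ)) (-γ * ν) ω (deriv (hilferPrabhakarInner α γ ρ ν ω f))

/-- Every operation in the definition of `hilferPrabhakarDeriv α γ ρ ν ω f t`, `t > 0`, is
legitimate: `f` is integrable on bounded intervals, the inner integral is differentiable on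
`(0, ∞)` with a derivative that is integrable on bounded intervals (so it is absolutely
continuous up to `0`), and both Prabhakar integrals converge absolutely. -/
structure HilferPrabhakarDifferentiable (α γ ρ ν ω : ℝ) (f : ℝ → ℂ) : Prop where
  integrable : ∀ T > 0, IntervalIntegrable f volume 0 T
  inner_integrable : ∀ t > 0,
    PrabhakarIntegrableAt α ((1 - ν) * (1 - ρ)) (-γ * (1 - ν)) ω f t
  inner_differentiable : ∀ t > 0, DifferentiableAt ℝ (hilferPrabhakarInner α γ ρ ν ω f) t
  deriv_integrable : ∀ T > 0,
    IntervalIntegrable (deriv (hilferPrabhakarInner α γ ρ ν ω f)) volume 0 T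
  outer_integrable : ∀ t > 0,
    PrabhakarIntegrableAt α (ν * (1 - ρ)) (-γ * ν) ω
      (deriv (hilferPrabhakarInner α γ ρ ν ω f)) t

/-- The reciprocal of the normalizing constant of the fractional Laplacian of order `lam`. -/
def fracLaplacianNorm (lam : ℝ) : ℝ :=
  ∫ y in Ioi (0 : ℝ), (2 - 2 * Real.cos y) / y ^ (1 + lam)

/-- The integral defining the fractional Laplacian at `x` converges absolutely. -/
def FracLaplacianIntegrableAt (lam : ℝ) (f : ℝ → ℂ) (x : ℝ) : Prop :=
  IntegrableOn (fun y : ℝ => (f (x + y) + f (x - y) - 2 * f x) / ((y ^ (1 + lam) : ℝ) : ℂ))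
    (Ioi 0)

/-- The fractional Laplace operator `Δ^{lam/2}` on the line, `0 < lam < 2`, as the
second-difference singular integral, normalized to have Fourier symbol `-|k|^lam`
(see `fracLaplacian_exp`). -/
def fracLaplacian (lam : ℝ) (f : ℝ → ℂ) (x : ℝ) : ℂ :=
  ((fracLaplacianNorm lam : ℝ) : ℂ)⁻¹ *
    ∫ y in Ioi (0 : ℝ), (f (x + y) + f (x - y) - 2 * f x) / ((y ^ (1 + lam) : ℝ) : ℂ)

/-- The Fourier transform `f*(k) = ∫ f(x) e^{ikx} dx`. -/
def fourierStar (f : ℝ → ℂ) (k : ℝ) : ℂ :=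
  ∫ x : ℝ, f x * Complex.exp (Complex.I * k * x)

/-- `ψ` is a classical solution of
`D^{γ,ρ,ν}_{α,ω,0+} ψ = -p ∂_x ψ + ϑ Δ^{lam/2} ψ` for `x ∈ ℝ`, `t > 0`, with initial condition
`I^{-γ(1-ν)}_{α,(1-ν)(1-ρ),ω,0+} ψ(x,0+) = g(x)` and `ψ(x,t) → 0` as `|x| → ∞`. -/
structure IsAdvectionDispersionSolution (α γ ρ ν ω p ϑ lam : ℝ) (g : ℝ → ℂ)
    (ψ : ℝ → ℝ → ℂ) : Prop where
  time_regular : ∀ x, HilferPrabhakarDifferentiable α γ ρ ν ω (fun t => ψ x t)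
  space_differentiable : ∀ t > 0, Differentiable ℝ (fun x => ψ x t)
  fracLaplacian_integrable : ∀ t > 0, ∀ x, FracLaplacianIntegrableAt lam (fun x' => ψ x' t) x
  equation : ∀ t > 0, ∀ x,
    hilferPrabhakarDeriv α γ ρ ν ω (fun t' => ψ x t') t =
      -(p : ℂ) * deriv (fun x' => ψ x' t) x + (ϑ : ℂ) * fracLaplacian lam (fun x' => ψ x' t) x
  initial : ∀ x,
    Tendsto (hilferPrabhakarInner α γ ρ ν ω (fun t => ψ x t)) (𝓝[>] 0) (𝓝 (g x))
  decay : ∀ t > 0, Tendsto (fun x => ψ x t) (cocompact ℝ) (𝓝 0)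

/-- The `n`-th term
`t^{ν(1-ρ)+nρ+ρ-1} (ipk - ϑ|k|^lam)^n E^{γ(n+1)-γν}_{α,ν(1-ρ)+ρ(n+1)}(ω t^α)`. -/
def solutionTerm (α γ ρ ν ω p ϑ lam k t : ℝ) (n : ℕ) : ℂ :=
  ((t ^ (ν * (1 - ρ) + n * ρ + ρ - 1) : ℝ) : ℂ) *
    (Complex.I * p * k - ϑ * ((|k| ^ lam : ℝ) : ℂ)) ^ n *
    (prabhakarE α (ν * (1 - ρ) + ρ * (n + 1)) (γ * (n + 1) - γ * ν) (ω * t ^ α) : ℂ)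

/-- The integrand `e^{-ikx} g*(k) ∑_n (n-th term)` of the solution formula. -/
def solutionIntegrand (α γ ρ ν ω p ϑ lam : ℝ) (g : ℝ → ℂ) (x t k : ℝ) : ℂ :=
  Complex.exp (-Complex.I * k * x) * fourierStar g k *
    ∑' n : ℕ, solutionTerm α γ ρ ν ω p ϑ lam k t n

/-- `ψ(x,t) = (1/2π) ∫ e^{-ikx} g*(k) ∑_n (n-th term) dk`. -/
def solutionFormula (α γ ρ ν ω p ϑ lam : ℝ) (g : ℝ → ℂ) (x t : ℝ) : ℂ :=
  (1 / (2 * Real.pi) : ℂ) * ∫ k : ℝ, solutionIntegrand α γ ρ ν ω p ϑ lam g x t k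

theorem integrableOn_fracLaplacianNorm {lam : ℝ} (h0 : 0 < lam) (h2 : lam < 2) :
    IntegrableOn (fun y : ℝ => (2 - 2 * Real.cos y) / y ^ (1 + lam)) (Ioi 0) := by
  have hm : Measurable (fun y : ℝ => (2 - 2 * Real.cos y) / y ^ (1 + lam)) := by fun_prop
  rw [← Ioc_union_Ioi_eq_Ioi (zero_le_one' ℝ)]
  refine IntegrableOn.union ?_ ?_
  · have h1 : IntegrableOn (fun y : ℝ => y ^ (1 - lam)) (Ioc 0 1) := by
      have := intervalIntegral.intervalIntegrable_rpow' (a := 0) (b := 1) (r := 1 - lam)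
        (by linarith)
      rwa [intervalIntegrable_iff_integrableOn_Ioc_of_le zero_le_one] at this
    refine Integrable.mono' h1 hm.aestronglyMeasurable ?_
    filter_upwards [ae_restrict_mem measurableSet_Ioc] with y hy
    have hy0 : 0 < y := hy.1
    have hp : 0 < y ^ (1 + lam) := Real.rpow_pos_of_pos hy0 _
    rw [Real.norm_of_nonneg (div_nonneg (by linarith [Real.cos_le_one y]) hp.le), div_le_iff₀ hp,
      ← Real.rpow_add hy0]
    have : y ^ (1 - lam + (1 + lam)) = y ^ 2 := by
      rw [← Real.rpow_natCast]; congr 1; push_cast; ring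
    rw [this]
    linarith [Real.one_sub_sq_div_two_le_cos (x := y)]
  · have h1 : IntegrableOn (fun y : ℝ => 4 * y ^ (-(1 + lam))) (Ioi 1) :=
      (integrableOn_Ioi_rpow_of_lt (by linarith) one_pos).const_mul 4
    refine Integrable.mono' h1 hm.aestronglyMeasurable ?_
    filter_upwards [ae_restrict_mem measurableSet_Ioi] with y hy
    have hy0 : 0 < y := lt_trans one_pos hy
    have hp : 0 < y ^ (1 + lam) := Real.rpow_pos_of_pos hy0 _
    rw [Real.norm_of_nonneg (div_nonneg (by linarith [Real.cos_le_one y]) hp.le),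
      Real.rpow_neg hy0.le, div_eq_mul_inv]
    gcongr
    linarith [Real.neg_one_le_cos y]

theorem fracLaplacianNorm_pos {lam : ℝ} (h0 : 0 < lam) (h2 : lam < 2) :
    0 < fracLaplacianNorm lam := by
  unfold fracLaplacianNorm
  rw [setIntegral_pos_iff_support_of_nonneg_ae _ (integrableOn_fracLaplacianNorm h0 h2)]
  · have hsub : Ioo (0 : ℝ) 1 ⊆
        Function.support (fun y : ℝ => (2 - 2 * Real.cos y) / y ^ (1 + lam)) ∩ Ioi 0 := by
      intro y hy
      refine ⟨?_, hy.1⟩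
      have hp : 0 < y ^ (1 + lam) := Real.rpow_pos_of_pos hy.1 _
      have hc : Real.cos y < 1 := by
        rw [← Real.cos_zero]
        exact Real.cos_lt_cos_of_nonneg_of_le_pi le_rfl
          (by linarith [hy.2, Real.pi_gt_three]) hy.1
      exact (div_pos (by linarith) hp).ne'
    refine lt_of_lt_of_le ?_ (measure_mono hsub)
    simp
  · filter_upwards [ae_restrict_mem measurableSet_Ioi] with y hy
    have hp : 0 < y ^ (1 + lam) := Real.rpow_pos_of_pos hy _
    exact div_nonneg (by linarith [Real.cos_le_one y]) hp.le

/-- `Δ^{lam/2}` has Fourier symbol `-|k|^lam`. -/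
theorem fracLaplacian_exp {lam : ℝ} (h0 : 0 < lam) (h2 : lam < 2) (k x : ℝ) :
    fracLaplacian lam (fun x => Complex.exp (-Complex.I * k * x)) x =
      -((|k| ^ lam : ℝ) : ℂ) * Complex.exp (-Complex.I * k * x) := by
  have hN : ((fracLaplacianNorm lam : ℝ) : ℂ) ≠ 0 := by
    exact_mod_cast (fracLaplacianNorm_pos h0 h2).ne'
  have key : ∀ y : ℝ, Complex.exp (-Complex.I * k * ((x + y : ℝ) : ℂ)) +
      Complex.exp (-Complex.I * k * ((x - y : ℝ) : ℂ)) - 2 * Complex.exp (-Complex.I * k * x) =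
      -Complex.exp (-Complex.I * k * x) * ((2 - 2 * Real.cos (|k| * y) : ℝ) : ℂ) := by
    intro y
    have hc : Real.cos (|k| * y) = Real.cos (k * y) := by
      rcases abs_choice k with h | h <;> rw [h]
      rw [neg_mul, Real.cos_neg]
    rw [hc]
    push_cast
    rw [Complex.cos]
    have e1 : -Complex.I * (k : ℂ) * ((x : ℂ) + y) = -Complex.I * k * x + -(k * y) * Complex.I := by
      ring
    have e2 : -Complex.I * (k : ℂ) * ((x : ℂ) - y) = -Complex.I * k * x + (k * y) * Complex.I := by
      ring
    rw [e1, e2, Complex.exp_add, Complex.exp_add]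
    ring
  have scale : ∫ y in Ioi (0 : ℝ), (2 - 2 * Real.cos (|k| * y)) / y ^ (1 + lam) =
      |k| ^ lam * fracLaplacianNorm lam := by
    rcases eq_or_ne k 0 with rfl | hk
    · simp [Real.zero_rpow h0.ne']
    have hk' : 0 < |k| := abs_pos.mpr hk
    have h := integral_comp_mul_left_Ioi
      (fun y : ℝ => (2 - 2 * Real.cos y) / y ^ (1 + lam)) 0 hk'
    rw [mul_zero] at h
    have hcongr : ∫ y in Ioi (0 : ℝ), (2 - 2 * Real.cos (|k| * y)) / y ^ (1 + lam) =
        ∫ y in Ioi (0 : ℝ), |k| ^ (1 + lam) *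
          ((2 - 2 * Real.cos (|k| * y)) / (|k| * y) ^ (1 + lam)) := by
      refine setIntegral_congr_fun measurableSet_Ioi fun y hy => ?_
      have hy0 : (0 : ℝ) < y := hy
      have h1 : 0 < y ^ (1 + lam) := Real.rpow_pos_of_pos hy0 _
      have h3 : 0 < |k| ^ (1 + lam) := Real.rpow_pos_of_pos hk' _
      simp only [Real.mul_rpow hk'.le hy0.le]
      field_simp
    rw [hcongr, integral_const_mul, h, smul_eq_mul, ← mul_assoc, Real.rpow_add hk', Real.rpow_one]
    unfold fracLaplacianNorm
    field_simp
  unfold fracLaplacian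
  have hint : ∀ y : ℝ, (Complex.exp (-Complex.I * k * ((x + y : ℝ) : ℂ)) +
      Complex.exp (-Complex.I * k * ((x - y : ℝ) : ℂ)) - 2 * Complex.exp (-Complex.I * k * x)) /
      ((y ^ (1 + lam) : ℝ) : ℂ) = -Complex.exp (-Complex.I * k * x) *
      (((2 - 2 * Real.cos (|k| * y)) / y ^ (1 + lam) : ℝ) : ℂ) := by
    intro y
    rw [key y, Complex.ofReal_div, mul_div_assoc]
  simp only [hint]
  rw [integral_const_mul, integral_complex_ofReal, scale]
  push_cast
  field_simp

end

open MeasureTheory Set Filter Topology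

/-! Write e^c_b for the Prabhakar kernel with second index b and upper index c. The kernels form a
semigroup under convolution on (0,t): e^c_a * e^d_b = e^{c+d}_{a+b}
(`integral_prabhakarKernel_conv`), which is the Beta integral for powers combined with the
Chu-Vandermonde identity for the coefficients. Put S_{β,c}(z,t) = ∑_n z^n e^{γn+c}_{ρn+β}(t).
Convolution with e^d_b then sends S_{β,c} to S_{β+b,c+d}.

The formula for ψ is a Fourier superposition of S_{β,c} with β = ν(1-ρ)+ρ, c = γ-γν and z(k) = ipk -
ϑ|k|^λ. The inner integral of the derivative adds ((1-ν)(1-ρ), -γ(1-ν)) to the indices and lands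
exactly on S_{1,0}. Since e^0_1 = 1, one has S_{1,0} = 1 + z∫V with V = S_{ρ,γ}, so its time
derivative is zV and its value at 0+ is 1. The outer integral adds (ν(1-ρ), -γν) and returns z
S_{β,c}. Each mode therefore satisfies Dψ = zψ with initial value 1, and z(k) is the symbol of -p∂_x
+ ϑΔ^{λ/2}.

The difficulty is uniformity in k: z(k) may be unbounded, while termwise estimates of S deteriorate
as |z| grows. What saves the argument is Re z(k) ≤ 0. The Laplace transform of V is 1/(Φ(s)-z) with
Φ(s) = s^ρ(1-ωs^{-α})^γ, and ρ < 1 keeps Φ(s) in a sector inside the right half-plane for Re s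
large. Hence |Φ(s)-z| ≥ κ|s|^ρ for all such z at once (`exists_symbol_bounds`). Inverting the
Laplace transform of tV(t) along Re s = a₀ + 1/t gives |V(z,t)| ≤ C t^{ρ-1} with C independent of z
(`norm_resolvent_le`), and convolution carries the bound to the other indices.

With this bound, Fubini and dominated convergence move all time operations inside the k-integral. In
space, the weight 1+|k|+|k|^λ pays for ∂_x and Δ^{λ/2}, Fourier inversion gives the initial value,
and the Riemann-Lebesgue lemma gives the decay. -/

/-! ### Coefficients of the binomial series. -/

/-- The coefficient `(c)_j / j!` of the binomial series of `(1 - x)^{-c}`. -/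
noncomputable def risingCoeff (c : ℝ) (j : ℕ) : ℝ :=
  (ascPochhammer ℝ j).eval c / (j.factorial : ℝ)

/-- The link to `Ring.choose`, through which the binomial series becomes available. -/
theorem risingCoeff_eq_multichoose (c : ℝ) (j : ℕ) : risingCoeff c j = Ring.multichoose c j := by
  have h := Ring.factorial_nsmul_multichoose_eq_ascPochhammer c j
  rw [Polynomial.ascPochhammer_smeval_eq_eval, nsmul_eq_mul] at h
  rw [risingCoeff, ← h]
  field_simp

@[simp] theorem risingCoeff_zero_right (c : ℝ) : risingCoeff c 0 = 1 := by simp [risingCoeff]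

theorem risingCoeff_zero_left {j : ℕ} (hj : j ≠ 0) : risingCoeff 0 j = 0 := by
  simp [risingCoeff, ascPochhammer_ne_zero_eval_zero (S := ℝ) hj]

/-- Factor by factor, |c+i| ≤ |c|+i. This is the source of every majorant below: replacing c and ω
by |c| and |ω| makes all terms nonnegative. -/
theorem abs_risingCoeff_le (c : ℝ) (j : ℕ) : |risingCoeff c j| ≤ risingCoeff |c| j := by
  unfold risingCoeff
  rw [abs_div, Nat.abs_cast]
  gcongr
  induction j with
  | zero => simp
  | succ n ih =>
    rw [ascPochhammer_succ_eval, ascPochhammer_succ_eval, abs_mul]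
    refine mul_le_mul ih ((abs_add_le _ _).trans (by simp)) (abs_nonneg _) ((abs_nonneg _).trans ih)

theorem risingCoeff_nonneg {c : ℝ} (hc : 0 ≤ c) (j : ℕ) : 0 ≤ risingCoeff c j := by
  have h := abs_risingCoeff_le c j
  rw [abs_of_nonneg hc] at h
  exact (abs_nonneg _).trans h

/-- The Chu-Vandermonde identity for rising factorials. -/
theorem risingCoeff_add (c d : ℝ) (m : ℕ) :
    risingCoeff (c + d) m =
      ∑ ij ∈ Finset.HasAntidiagonal.antidiagonal m, risingCoeff c ij.1 * risingCoeff d ij.2 := by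
  -- Upper negation turns rising factorials into generalized binomial coefficients at -c and -d. The
  -- signs (-1)^i(-1)^j = (-1)^m cancel from Vandermonde's identity.
  have key : ∀ (a : ℝ) (n : ℕ), Ring.choose (-a) n = (-1) ^ n * risingCoeff a n := by
    intro a n
    rw [Ring.choose_neg', risingCoeff_eq_multichoose, Units.smul_def, zsmul_eq_mul]
    simp
  have h := Ring.add_choose_eq (r := -c) (s := -d) m (Commute.all _ _)
  rw [← neg_add, key] at h
  have h2 : (-1 : ℝ) ^ m * risingCoeff (c + d) m = (-1) ^ m *
      ∑ ij ∈ Finset.HasAntidiagonal.antidiagonal m, risingCoeff c ij.1 * risingCoeff d ij.2 := by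
    rw [h, Finset.mul_sum]
    refine Finset.sum_congr rfl fun ij hij => ?_
    rw [key, key, ← Finset.HasAntidiagonal.mem_antidiagonal.1 hij, pow_add]
    ring
  exact mul_left_cancel₀ (by simp) h2

/-- The binomial series of (1+y)^{-c} at y = -x, whose two alternating signs cancel. -/
theorem hasSum_risingCoeff (c : ℝ) {x : ℂ} (hx : ‖x‖ < 1) :
    HasSum (fun j => (risingCoeff c j : ℂ) * x ^ j) ((1 - x) ^ (-(c : ℂ))) := by
  have h := (Complex.one_add_cpow_hasFPowerSeriesOnBall_zero (a := -(c : ℂ))).hasSum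
    (y := -x) (by simpa [enorm_eq_nnnorm, ← NNReal.coe_lt_coe] using hx)
  simp only [zero_add] at h
  rw [← sub_eq_add_neg] at h
  have e : (fun j => (risingCoeff c j : ℂ) * x ^ j) =
      fun n => (binomialSeries ℂ (-(c : ℂ)) n) fun _ => -x := by
    ext j
    rw [binomialSeries_apply, Ring.choose_neg', Units.smul_def, List.ofFn_const, List.prod_replicate,
      neg_pow, smul_eq_mul, zsmul_eq_mul, risingCoeff_eq_multichoose]
    have : ((Ring.multichoose c j : ℝ) : ℂ) = Ring.multichoose (c : ℂ) j :=
      Ring.map_multichoose (algebraMap ℝ ℂ) _ _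
    rw [this]
    have h1 : ((-1 : ℂ)) ^ j * (-1) ^ j = 1 := by rw [← mul_pow]; simp
    push_cast [Int.negOnePow]
    simp
    linear_combination (-Ring.multichoose (c : ℂ) j * x ^ j) * h1
  rw [e]
  exact h

theorem hasSum_risingCoeff_real (c : ℝ) {x : ℝ} (h0 : 0 ≤ x) (h1 : x < 1) :
    HasSum (fun j => risingCoeff c j * x ^ j) ((1 - x) ^ (-c)) := by
  have h := hasSum_risingCoeff c (x := (x : ℂ)) (by simpa [abs_of_nonneg h0] using h1)
  have e : ((1 : ℂ) - x) ^ (-(c : ℂ)) = (((1 - x) ^ (-c) : ℝ) : ℂ) := by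
    rw [Complex.ofReal_cpow (by linarith)]; push_cast; rfl
  rw [e] at h
  rw [← Complex.hasSum_ofReal]
  simpa using h

/-! ### Riemann-Liouville kernels: growth in the index and convolution. -/

/-- The Riemann-Liouville kernel `t^{b-1} / Γ(b)`. -/
noncomputable def powKer (b t : ℝ) : ℝ := t ^ (b - 1) / Real.Gamma b

theorem powKer_nonneg {b t : ℝ} (hb : 0 < b) (ht : 0 ≤ t) : 0 ≤ powKer b t :=
  div_nonneg (Real.rpow_nonneg ht _) (Real.Gamma_pos_of_pos hb).le

theorem integrableOn_rpow_mul_exp {a s : ℝ} (ha : 0 < a) (hs : 0 < s) :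
    IntegrableOn (fun t : ℝ => t ^ (a - 1) * Real.exp (-(s * t))) (Ioi 0) := by
  have := integrableOn_rpow_mul_exp_neg_mul_rpow (s := a - 1) (p := 1) (b := s)
    (by linarith) (by norm_num) hs
  simpa using this

/-- The point is the geometric decay σ^{-b} in the index, for arbitrary σ. With s = 2σ,
Γ(b+1)/s^{b+1} = ∫ x^b e^{-sx} dx is at least its part over (t, t+1], hence at least t^b
e^{-s(t+1)}. Passing from Γ(b+1) to Γ(b) costs a factor b ≤ 2^b, and the 2 in s = 2σ absorbs it. -/
theorem powKer_le {σ t b : ℝ} (hσ : 0 < σ) (ht : 0 < t) (hb : 0 < b) :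
    powKer b t ≤ Real.exp (2 * σ * (t + 1)) / (2 * σ * t) * σ ^ (-b) := by
  set s := 2 * σ with hs_def
  have hs : 0 < s := by positivity
  have hG : 0 < Real.Gamma (b + 1) := Real.Gamma_pos_of_pos (by linarith)
  have h1 := Real.integral_rpow_mul_exp_neg_mul_Ioi (a := b + 1) (by linarith) hs
  have hi := integrableOn_rpow_mul_exp (a := b + 1) (by linarith) hs
  have h2 : t ^ b * Real.exp (-(s * (t + 1))) ≤ (1 / s) ^ (b + 1) * Real.Gamma (b + 1) := by
    rw [← h1]
    have h3 : ∫ _ in Ioc t (t + 1), t ^ b * Real.exp (-(s * (t + 1))) =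
        t ^ b * Real.exp (-(s * (t + 1))) := by simp
    rw [← h3]
    refine (setIntegral_mono_on (integrableOn_const (by simp)) (hi.mono_set ?_) measurableSet_Ioc ?_).trans
      (setIntegral_mono_set hi ?_ (LE.le.eventuallyLE ?_))
    · exact fun x hx => ht.trans hx.1
    · intro x hx
      simp only [add_sub_cancel_right]
      have := hx.1; have := hx.2; have : 0 < x := by linarith
      gcongr
    · filter_upwards [ae_restrict_mem measurableSet_Ioi] with x hx
      have hx : 0 < x := hx
      simp only [Pi.zero_apply]; positivity
    · exact fun x hx => ht.trans hx.1
  have h4 : t ^ b ≤ Real.exp (s * (t + 1)) * (s ^ (-b) * s⁻¹) * Real.Gamma (b + 1) := by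
    rw [Real.exp_neg] at h2
    have e : (1 / s) ^ (b + 1) = s ^ (-b) * s⁻¹ := by
      rw [one_div, Real.inv_rpow hs.le, ← Real.rpow_neg hs.le, neg_add, Real.rpow_add hs,
        Real.rpow_neg_one]
    rw [e, ← div_eq_mul_inv, div_le_iff₀ (Real.exp_pos _)] at h2
    linarith
  -- Bernoulli's inequality needs an exponent of at least 1; for b ≤ 1 it suffices that 2^b ≥ 1.
  have h5 : b ≤ 2 ^ b := by
    have h6 := one_add_mul_self_le_rpow_one_add (s := 1) (p := max b 1) (by norm_num)
      (le_max_right _ _)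
    rcases le_total 1 b with h | h
    · rw [max_eq_left h] at h6; norm_num at h6; linarith
    · exact h.trans (Real.one_le_rpow (by norm_num) hb.le)
  have e2 : σ ^ (-b) = 2 ^ b * s ^ (-b) := by
    rw [hs_def, Real.mul_rpow (by norm_num) hσ.le, ← mul_assoc, ← Real.rpow_add (by norm_num)]
    simp
  rw [powKer, e2, div_le_iff₀ (Real.Gamma_pos_of_pos hb), Real.rpow_sub_one ht.ne',
    div_le_iff₀ ht]
  rw [Real.Gamma_add_one hb.ne'] at h4
  have hsb : 0 < s ^ (-b) := Real.rpow_pos_of_pos hs _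
  have hGb := Real.Gamma_pos_of_pos hb
  calc t ^ b ≤ Real.exp (s * (t + 1)) * (s ^ (-b) * s⁻¹) * (b * Real.Gamma b) := h4
    _ ≤ Real.exp (s * (t + 1)) * (s ^ (-b) * s⁻¹) * (2 ^ b * Real.Gamma b) := by gcongr
    _ = _ := by field_simp

theorem measurable_powKer (b : ℝ) : Measurable (powKer b) := by unfold powKer; fun_prop

theorem intervalIntegrable_betaKernel {a b t : ℝ} (ha : 0 < a) (hb : 0 < b) (ht : 0 < t) :
    IntervalIntegrable (fun τ : ℝ => (t - τ) ^ (a - 1) * τ ^ (b - 1)) volume 0 t := by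
  have hint : ∀ a' b' : ℝ, 0 < b' →
      IntervalIntegrable (fun τ : ℝ => (t - τ) ^ (a' - 1) * τ ^ (b' - 1)) volume 0 (t / 2) := by
    intro a' b' hb'
    refine IntervalIntegrable.continuousOn_mul
      (intervalIntegral.intervalIntegrable_rpow' (by linarith)) ?_
    refine ContinuousOn.rpow_const (by fun_prop) fun x hx => Or.inl ?_
    rw [uIcc_of_le (by linarith)] at hx
    linarith [hx.2]
  -- The two endpoint singularities are separated at t/2; the reflection τ ↦ t - τ reduces the right
  -- half to the left one.
  refine (hint a b hb).trans ?_
  have := (hint b a ha).comp_sub_left t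
  simp only [sub_sub_cancel, sub_zero] at this
  rw [show t - t / 2 = t / 2 by ring] at this
  simpa only [mul_comm] using this.symm

theorem integral_betaKernel {a b t : ℝ} (ha : 0 < a) (hb : 0 < b) (ht : 0 < t) :
    ∫ τ in (0 : ℝ)..t, (t - τ) ^ (a - 1) * τ ^ (b - 1) =
      t ^ (a + b - 1) * (Real.Gamma a * Real.Gamma b / Real.Gamma (a + b)) := by
  have h := Complex.betaIntegral_scaled (b : ℂ) (a : ℂ) ht
  have h2 := Complex.Gamma_mul_Gamma_eq_betaIntegral (s := (b : ℂ)) (t := (a : ℂ))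
    (by simpa) (by simpa)
  have hG : (Complex.Gamma ((b : ℂ) + a)) ≠ 0 :=
    Complex.Gamma_ne_zero_of_re_pos (by simp; linarith)
  rw [eq_comm, mul_comm, ← eq_div_iff hG] at h2
  rw [h2] at h
  apply Complex.ofReal_injective
  rw [← intervalIntegral.integral_ofReal]
  rw [add_comm a b]
  push_cast [Complex.ofReal_cpow ht.le]
  rw [← Complex.Gamma_ofReal, ← Complex.Gamma_ofReal, ← Complex.Gamma_ofReal]
  push_cast
  rw [mul_comm (Complex.Gamma (a : ℂ)), ← h]
  refine intervalIntegral.integral_congr fun x hx => ?_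
  rw [uIcc_of_le ht.le] at hx
  rw [Complex.ofReal_cpow (by linarith [hx.2]), Complex.ofReal_cpow hx.1]
  push_cast
  ring

theorem intervalIntegrable_powKer_conv {a b t : ℝ} (ha : 0 < a) (hb : 0 < b) (ht : 0 < t) :
    IntervalIntegrable (fun τ : ℝ => powKer a (t - τ) * powKer b τ) volume 0 t := by
  refine ((intervalIntegrable_betaKernel ha hb ht).const_mul
    ((Real.Gamma a)⁻¹ * (Real.Gamma b)⁻¹)).congr fun x _ => ?_
  simp only [powKer]
  ring

theorem integral_powKer_conv {a b t : ℝ} (ha : 0 < a) (hb : 0 < b) (ht : 0 < t) :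
    ∫ τ in (0 : ℝ)..t, powKer a (t - τ) * powKer b τ = powKer (a + b) t := by
  have h := integral_betaKernel ha hb ht
  have e : ∀ τ, powKer a (t - τ) * powKer b τ =
      ((Real.Gamma a)⁻¹ * (Real.Gamma b)⁻¹) * ((t - τ) ^ (a - 1) * τ ^ (b - 1)) := by
    intro τ; simp only [powKer]; ring
  simp_rw [e]
  rw [intervalIntegral.integral_const_mul, h, powKer]
  have := (Real.Gamma_pos_of_pos ha).ne'
  have := (Real.Gamma_pos_of_pos hb).ne'
  field_simp

/-! ### Laplace transforms and the power kernels. -/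

theorem norm_cexp_neg_mul_ofReal (s : ℂ) (t : ℝ) :
    ‖Complex.exp (-s * t)‖ = Real.exp (-(s.re * t)) := by
  rw [Complex.norm_exp]; simp

theorem integrableOn_powKer_laplace {s : ℂ} {b : ℝ} (hs : 0 < s.re) (hb : 0 < b) :
    IntegrableOn (fun t : ℝ => Complex.exp (-s * t) * (powKer b t : ℂ)) (Ioi 0) := by
  refine Integrable.mono' ((integrableOn_rpow_mul_exp hb hs).const_mul (Real.Gamma b)⁻¹)
    ((by fun_prop : Measurable fun t : ℝ => Complex.exp (-s * t)).mul
      (measurable_powKer b).complex_ofReal).aestronglyMeasurable ?_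
  filter_upwards [ae_restrict_mem measurableSet_Ioi] with t ht
  rw [norm_mul, norm_cexp_neg_mul_ofReal, Complex.norm_real,
    Real.norm_of_nonneg (powKer_nonneg hb (le_of_lt ht)), powKer]
  apply le_of_eq
  ring

/-- Half of the gap, δ = (Re s - c)/2, pays for the factor t produced by differentiation, since t
e^{-δt} ≤ 1/δ. The other half leaves a disc of radius δ around s on which the same majorant works.
-/
theorem hasDerivAt_laplace {f : ℝ → ℂ} {c : ℝ}
    (hf : IntegrableOn (fun t : ℝ => (Real.exp (-(c * t)) : ℂ) * f t) (Ioi 0)) {s : ℂ}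
    (hs : c < s.re) :
    IntegrableOn (fun t : ℝ => -(t : ℂ) * Complex.exp (-s * t) * f t) (Ioi 0) ∧
    HasDerivAt (fun s : ℂ => ∫ t in Ioi (0 : ℝ), Complex.exp (-s * t) * f t)
      (∫ t in Ioi (0 : ℝ), -(t : ℂ) * Complex.exp (-s * t) * f t) s := by
  set δ := (s.re - c) / 2 with hδ
  have hδ0 : 0 < δ := by rw [hδ]; linarith
  have hfm : AEStronglyMeasurable f (volume.restrict (Ioi 0)) := by
    have h := ((by fun_prop : Measurable fun t : ℝ =>
      (Real.exp (c * t) : ℂ)).aestronglyMeasurable (μ := volume.restrict (Ioi 0))).mul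
      hf.aestronglyMeasurable
    refine h.congr (Eventually.of_forall fun t => ?_)
    simp only [Pi.mul_apply]
    rw [← mul_assoc, ← Complex.ofReal_mul, ← Real.exp_add]
    simp
  have hm : ∀ s : ℂ, AEStronglyMeasurable (fun t : ℝ => Complex.exp (-s * t) * f t)
      (volume.restrict (Ioi 0)) := fun s =>
    (by fun_prop : Measurable fun t : ℝ => Complex.exp (-s * t)).aestronglyMeasurable.mul hfm
  have hcore : ∀ s' : ℂ, c + δ ≤ s'.re → ∀ t : ℝ, 0 < t →
      t * Real.exp (-(s'.re * t)) ≤ δ⁻¹ * Real.exp (-(c * t)) := by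
    intro s' hs' t ht
    have h1 : δ * t ≤ Real.exp (δ * t) := by linarith [Real.add_one_le_exp (δ * t)]
    have h2 : Real.exp (-(s'.re * t)) ≤ Real.exp (-(c * t)) * Real.exp (-(δ * t)) := by
      rw [← Real.exp_add]
      apply Real.exp_le_exp.2
      nlinarith
    rw [Real.exp_neg (δ * t)] at h2
    calc t * Real.exp (-(s'.re * t)) ≤ t * (Real.exp (-(c * t)) * (Real.exp (δ * t))⁻¹) := by
          gcongr
      _ = δ⁻¹ * Real.exp (-(c * t)) * ((δ * t) * (Real.exp (δ * t))⁻¹) := by field_simp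
      _ ≤ δ⁻¹ * Real.exp (-(c * t)) * 1 := by
          gcongr
          rw [← div_eq_mul_inv, div_le_one (Real.exp_pos _)]
          exact h1
      _ = _ := mul_one _
  refine hasDerivAt_integral_of_dominated_loc_of_deriv_le
    (F := fun (s : ℂ) (t : ℝ) => Complex.exp (-s * t) * f t)
    (F' := fun (s : ℂ) (t : ℝ) => -(t : ℂ) * Complex.exp (-s * t) * f t)
    (bound := fun t => δ⁻¹ * ‖(Real.exp (-(c * t)) : ℂ) * f t‖)
    (Metric.ball_mem_nhds s hδ0) (Eventually.of_forall hm) ?_ ?_ ?_ (hf.norm.const_mul _) ?_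
  · refine Integrable.mono' hf.norm (hm s) ?_
    filter_upwards [ae_restrict_mem measurableSet_Ioi] with t ht
    have ht : 0 < t := ht
    rw [norm_mul, norm_mul, norm_cexp_neg_mul_ofReal, Complex.norm_real, Real.norm_of_nonneg
      (Real.exp_pos _).le]
    gcongr
  · simp_rw [mul_assoc]
    exact (by fun_prop : Measurable fun t : ℝ => -(t : ℂ)).aestronglyMeasurable.mul (hm s)
  · filter_upwards [ae_restrict_mem measurableSet_Ioi] with t ht s' hs'
    have ht : 0 < t := ht
    have h1 : c + δ ≤ s'.re := by
      have h2 := (Complex.abs_re_le_norm (s' - s)).trans_lt (mem_ball_iff_norm.1 hs')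
      rw [Complex.sub_re, abs_lt] at h2
      linarith [h2.1]
    rw [norm_mul, norm_mul, norm_mul, norm_cexp_neg_mul_ofReal, Complex.norm_real, norm_neg,
      Complex.norm_real, Real.norm_of_nonneg (Real.exp_pos _).le, Real.norm_of_nonneg ht.le,
      ← mul_assoc]
    exact mul_le_mul_of_nonneg_right (hcore s' h1 t ht) (norm_nonneg _)
  · filter_upwards with t s' _
    have h1 : HasDerivAt (fun s : ℂ => -s * (t : ℂ)) (-1 * (t : ℂ)) s' :=
      (hasDerivAt_id s').neg.mul_const _
    have h2 := (h1.cexp.mul_const (f t))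
    exact h2.congr_deriv (by ring)

theorem isPreconnected_re_gt (a : ℝ) : IsPreconnected {s : ℂ | a < s.re} :=
  (convex_halfSpace_re_gt a).isPreconnected

theorem isOpen_re_gt (a : ℝ) : IsOpen {s : ℂ | a < s.re} :=
  isOpen_lt continuous_const Complex.continuous_re

theorem mem_slitPlane_of_re_pos {s : ℂ} (hs : 0 < s.re) : s ∈ Complex.slitPlane := Or.inl hs

/-- For real s this is the Gamma integral. Both sides are holomorphic in the right half-plane and
agree on real points accumulating at 1, so the identity theorem applies. -/
theorem integral_powKer_laplace {s : ℂ} {b : ℝ} (hs : 0 < s.re) (hb : 0 < b) :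
    ∫ t in Ioi (0 : ℝ), Complex.exp (-s * t) * (powKer b t : ℂ) = s ^ (-(b : ℂ)) := by
  have hreal : ∀ r : ℝ, 0 < r →
      ∫ t in Ioi (0 : ℝ), Complex.exp (-(r : ℂ) * t) * (powKer b t : ℂ) = (r : ℂ) ^ (-(b : ℂ)) := by
    intro r hr
    have h := Real.integral_rpow_mul_exp_neg_mul_Ioi hb hr
    have e : ∫ t in Ioi (0 : ℝ), Complex.exp (-(r : ℂ) * t) * (powKer b t : ℂ) =
        ∫ t in Ioi (0 : ℝ),
          (((Real.Gamma b)⁻¹ * (t ^ (b - 1) * Real.exp (-(r * t))) : ℝ) : ℂ) := by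
      refine setIntegral_congr_fun measurableSet_Ioi fun t ht => ?_
      simp only [powKer]
      push_cast
      rw [neg_mul]
      ring
    have hG := (Real.Gamma_pos_of_pos hb).ne'
    rw [e, integral_complex_ofReal, integral_const_mul, h, one_div, Real.inv_rpow hr.le,
      ← Real.rpow_neg hr.le, mul_comm, mul_assoc, mul_inv_cancel₀ hG, mul_one,
      Complex.ofReal_cpow hr.le]
    push_cast; rfl
  have hF : AnalyticOnNhd ℂ
      (fun s : ℂ => ∫ t in Ioi (0 : ℝ), Complex.exp (-s * t) * (powKer b t : ℂ))
      {s | 0 < s.re} := by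
    refine DifferentiableOn.analyticOnNhd (fun s hs => ?_) (isOpen_re_gt 0)
    have hs : 0 < s.re := hs
    refine (hasDerivAt_laplace (c := s.re / 2) ?_
      (by linarith)).2.differentiableAt.differentiableWithinAt
    have := integrableOn_powKer_laplace (s := ((s.re / 2 : ℝ) : ℂ)) (b := b)
      (by simpa using hs) hb
    refine this.congr_fun (fun t _ => ?_) measurableSet_Ioi
    push_cast
    rw [neg_mul]
  have hG : AnalyticOnNhd ℂ (fun s : ℂ => s ^ (-(b : ℂ))) {s | 0 < s.re} := by
    refine DifferentiableOn.analyticOnNhd (fun s hs => ?_) (isOpen_re_gt 0)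
    exact ((hasDerivAt_id s).cpow_const (mem_slitPlane_of_re_pos
      hs)).differentiableAt.differentiableWithinAt
  refine hF.eqOn_of_preconnected_of_frequently_eq hG (isPreconnected_re_gt 0)
    (z₀ := ((1 : ℝ) : ℂ)) (by simp) ?_ hs
  have htend : Tendsto (fun x : ℝ => (x : ℂ)) (𝓝[>] 1) (𝓝[≠] ((1 : ℝ) : ℂ)) := by
    refine tendsto_nhdsWithin_iff.2
      ⟨(Complex.continuous_ofReal.tendsto 1).mono_left nhdsWithin_le_nhds, ?_⟩
    filter_upwards [self_mem_nhdsWithin] with x hx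
    simpa using (ne_of_gt hx : x ≠ 1)
  refine htend.frequently (Eventually.frequently ?_)
  filter_upwards [self_mem_nhdsWithin] with x hx
  exact hreal x (zero_lt_one.trans hx)

/-! ### The Prabhakar kernel: convergence, majorants, regularity. -/

theorem prabhakarKernel_eq_tsum (α β c ω : ℝ) {t : ℝ} (ht : 0 < t) :
    prabhakarKernel α β c ω t =
      ∑' j : ℕ, risingCoeff c j * ω ^ j * powKer (α * j + β) t := by
  rw [prabhakarKernel, prabhakarE, ← tsum_mul_left]
  refine tsum_congr fun j => ?_
  have e : t ^ (α * j + β - 1) = t ^ (β - 1) * (t ^ α) ^ j := by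
    rw [← Real.rpow_mul_natCast ht.le, ← Real.rpow_add ht]
    congr 1; ring
  rw [powKer, e, risingCoeff, mul_pow]
  ring

/-- The condition |ω|σ^{-α} < 1 places ωσ^{-α} inside the disc of convergence of the binomial
series. -/
theorem exists_abscissa {α : ℝ} (hα : 0 < α) (ω : ℝ) :
    ∀ᶠ σ : ℝ in atTop, 0 < σ ∧ |ω| * σ ^ (-α) < 1 := by
  have h : Tendsto (fun σ : ℝ => |ω| * σ ^ (-α)) atTop (𝓝 (|ω| * 0)) :=
    (tendsto_rpow_neg_atTop hα).const_mul _
  rw [mul_zero] at h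
  exact (eventually_gt_atTop 0).and (h.eventually (gt_mem_nhds one_pos))

section Kernel

variable {α β : ℝ}

theorem kernelTerm_nonneg (hα : 0 < α) (hβ : 0 < β) {c ω t : ℝ} (hc : 0 ≤ c) (hω : 0 ≤ ω)
    (ht : 0 < t) (j : ℕ) : 0 ≤ risingCoeff c j * ω ^ j * powKer (α * j + β) t :=
  mul_nonneg (mul_nonneg (risingCoeff_nonneg hc j) (pow_nonneg hω j))
    (powKer_nonneg (by positivity) ht.le)

theorem norm_kernelTerm_le (hα : 0 < α) (hβ : 0 < β) {c ω t : ℝ} (ht : 0 < t) (j : ℕ) :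
    ‖risingCoeff c j * ω ^ j * powKer (α * j + β) t‖ ≤
      risingCoeff |c| j * |ω| ^ j * powKer (α * j + β) t := by
  have h := powKer_nonneg (b := α * j + β) (by positivity) ht.le
  rw [Real.norm_eq_abs, abs_mul, abs_mul, abs_pow, abs_of_nonneg h]
  gcongr
  exact abs_risingCoeff_le c j

/-- `powKer_le` with index αj+β turns the kernel series into a binomial series at ωσ^{-α}. -/
theorem kernelTerm_le (hα : 0 < α) (hβ : 0 < β) {c ω t σ : ℝ} (hc : 0 ≤ c) (hω : 0 ≤ ω)
    (ht : 0 < t) (hσ : 0 < σ) (j : ℕ) :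
    risingCoeff c j * ω ^ j * powKer (α * j + β) t ≤
      Real.exp (2 * σ * (t + 1)) / (2 * σ * t) * σ ^ (-β) *
        (risingCoeff c j * (ω * σ ^ (-α)) ^ j) := by
  have h := powKer_le hσ ht (b := α * j + β) (by positivity)
  have e : σ ^ (-(α * j + β)) = σ ^ (-β) * (σ ^ (-α)) ^ j := by
    rw [← Real.rpow_mul_natCast hσ.le, ← Real.rpow_add hσ]
    congr 1; ring
  rw [e] at h
  calc _ ≤ risingCoeff c j * ω ^ j *
        (Real.exp (2 * σ * (t + 1)) / (2 * σ * t) * (σ ^ (-β) * (σ ^ (-α)) ^ j)) :=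
        mul_le_mul_of_nonneg_left h (mul_nonneg (risingCoeff_nonneg hc j) (pow_nonneg hω j))
    _ = _ := by rw [mul_pow]; ring

theorem summable_kernelTerm_of_nonneg (hα : 0 < α) (hβ : 0 < β) {c ω t : ℝ} (hc : 0 ≤ c)
    (hω : 0 ≤ ω) (ht : 0 < t) :
    Summable fun j : ℕ => risingCoeff c j * ω ^ j * powKer (α * j + β) t := by
  obtain ⟨σ, hσ, hx⟩ := (exists_abscissa hα ω).exists
  rw [abs_of_nonneg hω] at hx
  exact Summable.of_nonneg_of_le (kernelTerm_nonneg hα hβ hc hω ht)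
    (kernelTerm_le hα hβ hc hω ht hσ)
    ((hasSum_risingCoeff_real c (by positivity) hx).summable.mul_left _)

theorem summable_norm_kernelTerm (hα : 0 < α) (hβ : 0 < β) (c ω : ℝ) {t : ℝ} (ht : 0 < t) :
    Summable fun j : ℕ => ‖risingCoeff c j * ω ^ j * powKer (α * j + β) t‖ :=
  Summable.of_nonneg_of_le (fun _ => norm_nonneg _) (norm_kernelTerm_le hα hβ ht)
    (summable_kernelTerm_of_nonneg hα hβ (abs_nonneg c) (abs_nonneg ω) ht)

theorem prabhakarKernel_nonneg (hα : 0 < α) (hβ : 0 < β) {c ω t : ℝ} (hc : 0 ≤ c) (hω : 0 ≤ ω)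
    (ht : 0 < t) : 0 ≤ prabhakarKernel α β c ω t := by
  rw [prabhakarKernel_eq_tsum α β c ω ht]
  exact tsum_nonneg (kernelTerm_nonneg hα hβ hc hω ht)

theorem abs_prabhakarKernel_le (hα : 0 < α) (hβ : 0 < β) (c ω : ℝ) {t : ℝ} (ht : 0 < t) :
    |prabhakarKernel α β c ω t| ≤ prabhakarKernel α β |c| |ω| t := by
  rw [← Real.norm_eq_abs, prabhakarKernel_eq_tsum α β c ω ht, prabhakarKernel_eq_tsum α β |c| |ω| ht]
  refine (norm_tsum_le_tsum_norm (summable_norm_kernelTerm hα hβ c ω ht)).trans ?_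
  exact Summable.tsum_le_tsum (norm_kernelTerm_le hα hβ ht) (summable_norm_kernelTerm hα hβ c ω ht)
    (summable_kernelTerm_of_nonneg hα hβ (abs_nonneg c) (abs_nonneg ω) ht)

/-- Both indices enter the bound only as exponents. When they grow linearly in n, the bound is
therefore geometric in n. -/
theorem prabhakarKernel_le (hα : 0 < α) (hβ : 0 < β) {c ω t σ : ℝ} (hc : 0 ≤ c) (hω : 0 ≤ ω)
    (ht : 0 < t) (hσ : 0 < σ) (hx : ω * σ ^ (-α) < 1) :
    prabhakarKernel α β c ω t ≤ Real.exp (2 * σ * (t + 1)) / (2 * σ * t) *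
      (σ ^ (-β) * (1 - ω * σ ^ (-α)) ^ (-c)) := by
  have h := hasSum_risingCoeff_real c (x := ω * σ ^ (-α)) (by positivity) hx
  rw [prabhakarKernel_eq_tsum α β c ω ht, ← mul_assoc, ← h.tsum_eq, ← tsum_mul_left]
  exact Summable.tsum_le_tsum (kernelTerm_le hα hβ hc hω ht hσ)
    (summable_kernelTerm_of_nonneg hα hβ hc hω ht) (h.summable.mul_left _)

theorem prabhakarE_eq_kernel (α β c z : ℝ) : prabhakarE α β c z = prabhakarKernel α β c z 1 := by
  simp [prabhakarKernel]

theorem prabhakarETerm_eq (α β c z : ℝ) (j : ℕ) :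
    (ascPochhammer ℝ j).eval c / Real.Gamma (α * j + β) * (z ^ j / (j.factorial : ℝ)) =
      risingCoeff c j * z ^ j * powKer (α * j + β) 1 := by
  rw [risingCoeff, powKer, Real.one_rpow]
  ring

theorem abs_prabhakarE_le (hα : 0 < α) (hβ : 0 < β) (c : ℝ) {z R : ℝ} (hz : |z| ≤ R) :
    |prabhakarE α β c z| ≤ prabhakarE α β |c| R := by
  have h := abs_prabhakarKernel_le hα hβ c z one_pos
  rw [← prabhakarE_eq_kernel] at h
  refine h.trans ?_
  rw [prabhakarE_eq_kernel, prabhakarKernel_eq_tsum _ _ _ _ one_pos,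
    prabhakarKernel_eq_tsum _ _ _ _ one_pos]
  have hR : 0 ≤ R := (abs_nonneg z).trans hz
  refine Summable.tsum_le_tsum (fun j => ?_)
    (summable_kernelTerm_of_nonneg hα hβ (abs_nonneg c) (abs_nonneg z) one_pos)
    (summable_kernelTerm_of_nonneg hα hβ (abs_nonneg c) hR one_pos)
  have := risingCoeff_nonneg (abs_nonneg c) j
  have := powKer_nonneg (b := α * j + β) (t := 1) (by positivity) zero_le_one
  gcongr

theorem continuous_prabhakarE (hα : 0 < α) (hβ : 0 < β) (c : ℝ) :
    Continuous (prabhakarE α β c) := by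
  have key : ∀ R : ℝ, ContinuousOn (prabhakarE α β c) (Metric.ball 0 R) := by
    intro R
    unfold prabhakarE
    simp_rw [prabhakarETerm_eq]
    refine continuousOn_tsum (u := fun j : ℕ => risingCoeff |c| j * |R| ^ j * powKer (α * j + β) 1)
      (fun j => by fun_prop)
      (summable_kernelTerm_of_nonneg hα hβ (abs_nonneg c) (abs_nonneg R) one_pos) ?_
    intro j z hz
    refine (norm_kernelTerm_le hα hβ one_pos j).trans ?_
    have := risingCoeff_nonneg (abs_nonneg c) j
    have := powKer_nonneg (b := α * j + β) (t := 1) (by positivity) zero_le_one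
    have : |z| ≤ |R| := (le_of_lt (by simpa using hz)).trans (le_abs_self R)
    gcongr
  refine continuous_iff_continuousAt.2 fun z => ?_
  refine (key (|z| + 1)).continuousAt (Metric.isOpen_ball.mem_nhds ?_)
  simp

theorem continuousOn_prabhakarKernel (hα : 0 < α) (hβ : 0 < β) (c ω : ℝ) :
    ContinuousOn (prabhakarKernel α β c ω) (Ioi 0) := by
  unfold prabhakarKernel
  refine ContinuousOn.mul (continuousOn_id.rpow_const fun x hx => Or.inl (ne_of_gt hx)) ?_
  exact (continuous_prabhakarE hα hβ c).comp_continuousOn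
    ((continuousOn_id.rpow_const fun x hx => Or.inl (ne_of_gt hx)).const_mul ω |>.congr
      fun x _ => rfl)

theorem measurable_prabhakarKernel (hα : 0 < α) (hβ : 0 < β) (c ω : ℝ) :
    Measurable (prabhakarKernel α β c ω) := by
  unfold prabhakarKernel
  have := (continuous_prabhakarE hα hβ c).measurable
  fun_prop

/-- Isolates the singularity t^{β-1} at 0, so that convolutions can be compared with the Beta
integral. -/
theorem abs_prabhakarKernel_le_rpow (hα : 0 < α) (hβ : 0 < β) (c ω : ℝ) {t T : ℝ} (ht : 0 < t)
    (hT : t ≤ T) :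
    |prabhakarKernel α β c ω t| ≤ prabhakarE α β |c| (|ω| * T ^ α) * t ^ (β - 1) := by
  rw [prabhakarKernel, abs_mul, abs_of_nonneg (Real.rpow_nonneg ht.le _), mul_comm]
  gcongr
  refine abs_prabhakarE_le hα hβ c ?_
  rw [abs_mul, abs_of_nonneg (Real.rpow_nonneg ht.le _)]
  gcongr

end Kernel

/-- Only j = 0 survives when the upper index is 0. Convolution with e^0_1 is thus plain integration,
which is how d/dt enters later. -/
theorem prabhakarKernel_zero_one (α ω : ℝ) {t : ℝ} (ht : 0 < t) :
    prabhakarKernel α 1 0 ω t = 1 := by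
  rw [prabhakarKernel_eq_tsum _ _ _ _ ht, tsum_eq_single 0]
  · simp [powKer]
  · intro j hj
    simp [risingCoeff_zero_left hj]

/-! ### The convolution semigroup law. -/

/-- A product `k(t - τ) f(τ)` of functions bounded by powers is integrable on `(0, t)`. -/
theorem intervalIntegrable_conv_of_bound {k : ℝ → ℝ} {f : ℝ → ℂ} {a b A B t : ℝ} (ha : 0 < a)
    (hb : 0 < b) (ht : 0 < t) (hkm : Measurable k)
    (hfm : AEStronglyMeasurable f (volume.restrict (Ioc 0 t)))
    (hk : ∀ τ ∈ Ioc 0 t, |k τ| ≤ A * τ ^ (a - 1)) (hf : ∀ τ ∈ Ioc 0 t, ‖f τ‖ ≤ B * τ ^ (b - 1)) :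
    IntervalIntegrable (fun τ => (k (t - τ) : ℂ) * f τ) volume 0 t ∧
    ‖∫ τ in (0 : ℝ)..t, (k (t - τ) : ℂ) * f τ‖ ≤
      A * B * (t ^ (a + b - 1) * (Real.Gamma a * Real.Gamma b / Real.Gamma (a + b))) := by
  have hle : ∀ᵐ τ, τ ∈ Ioc 0 t → ‖(k (t - τ) : ℂ) * f τ‖ ≤
      A * B * ((t - τ) ^ (a - 1) * τ ^ (b - 1)) := by
    filter_upwards [volume.ae_ne t] with τ hne hτ
    have h1 := hk (t - τ) ⟨by have := lt_of_le_of_ne hτ.2 hne; linarith, by linarith [hτ.1]⟩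
    have h2 := hf τ hτ
    rw [norm_mul, Complex.norm_real, Real.norm_eq_abs]
    calc _ ≤ (A * (t - τ) ^ (a - 1)) * (B * τ ^ (b - 1)) :=
          mul_le_mul h1 h2 (norm_nonneg _) ((abs_nonneg _).trans h1)
      _ = _ := by ring
  have hint := (intervalIntegrable_betaKernel ha hb ht).const_mul (A * B)
  refine ⟨?_, ?_⟩
  · rw [intervalIntegrable_iff_integrableOn_Ioc_of_le ht.le] at hint ⊢
    refine Integrable.mono' hint ?_ ((ae_restrict_iff' measurableSet_Ioc).2 hle)
    exact ((hkm.comp (measurable_const.sub measurable_id)).complex_ofReal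
      |>.aestronglyMeasurable).mul hfm
  · refine (intervalIntegral.norm_integral_le_of_norm_le ht.le hle hint).trans (le_of_eq ?_)
    rw [intervalIntegral.integral_const_mul, integral_betaKernel ha hb ht]

/-- Multiply the two series and integrate termwise: each pair (i,j) yields a power kernel of index
α(i+j)+a+b, which depends only on i+j. The coefficients along i+j = m add up by Chu-Vandermonde. -/
theorem integral_prabhakarKernel_conv {α a b : ℝ} (hα : 0 < α) (ha : 0 < a) (hb : 0 < b)
    (c d ω : ℝ) {t : ℝ} (ht : 0 < t) :
    ∫ τ in (0 : ℝ)..t, prabhakarKernel α a c ω (t - τ) * prabhakarKernel α b d ω τ =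
      prabhakarKernel α (a + b) (c + d) ω t := by
  set F : ℕ × ℕ → ℝ → ℝ := fun ij τ =>
    (risingCoeff c ij.1 * ω ^ ij.1 * powKer (α * ij.1 + a) (t - τ)) *
      (risingCoeff d ij.2 * ω ^ ij.2 * powKer (α * ij.2 + b) τ) with hF
  have hpos : ∀ (b : ℝ) (j : ℕ), 0 < b → 0 < α * j + b := fun b j hb => by positivity
  have hFeq : ∀ ij, F ij = fun τ => (risingCoeff c ij.1 * ω ^ ij.1 * (risingCoeff d ij.2 *
      ω ^ ij.2)) * (powKer (α * ij.1 + a) (t - τ) * powKer (α * ij.2 + b) τ) := by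
    intro ij; ext τ; simp only [hF]; ring
  have hFint : ∀ ij, IntegrableOn (F ij) (Ioc 0 t) := by
    intro ij
    rw [← intervalIntegrable_iff_integrableOn_Ioc_of_le ht.le, hFeq]
    exact (intervalIntegrable_powKer_conv (hpos _ _ ha) (hpos _ _ hb) ht).const_mul _
  have hadd : ∀ ij : ℕ × ℕ, α * ij.1 + a + (α * ij.2 + b) = α * (ij.1 + ij.2 : ℕ) + (a + b) := by
    intro ij; push_cast; ring
  have hFval : ∀ ij, ∫ τ in Ioc 0 t, F ij τ = (risingCoeff c ij.1 * ω ^ ij.1 *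
      (risingCoeff d ij.2 * ω ^ ij.2)) * powKer (α * (ij.1 + ij.2 : ℕ) + (a + b)) t := by
    intro ij
    rw [hFeq, integral_const_mul, ← intervalIntegral.integral_of_le ht.le,
      integral_powKer_conv (hpos _ _ ha) (hpos _ _ hb) ht, hadd]
  have hFnorm : ∀ ij, ∫ τ in Ioc 0 t, ‖F ij τ‖ = |risingCoeff c ij.1 * ω ^ ij.1 *
      (risingCoeff d ij.2 * ω ^ ij.2)| * powKer (α * (ij.1 + ij.2 : ℕ) + (a + b)) t := by
    intro ij
    rw [← hadd, ← integral_powKer_conv (hpos _ _ ha) (hpos _ _ hb) ht,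
      intervalIntegral.integral_of_le ht.le, ← integral_const_mul]
    refine setIntegral_congr_fun measurableSet_Ioc fun τ hτ => ?_
    simp only [hFeq]
    rw [norm_mul, Real.norm_eq_abs, Real.norm_of_nonneg (mul_nonneg
      (powKer_nonneg (hpos _ _ ha) (by linarith [hτ.2])) (powKer_nonneg (hpos _ _ hb) hτ.1.le))]
  -- Because σ^{-(α(i+j)+a+b)} splits as a product, the double series is dominated by a product of
  -- two convergent binomial series.
  have hsum : Summable fun ij => ∫ τ in Ioc 0 t, ‖F ij τ‖ := by
    obtain ⟨σ, hσ, hx⟩ := (exists_abscissa hα ω).exists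
    have h1 := (hasSum_risingCoeff_real |c| (x := |ω| * σ ^ (-α)) (by positivity) hx).summable
    have h2 := (hasSum_risingCoeff_real |d| (x := |ω| * σ ^ (-α)) (by positivity) hx).summable
    have h12 := (h1.mul_of_nonneg h2
      (fun j => mul_nonneg (risingCoeff_nonneg (abs_nonneg _) _) (by positivity))
      (fun j => mul_nonneg (risingCoeff_nonneg (abs_nonneg _) _) (by positivity))).mul_left
      (Real.exp (2 * σ * (t + 1)) / (2 * σ * t) * σ ^ (-(a + b)))
    refine Summable.of_nonneg_of_le (fun ij => integral_nonneg fun _ => norm_nonneg _)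
      (fun ij => ?_) h12
    rw [hFnorm]
    have h := powKer_le hσ ht (hpos (a + b) (ij.1 + ij.2) (by linarith))
    have e : σ ^ (-(α * ((ij.1 + ij.2 : ℕ) : ℝ) + (a + b))) =
        σ ^ (-(a + b)) * ((σ ^ (-α)) ^ ij.1 * (σ ^ (-α)) ^ ij.2) := by
      rw [← pow_add, ← Real.rpow_mul_natCast hσ.le, ← Real.rpow_add hσ]
      congr 1; ring
    rw [e] at h
    rw [abs_mul, abs_mul, abs_mul, abs_pow, abs_pow]
    have hc := abs_risingCoeff_le c ij.1
    have hd := abs_risingCoeff_le d ij.2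
    have hc0 := risingCoeff_nonneg (abs_nonneg c) ij.1
    have hd0 := risingCoeff_nonneg (abs_nonneg d) ij.2
    calc _ ≤ (risingCoeff |c| ij.1 * |ω| ^ ij.1 * (risingCoeff |d| ij.2 * |ω| ^ ij.2)) *
          (Real.exp (2 * σ * (t + 1)) / (2 * σ * t) *
            (σ ^ (-(a + b)) * ((σ ^ (-α)) ^ ij.1 * (σ ^ (-α)) ^ ij.2))) := by
          have := powKer_nonneg (hpos (a + b) (ij.1 + ij.2) (by linarith)) ht.le
          gcongr
      _ = _ := by rw [mul_pow, mul_pow]; ring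
  have hHS := hasSum_integral_of_summable_integral_norm hFint hsum
  have hpt : ∫ τ in Ioc 0 t, (∑' ij, F ij τ) =
      ∫ τ in (0 : ℝ)..t, prabhakarKernel α a c ω (t - τ) * prabhakarKernel α b d ω τ := by
    rw [intervalIntegral.integral_of_le ht.le]
    refine setIntegral_congr_ae measurableSet_Ioc ?_
    filter_upwards [volume.ae_ne t] with τ hne hτ
    have h1 : 0 < t - τ := by have := lt_of_le_of_ne hτ.2 hne; linarith
    rw [prabhakarKernel_eq_tsum _ _ _ _ h1, prabhakarKernel_eq_tsum _ _ _ _ hτ.1]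
    exact (tsum_mul_tsum_of_summable_norm (summable_norm_kernelTerm hα ha c ω h1)
      (summable_norm_kernelTerm hα hb d ω hτ.1)).symm
  rw [← hpt, ← hHS.tsum_eq, prabhakarKernel_eq_tsum _ _ _ _ ht]
  simp_rw [hFval] at hHS ⊢
  -- Regroup the double series along the antidiagonals i+j = n, where `risingCoeff_add` applies.
  rw [← (Finset.HasAntidiagonal.sigmaAntidiagonalEquivProd (A := ℕ)).tsum_eq]
  have h := ((Finset.HasAntidiagonal.sigmaAntidiagonalEquivProd (A := ℕ)).summable_iff.2
    hHS.summable).tsum_sigma' fun n => (hasSum_fintype _).summable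
  refine h.trans ?_
  refine tsum_congr fun n => ?_
  rw [tsum_fintype, risingCoeff_add, Finset.sum_mul, Finset.sum_mul]
  refine Eq.trans (Finset.sum_congr rfl fun ij _ => ?_)
    (Finset.sum_coe_sort (Finset.HasAntidiagonal.antidiagonal n) fun ij : ℕ × ℕ =>
      risingCoeff c ij.1 * risingCoeff d ij.2 * ω ^ n * powKer (α * n + (a + b)) t)
  have hij : ij.1.1 + ij.1.2 = n := Finset.HasAntidiagonal.mem_antidiagonal.1 ij.2
  simp only [Function.comp_apply, Finset.HasAntidiagonal.sigmaAntidiagonalEquivProd_apply, hij]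
  have e : ω ^ n = ω ^ ij.1.1 * ω ^ ij.1.2 := by rw [← pow_add, hij]
  rw [e]
  ring

/-! ### Laplace transform of the Prabhakar kernel. -/

/-- Tonelli for the extended norms controls the limit function by the sum of the integrated norms.
This gives its integrability and a bound for its norm, in addition to termwise integration. -/
theorem integrable_of_hasSum {X ι E : Type*} [MeasurableSpace X] {μ : Measure X} [Countable ι]
    [NormedAddCommGroup E] [NormedSpace ℝ E] [CompleteSpace E] {F : ι → X → E} {g : X → E}
    (hg : AEStronglyMeasurable g μ) (hF : ∀ i, Integrable (F i) μ)
    (hsum : Summable fun i => ∫ a, ‖F i a‖ ∂μ) (hlim : ∀ᵐ a ∂μ, HasSum (fun i => F i a) (g a)) :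
    Integrable g μ ∧ HasSum (fun i => ∫ a, F i a ∂μ) (∫ a, g a ∂μ) ∧
      ∫ a, ‖g a‖ ∂μ ≤ ∑' i, ∫ a, ‖F i a‖ ∂μ := by
  have hle : ∫⁻ a, ‖g a‖ₑ ∂μ ≤ ENNReal.ofReal (∑' i, ∫ a, ‖F i a‖ ∂μ) := by
    calc ∫⁻ a, ‖g a‖ₑ ∂μ ≤ ∫⁻ a, ∑' i, ‖F i a‖ₑ ∂μ := by
          refine lintegral_mono_ae ?_
          filter_upwards [hlim] with a ha
          rw [← ha.tsum_eq]
          exact enorm_tsum_le_tsum_enorm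
      _ = ∑' i, ∫⁻ a, ‖F i a‖ₑ ∂μ := lintegral_tsum fun i => (hF i).1.enorm
      _ = ∑' i, ENNReal.ofReal (∫ a, ‖F i a‖ ∂μ) := by
          refine tsum_congr fun i => ?_
          rw [ofReal_integral_norm_eq_lintegral_enorm (hF i)]
      _ = _ := (ENNReal.ofReal_tsum_of_nonneg (fun i => integral_nonneg fun _ => norm_nonneg _)
          hsum).symm
  refine ⟨⟨hg, hle.trans_lt ENNReal.ofReal_lt_top⟩, ?_, ?_⟩
  · have h := hasSum_integral_of_summable_integral_norm hF hsum
    rwa [integral_congr_ae (g := g) (hlim.mono fun a ha => ha.tsum_eq)] at h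
  · rw [integral_norm_eq_lintegral_enorm hg]
    exact ENNReal.toReal_le_of_le_ofReal
      (tsum_nonneg fun i => integral_nonneg fun _ => norm_nonneg _) hle

theorem integral_norm_powKer_laplace {s : ℂ} {b : ℝ} (hs : 0 < s.re) (hb : 0 < b) :
    ∫ t in Ioi (0 : ℝ), ‖Complex.exp (-s * t) * (powKer b t : ℂ)‖ = s.re ^ (-b) := by
  have h := Real.integral_rpow_mul_exp_neg_mul_Ioi hb hs
  have e : ∫ t in Ioi (0 : ℝ), ‖Complex.exp (-s * t) * (powKer b t : ℂ)‖ =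
      ∫ t in Ioi (0 : ℝ), (Real.Gamma b)⁻¹ * (t ^ (b - 1) * Real.exp (-(s.re * t))) := by
    refine setIntegral_congr_fun measurableSet_Ioi fun t ht => ?_
    rw [norm_mul, norm_cexp_neg_mul_ofReal, Complex.norm_real,
      Real.norm_of_nonneg (powKer_nonneg hb (le_of_lt ht)), powKer]
    ring
  have hG := (Real.Gamma_pos_of_pos hb).ne'
  rw [e, integral_const_mul, h, one_div, Real.inv_rpow hs.le, ← Real.rpow_neg hs.le, mul_comm,
    mul_assoc, mul_inv_cancel₀ hG, mul_one]

theorem norm_cpow_neg_ofReal_le {s : ℂ} (hs : 0 < s.re) {a : ℝ} (ha : 0 ≤ a) :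
    ‖s ^ (-(a : ℂ))‖ ≤ s.re ^ (-a) := by
  have hs0 : s ≠ 0 := fun h => by simp [h] at hs
  have e : (-(a : ℂ)) = ((-a : ℝ) : ℂ) := by push_cast; rfl
  rw [e, Complex.norm_cpow_real]
  exact Real.rpow_le_rpow_of_nonpos hs (Complex.re_le_norm s) (by linarith)

/-- The Laplace transform of the Prabhakar kernel. -/
theorem laplace_prabhakarKernel {α β : ℝ} (hα : 0 < α) (hβ : 0 < β) (c ω : ℝ) {s : ℂ}
    (hs : 0 < s.re) (hx : |ω| * s.re ^ (-α) < 1) :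
    IntegrableOn (fun t : ℝ => Complex.exp (-s * t) * (prabhakarKernel α β c ω t : ℂ)) (Ioi 0) ∧
    ∫ t in Ioi (0 : ℝ), Complex.exp (-s * t) * (prabhakarKernel α β c ω t : ℂ) =
      s ^ (-(β : ℂ)) * (1 - ω * s ^ (-(α : ℂ))) ^ (-(c : ℂ)) ∧
    ∫ t in Ioi (0 : ℝ), ‖Complex.exp (-s * t) * (prabhakarKernel α β c ω t : ℂ)‖ ≤
      s.re ^ (-β) * (1 - |ω| * s.re ^ (-α)) ^ (-|c|) := by
  have hs0 : s ≠ 0 := fun h => by simp [h] at hs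
  have hpos : ∀ j : ℕ, 0 < α * j + β := fun j => by positivity
  set F : ℕ → ℝ → ℂ := fun j t => (risingCoeff c j * ω ^ j : ℂ) *
    (Complex.exp (-s * t) * (powKer (α * j + β) t : ℂ)) with hF
  have hFint : ∀ j, IntegrableOn (F j) (Ioi 0) := fun j =>
    (integrableOn_powKer_laplace hs (hpos j)).const_mul _
  -- The integrated norms are bounded by the terms of the binomial series at |ω|(Re s)^{-α}; this
  -- justifies termwise integration and gives the norm bound.
  have hFnorm : ∀ j, ∫ t in Ioi (0 : ℝ), ‖F j t‖ ≤
      s.re ^ (-β) * (risingCoeff |c| j * (|ω| * s.re ^ (-α)) ^ j) := by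
    intro j
    simp only [hF]
    simp_rw [norm_mul (_ * _ : ℂ) (Complex.exp _ * _)]
    rw [integral_const_mul, integral_norm_powKer_laplace hs (hpos j)]
    have e : s.re ^ (-(α * j + β)) = s.re ^ (-β) * (s.re ^ (-α)) ^ j := by
      rw [← Real.rpow_mul_natCast hs.le, ← Real.rpow_add hs]
      congr 1; ring
    rw [norm_mul, norm_pow, Complex.norm_real, Complex.norm_real, Real.norm_eq_abs,
      Real.norm_eq_abs, e]
    calc _ ≤ risingCoeff |c| j * |ω| ^ j * (s.re ^ (-β) * (s.re ^ (-α)) ^ j) := by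
          gcongr
          exact abs_risingCoeff_le c j
      _ = _ := by rw [mul_pow]; ring
  have hgeo := (hasSum_risingCoeff_real |c| (x := |ω| * s.re ^ (-α)) (by positivity) hx).mul_left
    (s.re ^ (-β))
  have hFsum : Summable fun j => ∫ t in Ioi (0 : ℝ), ‖F j t‖ :=
    Summable.of_nonneg_of_le (fun j => integral_nonneg fun _ => norm_nonneg _) hFnorm hgeo.summable
  have hmeas : AEStronglyMeasurable (fun t : ℝ => Complex.exp (-s * t) *
      (prabhakarKernel α β c ω t : ℂ)) (volume.restrict (Ioi 0)) :=
    ((by fun_prop : Measurable fun t : ℝ => Complex.exp (-s * t)).mul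
      (measurable_prabhakarKernel hα hβ c ω).complex_ofReal).aestronglyMeasurable
  obtain ⟨h1, h2, h3⟩ := integrable_of_hasSum hmeas hFint hFsum (by
    filter_upwards [ae_restrict_mem measurableSet_Ioi] with t ht
    rw [prabhakarKernel_eq_tsum _ _ _ _ ht]
    have h := Complex.hasSum_ofReal.2 (summable_norm_kernelTerm hα hβ c ω ht).of_norm.hasSum
    refine (h.mul_left (Complex.exp (-s * t))).congr_fun fun j => ?_
    simp only [hF]
    push_cast
    ring)
  refine ⟨h1, h2.unique ?_, h3.trans ?_⟩
  · have hx' : ‖(ω : ℂ) * s ^ (-(α : ℂ))‖ < 1 := by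
      rw [norm_mul, Complex.norm_real, Real.norm_eq_abs]
      exact (mul_le_mul_of_nonneg_left (norm_cpow_neg_ofReal_le hs hα.le) (abs_nonneg _)).trans_lt hx
    refine ((hasSum_risingCoeff c hx').mul_left (s ^ (-(β : ℂ)))).congr_fun fun j => ?_
    simp only [hF]
    rw [integral_const_mul, integral_powKer_laplace hs (hpos j), mul_pow, ← Complex.cpow_mul_nat]
    have e : s ^ (-((α * j + β : ℝ) : ℂ)) = s ^ (-(β : ℂ)) * s ^ (-(α : ℂ) * j) := by
      rw [← Complex.cpow_add _ _ hs0]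
      congr 1; push_cast; ring
    rw [e]
    ring
  · rw [← hgeo.tsum_eq]
    exact hFsum.tsum_le_tsum hFnorm hgeo.summable

/-! ### Series of Prabhakar kernels in powers of z. -/

/-- The series `∑_n z^n e^{γ n + c}_{α, ρ n + β, ω}(t)` of Prabhakar kernels. -/
noncomputable def prabhakarSeries (α ρ γ ω β c : ℝ) (z : ℂ) (t : ℝ) : ℂ :=
  ∑' n : ℕ, z ^ n * (prabhakarKernel α (ρ * n + β) (γ * n + c) ω t : ℂ)

/-- The left side of the last inequality is the ratio of the geometric majorant of the series for
|z| ≤ R. It tends to 0 as σ → ∞, but an admissible σ depends on R. This lack of uniformity in z is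
what the later contour shift repairs. -/
theorem exists_abscissa_series {α ρ : ℝ} (hα : 0 < α) (hρ : 0 < ρ) (γ ω R : ℝ) :
    ∀ᶠ σ : ℝ in atTop, 0 < σ ∧ |ω| * σ ^ (-α) < 1 ∧
      R * (σ ^ (-ρ) * (1 - |ω| * σ ^ (-α)) ^ (-γ)) < 1 := by
  have h : Tendsto (fun σ : ℝ => |ω| * σ ^ (-α)) atTop (𝓝 (|ω| * 0)) :=
    (tendsto_rpow_neg_atTop hα).const_mul _
  rw [mul_zero] at h
  have h1 : Tendsto (fun σ : ℝ => R * (σ ^ (-ρ) * (1 - |ω| * σ ^ (-α)) ^ (-γ))) atTop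
      (𝓝 (R * (0 * (1 - 0) ^ (-γ)))) :=
    ((tendsto_rpow_neg_atTop hρ).mul
      ((tendsto_const_nhds.sub h).rpow_const (Or.inl (by norm_num)))).const_mul R
  rw [zero_mul, mul_zero] at h1
  filter_upwards [exists_abscissa hα ω, h1.eventually (gt_mem_nhds one_pos)] with σ h2 h3
  exact ⟨h2.1, h2.2, h3⟩

section Series

variable {α ρ γ ω β : ℝ}

/-- By `prabhakarKernel_le` the terms are dominated by a geometric series. The upper index need only
be bounded by an affine function of n, since absolute values such as |d| + |γn+c| have to be
allowed. -/
theorem summable_pow_mul_kernel (hα : 0 < α) (hρ : 0 < ρ) (hβ : 0 < β) {R C : ℝ}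
    (hR : 0 ≤ R) (ω : ℝ) {d : ℕ → ℝ} (hd0 : ∀ n, 0 ≤ d n) (hd : ∀ n, d n ≤ γ * n + C) {t : ℝ}
    (ht : 0 < t) :
    Summable fun n : ℕ => R ^ n * prabhakarKernel α (ρ * n + β) (d n) |ω| t := by
  obtain ⟨σ, hσ, hx, hq⟩ := (exists_abscissa_series hα hρ γ ω R).exists
  set x := |ω| * σ ^ (-α) with hxdef
  have hx0 : 0 ≤ x := by positivity
  have h1x : 0 < 1 - x := by linarith
  have hgeo := (summable_geometric_of_lt_one
    (by positivity : 0 ≤ R * (σ ^ (-ρ) * (1 - x) ^ (-γ))) hq).mul_left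
    (Real.exp (2 * σ * (t + 1)) / (2 * σ * t) * (σ ^ (-β) * (1 - x) ^ (-C)))
  have hb : ∀ n : ℕ, 0 < ρ * n + β := fun n => by positivity
  refine Summable.of_nonneg_of_le (fun n => mul_nonneg (pow_nonneg hR n)
    (prabhakarKernel_nonneg hα (hb n) (hd0 n) (abs_nonneg ω) ht)) (fun n => ?_) hgeo
  have h1 := prabhakarKernel_le hα (hb n) (hd0 n) (abs_nonneg ω) ht hσ hx
  have h2 : (1 - x) ^ (-d n) ≤ (1 - x) ^ (-C) * ((1 - x) ^ (-γ)) ^ n := by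
    rw [← Real.rpow_mul_natCast h1x.le, ← Real.rpow_add h1x]
    exact Real.rpow_le_rpow_of_exponent_ge h1x (by linarith) (by have := hd n; linarith)
  have h3 : σ ^ (-(ρ * n + β)) = σ ^ (-β) * (σ ^ (-ρ)) ^ n := by
    rw [← Real.rpow_mul_natCast hσ.le, ← Real.rpow_add hσ]
    congr 1; ring
  calc _ ≤ R ^ n * (Real.exp (2 * σ * (t + 1)) / (2 * σ * t) *
        ((σ ^ (-β) * (σ ^ (-ρ)) ^ n) * ((1 - x) ^ (-C) * ((1 - x) ^ (-γ)) ^ n))) := by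
        rw [← h3]
        refine mul_le_mul_of_nonneg_left (h1.trans ?_) (pow_nonneg hR n)
        gcongr
    _ = _ := by rw [mul_pow, mul_pow]; ring

theorem abs_affine_le (hγ : 0 ≤ γ) (c : ℝ) (n : ℕ) : |γ * n + c| ≤ γ * n + |c| := by
  refine (abs_add_le _ _).trans ?_
  rw [abs_of_nonneg (by positivity : 0 ≤ γ * (n : ℝ))]

/-- Enlarging t^{ρn} to T^{ρn} leaves the common singularity t^{β-1} times a summable sequence that
does not depend on z or t. -/
theorem norm_seriesTerm_le (hα : 0 < α) (hρ : 0 < ρ) (hβ : 0 < β) (c : ℝ)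
    {z : ℂ} {t R T : ℝ} (hz : ‖z‖ ≤ R) (ht : 0 < t) (hT : t ≤ T) (n : ℕ) :
    ‖z ^ n * (prabhakarKernel α (ρ * n + β) (γ * n + c) ω t : ℂ)‖ ≤
      t ^ (β - 1) * (T ^ (1 - β) *
        (R ^ n * prabhakarKernel α (ρ * n + β) |γ * n + c| |ω| T)) := by
  have hT0 : 0 < T := ht.trans_le hT
  have hb : 0 < ρ * n + β := by positivity
  have h1 := abs_prabhakarKernel_le_rpow hα hb (γ * n + c) ω ht hT
  have hE : 0 ≤ prabhakarE α (ρ * n + β) |γ * n + c| (|ω| * T ^ α) := by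
    have := abs_prabhakarE_le hα hb (γ * n + c) (z := |ω| * T ^ α) (le_of_eq (abs_of_nonneg
      (by positivity)))
    exact (abs_nonneg _).trans this
  have e1 : t ^ (ρ * n + β - 1) = t ^ (β - 1) * t ^ (ρ * n) := by
    rw [← Real.rpow_add ht]; congr 1; ring
  have e2 : T ^ (ρ * n) = T ^ (1 - β) * T ^ (ρ * n + β - 1) := by
    rw [← Real.rpow_add hT0]; congr 1; ring
  rw [norm_mul, norm_pow, Complex.norm_real, Real.norm_eq_abs]
  calc _ ≤ R ^ n * (prabhakarE α (ρ * n + β) |γ * n + c| (|ω| * T ^ α) *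
          (t ^ (β - 1) * T ^ (ρ * n))) := by
        rw [e1] at h1
        refine mul_le_mul (by gcongr) (h1.trans ?_) (abs_nonneg _)
          (pow_nonneg ((norm_nonneg z).trans hz) n)
        gcongr
    _ = _ := by rw [e2, prabhakarKernel]; ring

theorem summable_seriesTerm_bound (hα : 0 < α) (hρ : 0 < ρ) (hγ : 0 ≤ γ) (hβ : 0 < β) (c ω : ℝ)
    {R t : ℝ} (hR : 0 ≤ R) (ht : 0 < t) :
    Summable fun n : ℕ => R ^ n * prabhakarKernel α (ρ * n + β) |γ * n + c| |ω| t :=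
  summable_pow_mul_kernel hα hρ hβ hR ω (fun _ => abs_nonneg _) (abs_affine_le hγ c) ht

theorem summable_norm_seriesTerm (hα : 0 < α) (hρ : 0 < ρ) (hγ : 0 ≤ γ) (hβ : 0 < β) (c ω : ℝ)
    (z : ℂ) {t : ℝ} (ht : 0 < t) :
    Summable fun n : ℕ => ‖z ^ n * (prabhakarKernel α (ρ * n + β) (γ * n + c) ω t : ℂ)‖ :=
  Summable.of_nonneg_of_le (fun _ => norm_nonneg _)
    (norm_seriesTerm_le hα hρ hβ c le_rfl ht le_rfl)
    (((summable_seriesTerm_bound hα hρ hγ hβ c ω (norm_nonneg z) ht).mul_left _).mul_left _)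

/-- A crude bound whose constant depends on R; it serves for a fixed z only. -/
theorem norm_prabhakarSeries_le (hα : 0 < α) (hρ : 0 < ρ) (hγ : 0 ≤ γ) (hβ : 0 < β) (c ω : ℝ)
    {R T : ℝ} (hR : 0 ≤ R) (hT : 0 < T) :
    ∃ C, ∀ z : ℂ, ‖z‖ ≤ R → ∀ t ∈ Ioc 0 T,
      ‖prabhakarSeries α ρ γ ω β c z t‖ ≤ C * t ^ (β - 1) := by
  refine ⟨∑' n : ℕ, T ^ (1 - β) *
    (R ^ n * prabhakarKernel α (ρ * n + β) |γ * n + c| |ω| T), fun z hz t ht => ?_⟩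
  have hs := (summable_seriesTerm_bound hα hρ hγ hβ c ω hR hT).mul_left (T ^ (1 - β))
  rw [mul_comm, ← tsum_mul_left]
  refine (norm_tsum_le_tsum_norm (summable_norm_seriesTerm hα hρ hγ hβ c ω z ht.1)).trans ?_
  exact (summable_norm_seriesTerm hα hρ hγ hβ c ω z ht.1).tsum_le_tsum
    (norm_seriesTerm_le hα hρ hβ c hz ht.1 ht.2) (hs.mul_left _)

theorem continuousOn_prabhakarSeries (hα : 0 < α) (hρ : 0 < ρ) (hγ : 0 ≤ γ) (hβ : 0 < β)
    (c ω : ℝ) :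
    ContinuousOn (fun q : ℂ × ℝ => prabhakarSeries α ρ γ ω β c q.1 q.2) (univ ×ˢ Ioi 0) := by
  have key : ∀ R a T : ℝ, 0 ≤ R → 0 < a → a < T →
      ContinuousOn (fun q : ℂ × ℝ => prabhakarSeries α ρ γ ω β c q.1 q.2)
        (Metric.ball 0 R ×ˢ Ioo a T) := by
    intro R a T hR ha hT
    have hT0 := ha.trans hT
    -- The sum a^{β-1} + T^{β-1} bounds t^{β-1} on (a,T) whatever the sign of β-1.
    refine continuousOn_tsum (fun n => ?_) (((summable_seriesTerm_bound hα hρ hγ hβ c ω hR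
      hT0).mul_left (T ^ (1 - β))).mul_left (a ^ (β - 1) + T ^ (β - 1))) ?_
    · refine ContinuousOn.mul (by fun_prop) (Complex.continuous_ofReal.comp_continuousOn ?_)
      exact (continuousOn_prabhakarKernel hα (by positivity) _ _).comp continuousOn_snd
        fun q hq => ha.trans hq.2.1
    · intro n q hq
      have hq0 : 0 < q.2 := ha.trans hq.2.1
      refine (norm_seriesTerm_le hα hρ hβ c (le_of_lt (mem_ball_zero_iff.1 hq.1)) hq0
        hq.2.2.le n).trans ?_
      have h0 : 0 ≤ T ^ (1 - β) *
          (R ^ n * prabhakarKernel α (ρ * n + β) |γ * n + c| |ω| T) :=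
        mul_nonneg (by positivity) (mul_nonneg (by positivity)
          (prabhakarKernel_nonneg hα (by positivity) (abs_nonneg _) (abs_nonneg _) hT0))
      refine mul_le_mul_of_nonneg_right ?_ h0
      rcases le_total 0 (β - 1) with h | h
      · exact (Real.rpow_le_rpow hq0.le hq.2.2.le h).trans
          (le_add_of_nonneg_left (by positivity))
      · exact (Real.rpow_le_rpow_of_nonpos ha hq.2.1.le h).trans
          (le_add_of_nonneg_right (by positivity))
  rintro ⟨z, t⟩ ⟨-, ht⟩
  have ht : 0 < t := ht
  refine ((key (‖z‖ + 1) (t / 2) (2 * t) (by positivity) (by linarith) (by linarith)).continuousAt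
    ((Metric.isOpen_ball.prod isOpen_Ioo).mem_nhds ⟨by simp, ?_, ?_⟩)).continuousWithinAt
  · simpa using by linarith
  · simpa using by linarith

theorem continuousOn_prabhakarSeries_time (hα : 0 < α) (hρ : 0 < ρ) (hγ : 0 ≤ γ) (hβ : 0 < β)
    (c ω : ℝ) (z : ℂ) : ContinuousOn (prabhakarSeries α ρ γ ω β c z) (Ioi 0) :=
  (continuousOn_prabhakarSeries hα hρ hγ hβ c ω).comp
    (continuousOn_const.prodMk continuousOn_id) fun _ ht => ⟨mem_univ _, ht⟩

theorem aestronglyMeasurable_prabhakarSeries (hα : 0 < α) (hρ : 0 < ρ) (hγ : 0 ≤ γ) (hβ : 0 < β)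
    (c ω : ℝ) (z : ℂ) (t : ℝ) :
    AEStronglyMeasurable (prabhakarSeries α ρ γ ω β c z) (volume.restrict (Ioc 0 t)) :=
  ((continuousOn_prabhakarSeries_time hα hρ hγ hβ c ω z).mono fun _ hx => hx.1).aestronglyMeasurable
    measurableSet_Ioc

/-- The Prabhakar integral maps a series of Prabhakar kernels to such a series. -/
theorem integral_kernel_conv_prabhakarSeries (hα : 0 < α) (hρ : 0 < ρ) (hγ : 0 ≤ γ) (hβ : 0 < β)
    {b : ℝ} (hb : 0 < b) (c d ω : ℝ) (z : ℂ) {t : ℝ} (ht : 0 < t) :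
    ∫ τ in (0 : ℝ)..t, (prabhakarKernel α b d ω (t - τ) : ℂ) * prabhakarSeries α ρ γ ω β c z τ =
      prabhakarSeries α ρ γ ω (b + β) (d + c) z t := by
  have hbn : ∀ n : ℕ, 0 < ρ * n + β := fun n => by positivity
  set K : ℕ → ℝ → ℝ := fun n τ => prabhakarKernel α b d ω (t - τ) *
    prabhakarKernel α (ρ * n + β) (γ * n + c) ω τ with hK
  set F : ℕ → ℝ → ℂ := fun n τ => z ^ n * (K n τ : ℂ) with hF
  have hmeasK : ∀ (b' d' ω' : ℝ) (n : ℕ) (c' : ℝ), 0 < b' → AEStronglyMeasurable (fun τ =>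
      prabhakarKernel α b' d' ω' (t - τ) * prabhakarKernel α (ρ * n + β) c' ω' τ)
      (volume.restrict (Ioc 0 t)) := fun b' d' ω' n c' hb' =>
    (((measurable_prabhakarKernel hα hb' d' ω').comp (measurable_const.sub measurable_id)).mul
      (measurable_prabhakarKernel hα (hbn n) c' ω')).aestronglyMeasurable
  have hKabs : ∀ n, ∀ᵐ τ ∂(volume.restrict (Ioc 0 t)), ‖K n τ‖ ≤
      prabhakarKernel α b |d| |ω| (t - τ) *
        prabhakarKernel α (ρ * n + β) |γ * n + c| |ω| τ := by
    intro n
    filter_upwards [ae_restrict_mem measurableSet_Ioc, ae_restrict_of_ae (volume.ae_ne t)]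
      with τ hτ hne
    have h1 : 0 < t - τ := by have := lt_of_le_of_ne hτ.2 hne; linarith
    rw [hK, Real.norm_eq_abs, abs_mul]
    exact mul_le_mul (abs_prabhakarKernel_le hα hb d ω h1)
      (abs_prabhakarKernel_le hα (hbn n) _ ω hτ.1) (abs_nonneg _)
      (prabhakarKernel_nonneg hα hb (abs_nonneg _) (abs_nonneg _) h1)
  have hint : ∀ (d' ω' : ℝ) (n : ℕ) (c' : ℝ), IntegrableOn (fun τ =>
      prabhakarKernel α b d' ω' (t - τ) * prabhakarKernel α (ρ * n + β) c' ω' τ) (Ioc 0 t) := by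
    intro d' ω' n c'
    have h := (intervalIntegrable_conv_of_bound (k := prabhakarKernel α b d' ω')
      (f := fun τ => (prabhakarKernel α (ρ * n + β) c' ω' τ : ℂ)) (a := b) (b := ρ * n + β)
      hb (hbn n) ht (measurable_prabhakarKernel hα hb d' ω')
      (measurable_prabhakarKernel hα (hbn n) c' ω').complex_ofReal.aestronglyMeasurable
      (fun τ hτ => abs_prabhakarKernel_le_rpow hα hb d' ω' hτ.1 hτ.2)
      (fun τ hτ => by
        rw [Complex.norm_real]
        exact abs_prabhakarKernel_le_rpow hα (hbn n) c' ω' hτ.1 hτ.2)).1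
    rw [intervalIntegrable_iff_integrableOn_Ioc_of_le ht.le] at h
    have h2 := h.re
    refine h2.congr (Eventually.of_forall fun τ => ?_)
    simp only [← Complex.ofReal_mul]
    exact Complex.ofReal_re _
  have hFint : ∀ n, IntegrableOn (F n) (Ioc 0 t) := fun n =>
    (hint d ω n _).ofReal.const_mul _
  have hval : ∀ n, ∫ τ in Ioc 0 t, F n τ =
      z ^ n * (prabhakarKernel α (ρ * n + (b + β)) (γ * n + (d + c)) ω t : ℂ) := by
    intro n
    rw [hF, integral_const_mul, integral_complex_ofReal, hK,
      ← intervalIntegral.integral_of_le ht.le,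
      integral_prabhakarKernel_conv hα hb (hbn n) d _ ω ht]
    congr 3 <;> ring
  -- The majorizing kernels obey the same semigroup law, so the integrated norm is bounded by a
  -- single kernel with upper index |d| + |γn+c|.
  have hnorm : ∀ n, ∫ τ in Ioc 0 t, ‖F n τ‖ ≤
      ‖z‖ ^ n * prabhakarKernel α (ρ * n + (b + β)) (|d| + |γ * n + c|) |ω| t := by
    intro n
    simp only [hF, norm_mul, norm_pow, Complex.norm_real]
    rw [integral_const_mul]
    refine mul_le_mul_of_nonneg_left ?_ (by positivity)
    refine (integral_mono_ae (hint d ω n _).norm (hint _ _ n _) (hKabs n)).trans (le_of_eq ?_)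
    rw [← intervalIntegral.integral_of_le ht.le,
      integral_prabhakarKernel_conv hα hb (hbn n) _ _ _ ht]
    congr 1; ring
  have hsum : Summable fun n => ∫ τ in Ioc 0 t, ‖F n τ‖ :=
    Summable.of_nonneg_of_le (fun n => integral_nonneg fun _ => norm_nonneg _) hnorm
      (summable_pow_mul_kernel (γ := γ) (C := |d| + |c|) hα hρ (by linarith) (norm_nonneg z) ω
        (fun n => by positivity)
        (fun n => by have := abs_affine_le hγ c n; linarith) ht)
  have hHS := hasSum_integral_of_summable_integral_norm hFint hsum
  rw [prabhakarSeries]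
  simp_rw [← hval]
  rw [hHS.tsum_eq, intervalIntegral.integral_of_le ht.le]
  refine setIntegral_congr_fun measurableSet_Ioc fun τ _ => ?_
  simp only [prabhakarSeries, hF, hK, ← tsum_mul_left]
  refine tsum_congr fun n => ?_
  push_cast
  ring

/-- The Laplace transform of the resolvent kernel. -/
theorem laplace_prabhakarSeries (hα : 0 < α) (hρ : 0 < ρ) (hγ : 0 ≤ γ) (ω : ℝ) (z : ℂ) :
    ∀ᶠ σ : ℝ in atTop, ∀ s : ℂ, s.re = σ →
      IntegrableOn (fun t : ℝ => Complex.exp (-s * t) * prabhakarSeries α ρ γ ω ρ γ z t) (Ioi 0) ∧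
      ∫ t in Ioi (0 : ℝ), Complex.exp (-s * t) * prabhakarSeries α ρ γ ω ρ γ z t =
        (s ^ (ρ : ℂ) * (1 - ω * s ^ (-(α : ℂ))) ^ (γ : ℂ) - z)⁻¹ := by
  filter_upwards [exists_abscissa_series hα hρ γ ω ‖z‖] with σ hσ s hs
  obtain ⟨hσ0, hx, hq⟩ := hσ
  rw [← hs] at hσ0 hx hq
  have hbn : ∀ n : ℕ, 0 < ρ * n + ρ := fun n => by positivity
  have hcn : ∀ n : ℕ, 0 ≤ γ * n + γ := fun n => by positivity
  set x := |ω| * s.re ^ (-α)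
  set P := s ^ (-(ρ : ℂ)) * (1 - ω * s ^ (-(α : ℂ))) ^ (-(γ : ℂ)) with hP
  set F : ℕ → ℝ → ℂ := fun n t => z ^ n *
    (Complex.exp (-s * t) * (prabhakarKernel α (ρ * n + ρ) (γ * n + γ) ω t : ℂ)) with hF
  have hL := fun n : ℕ => laplace_prabhakarKernel hα (hbn n) (γ * n + γ) ω hσ0 hx
  have hFnorm : ∀ n, ∫ t in Ioi (0 : ℝ), ‖F n t‖ ≤
      (s.re ^ (-ρ) * (1 - x) ^ (-γ)) * (‖z‖ * (s.re ^ (-ρ) * (1 - x) ^ (-γ))) ^ n := by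
    intro n
    simp only [hF]
    simp_rw [norm_mul (z ^ n) _, norm_pow]
    rw [integral_const_mul]
    have h := (hL n).2.2
    rw [abs_of_nonneg (hcn n)] at h
    have e1 : s.re ^ (-(ρ * n + ρ)) = (s.re ^ (-ρ)) ^ (n + 1) := by
      rw [← Real.rpow_mul_natCast hσ0.le]; congr 1; push_cast; ring
    have e2 : (1 - x) ^ (-(γ * n + γ)) = ((1 - x) ^ (-γ)) ^ (n + 1) := by
      rw [← Real.rpow_mul_natCast (by linarith)]; congr 1; push_cast; ring
    rw [e1, e2] at h
    refine (mul_le_mul_of_nonneg_left h (by positivity)).trans (le_of_eq ?_)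
    ring
  have hx1 : 0 < 1 - x := by linarith
  have hgeo := (summable_geometric_of_lt_one (by positivity) hq).mul_left
    (s.re ^ (-ρ) * (1 - x) ^ (-γ))
  have hFsum : Summable fun n => ∫ t in Ioi (0 : ℝ), ‖F n t‖ :=
    Summable.of_nonneg_of_le (fun n => integral_nonneg fun _ => norm_nonneg _) hFnorm hgeo
  have hmeas : AEStronglyMeasurable (fun t : ℝ => Complex.exp (-s * t) *
      prabhakarSeries α ρ γ ω ρ γ z t) (volume.restrict (Ioi 0)) :=
    (by fun_prop : Measurable fun t : ℝ => Complex.exp (-s * t)).aestronglyMeasurable.mul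
      ((continuousOn_prabhakarSeries_time hα hρ hγ hρ γ ω z).aestronglyMeasurable
        measurableSet_Ioi)
  obtain ⟨h1, h2, -⟩ := integrable_of_hasSum hmeas (fun n => (hL n).1.const_mul (z ^ n)) hFsum (by
    filter_upwards [ae_restrict_mem measurableSet_Ioi] with t ht
    refine ((summable_norm_seriesTerm hα hρ hγ hρ γ ω z ht).of_norm.hasSum.mul_left
      (Complex.exp (-s * t))).congr_fun fun n => ?_
    ring)
  refine ⟨h1, h2.unique ?_⟩
  have hs0 : s ≠ 0 := fun h => by simp [h] at hσ0
  have hω : ‖(ω : ℂ) * s ^ (-(α : ℂ))‖ < 1 := by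
    rw [norm_mul, Complex.norm_real, Real.norm_eq_abs]
    exact (mul_le_mul_of_nonneg_left (norm_cpow_neg_ofReal_le hσ0 hα.le) (abs_nonneg _)).trans_lt
      hx
  have hw0 : 1 - (ω : ℂ) * s ^ (-(α : ℂ)) ≠ 0 := by
    intro h
    rw [sub_eq_zero] at h
    rw [← h] at hω
    simp at hω
  have hterm : ∀ n : ℕ, ∫ t in Ioi (0 : ℝ), z ^ n *
      (Complex.exp (-s * t) * (prabhakarKernel α (ρ * n + ρ) (γ * n + γ) ω t : ℂ)) =
      P * (z * P) ^ n := by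
    intro n
    rw [integral_const_mul, (hL n).2.1, hP]
    have e1 : s ^ (-((ρ * n + ρ : ℝ) : ℂ)) = (s ^ (-(ρ : ℂ))) ^ (n + 1) := by
      rw [← Complex.cpow_mul_nat]; congr 1; push_cast; ring
    have e2 : (1 - ω * s ^ (-(α : ℂ))) ^ (-((γ * n + γ : ℝ) : ℂ)) =
        ((1 - ω * s ^ (-(α : ℂ))) ^ (-(γ : ℂ))) ^ (n + 1) := by
      rw [← Complex.cpow_mul_nat]; congr 1; push_cast; ring
    rw [e1, e2]
    ring
  -- P is the transform of the n = 0 kernel, so its norm bound is already known and the abscissa was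
  -- chosen to make the ratio zP of the geometric series small.
  have hPz : ‖z * P‖ < 1 := by
    have h0 := (norm_integral_le_integral_norm _).trans (hL 0).2.2
    rw [(hL 0).2.1] at h0
    simp only [Nat.cast_zero, mul_zero, zero_add, abs_of_nonneg hγ] at h0
    rw [norm_mul]
    exact (mul_le_mul_of_nonneg_left h0 (norm_nonneg z)).trans_lt hq
  have hPinv : s ^ (ρ : ℂ) * (1 - ω * s ^ (-(α : ℂ))) ^ (γ : ℂ) = P⁻¹ := by
    rw [hP, Complex.cpow_neg s (ρ : ℂ), Complex.cpow_neg _ (γ : ℂ), mul_inv, inv_inv, inv_inv]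
  have hP0 : P ≠ 0 := mul_ne_zero (by simp [Complex.cpow_eq_zero_iff, hs0])
    (by simp [Complex.cpow_eq_zero_iff, hw0])
  have hfin : (P⁻¹ - z)⁻¹ = P * (1 - z * P)⁻¹ := by
    have : P⁻¹ - z = (1 - z * P) * P⁻¹ := by field_simp
    rw [this, mul_inv, inv_inv, mul_comm]
  rw [hPinv, hfin]
  exact ((hasSum_geometric_of_norm_lt_one hPz).mul_left P).congr_fun hterm

end Series

/-! ### Sectorial lower bound for the Laplace symbol. -/

/-- The symbol `s^ρ (1 - ω s^{-α})^γ`. -/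
noncomputable def prabhakarSymbol (α ρ γ ω : ℝ) (s : ℂ) : ℂ :=
  s ^ (ρ : ℂ) * (1 - ω * s ^ (-(α : ℂ))) ^ (γ : ℂ)

/-- On the right half-plane |arg s| ≤ π/2, so s^ρ has real part at least cos(ρπ/2)|s|^ρ = 2κ|s|^ρ,
with κ > 0 because ρ < 1. For Re s large, 1-ωs^{-α} is so close to 1 that its γ-th power differs
from 1 by less than κ, which costs half of this bound. In the derivative both product-rule terms are
O(|s|^{ρ-1}), since ωs^{-α} is bounded by 1 and the powers of 1-ωs^{-α} by 2. -/
theorem exists_symbol_bounds {α ρ γ : ℝ} (hα : 0 < α) (hρ0 : 0 < ρ) (hρ1 : ρ < 1)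
    (hγ : 0 ≤ γ) (ω : ℝ) :
    ∃ a₀ κ C : ℝ, 0 < a₀ ∧ 0 < κ ∧ 0 ≤ C ∧ ∀ s : ℂ, a₀ < s.re →
      κ * ‖s‖ ^ ρ ≤ (prabhakarSymbol α ρ γ ω s).re ∧
      ∃ d : ℂ, HasDerivAt (prabhakarSymbol α ρ γ ω) d s ∧ ‖d‖ ≤ C * ‖s‖ ^ (ρ - 1) := by
  have hπ := Real.pi_pos
  set κ := Real.cos (ρ * (Real.pi / 2)) / 2 with hκ
  have hκ0 : 0 < κ := by
    rw [hκ]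
    exact half_pos (Real.cos_pos_of_mem_Ioo ⟨by nlinarith, by nlinarith⟩)
  have hcont : ∀ e : ℂ, Tendsto (fun w : ℂ => w ^ e) (𝓝 1) (𝓝 1) := fun e => by
    have h : ContinuousAt (fun w : ℂ => w ^ e) 1 :=
      continuousAt_cpow_const (by simp)
    simpa [ContinuousAt] using h
  have h1 : ∀ᶠ w : ℂ in 𝓝 1, ‖w ^ (γ : ℂ) - 1‖ < min κ 1 := by
    have := (hcont γ).sub_const 1
    rw [sub_self] at this
    exact this.norm.eventually (gt_mem_nhds (by rw [norm_zero]; positivity))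
  have h2 : ∀ᶠ w : ℂ in 𝓝 1, ‖w ^ ((γ : ℂ) - 1)‖ < 2 :=
    (hcont _).norm.eventually (gt_mem_nhds (by norm_num))
  have h3 : ∀ᶠ w : ℂ in 𝓝 1, w ∈ Complex.slitPlane :=
    Complex.isOpen_slitPlane.mem_nhds (by simp)
  obtain ⟨δ, hδ, hball⟩ := Metric.eventually_nhds_iff.1 (h1.and (h2.and h3))
  have hlim : Tendsto (fun σ : ℝ => |ω| * σ ^ (-α)) atTop (𝓝 (|ω| * 0)) :=
    (tendsto_rpow_neg_atTop hα).const_mul _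
  rw [mul_zero] at hlim
  obtain ⟨a₀, ha₀, hx⟩ := ((eventually_gt_atTop 0).and
    (hlim.eventually (gt_mem_nhds (by positivity : 0 < min δ 1)))).exists
  refine ⟨a₀, κ, 2 * ρ + 2 * γ * α, ha₀, hκ0, by positivity, fun s hs => ?_⟩
  have hs0 : 0 < s.re := ha₀.trans hs
  have hsne : s ≠ 0 := fun h => by simp [h] at hs0
  have hsn : 0 < ‖s‖ := norm_pos_iff.2 hsne
  set u := (ω : ℂ) * s ^ (-(α : ℂ)) with hu
  have hunorm : ‖u‖ < min δ 1 := by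
    rw [hu, norm_mul, Complex.norm_real, Real.norm_eq_abs]
    refine (mul_le_mul_of_nonneg_left ((norm_cpow_neg_ofReal_le hs0 hα.le).trans ?_)
      (abs_nonneg _)).trans_lt hx
    exact Real.rpow_le_rpow_of_nonpos ha₀ hs.le (by linarith)
  obtain ⟨hw1, hw2, hw3⟩ := hball (y := 1 - u) (by
    rw [dist_eq_norm]; simpa using hunorm.trans_le (min_le_left _ _))
  have hsρ : ‖s ^ (ρ : ℂ)‖ = ‖s‖ ^ ρ := Complex.norm_cpow_real _ _
  refine ⟨?_, ?_⟩
  · have harg : |s.arg| ≤ Real.pi / 2 := Complex.abs_arg_le_pi_div_two_iff.2 hs0.le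
    have hre : 2 * κ * ‖s‖ ^ ρ ≤ (s ^ (ρ : ℂ)).re := by
      rw [Complex.cpow_ofReal_re, hκ, mul_comm (‖s‖ ^ ρ)]
      refine mul_le_mul_of_nonneg_right ?_ (by positivity)
      rw [← Real.cos_abs (s.arg * ρ), abs_mul, abs_of_pos hρ0]
      have : 2 * (Real.cos (ρ * (Real.pi / 2)) / 2) = Real.cos (ρ * (Real.pi / 2)) := by ring
      rw [this]
      refine Real.cos_le_cos_of_nonneg_of_le_pi (by positivity) (by nlinarith) ?_
      rw [mul_comm]
      gcongr
    have e : prabhakarSymbol α ρ γ ω s = s ^ (ρ : ℂ) + s ^ (ρ : ℂ) * ((1 - u) ^ (γ : ℂ) - 1) := by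
      rw [prabhakarSymbol]; ring
    have hsmall : ‖s ^ (ρ : ℂ) * ((1 - u) ^ (γ : ℂ) - 1)‖ ≤ ‖s‖ ^ ρ * κ := by
      rw [norm_mul, hsρ]
      have := hw1.le.trans (min_le_left _ _)
      gcongr
    have h4 := (abs_le.1 ((Complex.abs_re_le_norm _).trans hsmall)).1
    rw [e, Complex.add_re]
    linarith
  · have hd1 : HasDerivAt (fun s : ℂ => s ^ (ρ : ℂ)) (ρ * s ^ ((ρ : ℂ) - 1) * 1) s :=
      (hasDerivAt_id s).cpow_const (mem_slitPlane_of_re_pos hs0)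
    have hd2 : HasDerivAt (fun s : ℂ => s ^ (-(α : ℂ))) (-(α : ℂ) * s ^ (-(α : ℂ) - 1) * 1) s :=
      (hasDerivAt_id s).cpow_const (mem_slitPlane_of_re_pos hs0)
    have hd3 := ((hd2.const_mul (ω : ℂ)).const_sub 1).cpow_const (c := (γ : ℂ)) hw3
    refine ⟨_, hd1.mul hd3, ?_⟩
    have e1 : ‖s ^ ((ρ : ℂ) - 1)‖ = ‖s‖ ^ (ρ - 1) := by
      rw [← Complex.norm_cpow_real]; push_cast; rfl
    have hwγ : ‖(1 - u) ^ (γ : ℂ)‖ ≤ 2 := by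
      have h5 := norm_add_le ((1 - u) ^ (γ : ℂ) - 1) 1
      rw [sub_add_cancel, norm_one] at h5
      linarith [hw1.le.trans (min_le_right κ 1)]
    have e2 : s ^ (ρ : ℂ) * ((γ : ℂ) * (1 - u) ^ ((γ : ℂ) - 1) *
        -(ω * (-(α : ℂ) * s ^ (-(α : ℂ) - 1) * 1))) =
        (γ * α : ℂ) * s ^ ((ρ : ℂ) - 1) * (1 - u) ^ ((γ : ℂ) - 1) * u := by
      have e3 : s ^ (-(α : ℂ) - 1) * s ^ (ρ : ℂ) = s ^ (-(α : ℂ)) * s ^ ((ρ : ℂ) - 1) := by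
        rw [← Complex.cpow_add _ _ hsne, ← Complex.cpow_add _ _ hsne]
        congr 1; ring
      rw [hu]
      linear_combination (γ * (1 - u) ^ ((γ : ℂ) - 1) * ω * α : ℂ) * e3
    refine (norm_add_le _ _).trans ?_
    rw [e2]
    simp only [norm_mul, Complex.norm_real, Real.norm_of_nonneg hρ0.le, Real.norm_of_nonneg hγ,
      Real.norm_of_nonneg hα.le, e1, mul_one]
    have hu1 := hunorm.le.trans (min_le_right δ 1)
    have hp : 0 ≤ ‖s‖ ^ (ρ - 1) := by positivity
    calc _ ≤ ρ * ‖s‖ ^ (ρ - 1) * 2 + γ * α * ‖s‖ ^ (ρ - 1) * 2 * 1 := by gcongr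
      _ = _ := by ring

/-! ### Contour shift and Laplace inversion. -/

/-- Integrals along vertical lines of a holomorphic function with integrable decay agree. -/
theorem integral_vertical_eq {f : ℂ → ℂ} {a b : ℝ} (hab : a ≤ b)
    (hf : DifferentiableOn ℂ f {s | s.re ∈ Icc a b}) {B : ℝ → ℝ} (hB : Integrable B)
    (hB0 : Tendsto B (cocompact ℝ) (𝓝 0))
    (hfB : ∀ x ∈ Icc a b, ∀ y : ℝ, ‖f (x + y * Complex.I)‖ ≤ B y) :
    ∫ y : ℝ, f (a + y * Complex.I) = ∫ y : ℝ, f (b + y * Complex.I) := by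
  have hline : ∀ x ∈ Icc a b, Integrable fun y : ℝ => f (x + y * Complex.I) := by
    intro x hx
    refine Integrable.mono' hB (Continuous.aestronglyMeasurable ?_)
      (Eventually.of_forall (hfB x hx))
    refine hf.continuousOn.comp_continuous (by fun_prop) fun y => ?_
    simpa using hx
  have hlim : ∀ x ∈ Icc a b, Tendsto (fun T : ℝ => ∫ y in (-T)..T, f (x + y * Complex.I)) atTop
      (𝓝 (∫ y : ℝ, f (x + y * Complex.I))) := fun x hx =>
    intervalIntegral_tendsto_integral (hline x hx) tendsto_neg_atTop_atBot tendsto_id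
  -- The horizontal sides have fixed length b-a and the integrand there is at most B at the given
  -- height, so they vanish in the limit.
  have hhor : ∀ l : Filter ℝ, ∀ φ : ℝ → ℝ, Tendsto φ l (cocompact ℝ) →
      Tendsto (fun T : ℝ => ∫ x in a..b, f (x + φ T * Complex.I)) l (𝓝 0) := by
    intro l φ hφ
    refine squeeze_zero_norm (a := fun T => B (φ T) * |b - a|) (fun T => ?_) ?_
    · refine intervalIntegral.norm_integral_le_of_norm_le_const fun x hx => hfB x ?_ _
      rw [uIoc_of_le hab] at hx
      exact ⟨hx.1.le, hx.2⟩
    · simpa using (hB0.comp hφ).mul_const |b - a|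
  have hrect : ∀ T : ℝ, (∫ x in a..b, f (x + (-T : ℝ) * Complex.I)) -
      (∫ x in a..b, f (x + T * Complex.I)) +
      Complex.I • (∫ y in (-T)..T, f (b + y * Complex.I)) -
      Complex.I • (∫ y in (-T)..T, f (a + y * Complex.I)) = 0 := by
    intro T
    have h := Complex.integral_boundary_rect_eq_zero_of_differentiableOn f
      (⟨a, -T⟩ : ℂ) (⟨b, T⟩ : ℂ) (hf.mono fun s hs => by
        have := hs.1
        rw [uIcc_of_le hab] at this
        exact this)
    exact h
  have htop : Tendsto (fun T : ℝ => T) atTop (cocompact ℝ) := atTop_le_cocompact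
  have hbot : Tendsto (fun T : ℝ => -T) atTop (cocompact ℝ) :=
    tendsto_neg_atTop_atBot.mono_right atBot_le_cocompact
  have hl := (((hhor atTop _ hbot).sub (hhor atTop _ htop)).add
    ((hlim b ⟨hab, le_rfl⟩).const_smul Complex.I)).sub
    ((hlim a ⟨le_rfl, hab⟩).const_smul Complex.I)
  have h0 := tendsto_nhds_unique hl (tendsto_const_nhds.congr fun T => (hrect T).symm)
  rw [sub_zero, zero_add, ← smul_sub, smul_eq_zero, sub_eq_zero] at h0
  exact (h0.resolve_left Complex.I_ne_zero).symm

theorem rpow_norm_vertical {a : ℝ} (ha : 0 < a) (r y : ℝ) :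
    (‖(a : ℂ) + y * Complex.I‖) ^ (-r) = a ^ (-r) * (1 + ‖a⁻¹ * y‖ ^ 2) ^ (-r / 2) := by
  have e : ‖(a : ℂ) + y * Complex.I‖ = a * (1 + ‖a⁻¹ * y‖ ^ 2) ^ (1 / 2 : ℝ) := by
    rw [Complex.norm_add_mul_I, Real.sqrt_eq_rpow]
    have : a ^ 2 + y ^ 2 = a ^ 2 * (1 + ‖a⁻¹ * y‖ ^ 2) := by
      rw [Real.norm_eq_abs, sq_abs]; field_simp
    rw [this, Real.mul_rpow (by positivity) (by positivity), ← Real.sqrt_eq_rpow,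
      Real.sqrt_sq ha.le]
  rw [e, Real.mul_rpow ha.le (by positivity), ← Real.rpow_mul (by positivity)]
  congr 2; ring

theorem integrable_rpow_norm_vertical {a r : ℝ} (ha : 0 < a) (hr : 1 < r) :
    Integrable fun y : ℝ => (‖(a : ℂ) + y * Complex.I‖) ^ (-r) := by
  simp_rw [rpow_norm_vertical ha]
  exact ((integrable_rpow_neg_one_add_norm_sq (E := ℝ) (μ := volume) (r := r)
    (by simpa using hr)).comp_mul_left' (inv_ne_zero ha.ne')).const_mul _

/-- Scaling y = aη gives the exact power of a. With r = 1+ρ and a ≥ 1/t, this power is the source of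
the factor t^ρ in the resolvent bound. -/
theorem integral_rpow_norm_vertical {a : ℝ} (ha : 0 < a) (r : ℝ) :
    ∫ y : ℝ, (‖(a : ℂ) + y * Complex.I‖) ^ (-r) =
      a ^ (1 - r) * ∫ y : ℝ, (1 + ‖y‖ ^ 2) ^ (-r / 2) := by
  simp_rw [rpow_norm_vertical ha]
  rw [integral_const_mul, Measure.integral_comp_mul_left (fun y : ℝ => (1 + ‖y‖ ^ 2) ^ (-r / 2)),
    inv_inv, abs_of_pos ha, smul_eq_mul, ← mul_assoc, sub_eq_add_neg, add_comm 1,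
    Real.rpow_add_one ha.ne']

theorem norm_vertical_mono {a x : ℝ} (ha : 0 < a) (hx : a ≤ x) (y : ℝ) :
    ‖(a : ℂ) + y * Complex.I‖ ≤ ‖(x : ℂ) + y * Complex.I‖ := by
  rw [Complex.norm_add_mul_I, Complex.norm_add_mul_I]
  gcongr

theorem tendsto_rpow_norm_vertical (a : ℝ) {r : ℝ} (hr : 0 < r) :
    Tendsto (fun y : ℝ => (‖(a : ℂ) + y * Complex.I‖) ^ (-r)) (cocompact ℝ) (𝓝 0) := by
  refine (tendsto_rpow_neg_atTop hr).comp (tendsto_atTop_mono (f := fun y : ℝ => ‖y‖) ?_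
    (tendsto_norm_cocompact_atTop))
  intro y
  have := Complex.abs_im_le_norm ((a : ℂ) + y * Complex.I)
  simpa using this

/-- The factor t improves t^{ρ-1} to t^ρ, which vanishes at 0. The extension by zero is thus
continuous, as pointwise Fourier inversion requires. -/
theorem continuous_indicator_mul_of_bound {V : ℝ → ℂ} (hV : ContinuousOn V (Ioi 0)) {ρ C : ℝ}
    (hρ : 0 < ρ) (hb : ∀ t ∈ Ioc (0 : ℝ) 1, ‖V t‖ ≤ C * t ^ (ρ - 1)) (c : ℝ) :
    Continuous ((Ioi (0 : ℝ)).indicator fun t => (t : ℂ) * Complex.exp (-c * t) * V t) := by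
  have hcont : ContinuousOn (fun t : ℝ => (t : ℂ) * Complex.exp (-c * t) * V t) (Ioi 0) :=
    (by fun_prop : Continuous fun t : ℝ => (t : ℂ) * Complex.exp (-c * t)).continuousOn.mul hV
  rw [continuous_iff_continuousAt]
  intro t
  rcases lt_trichotomy t 0 with ht | rfl | ht
  · refine continuousAt_const.congr (f := fun _ => (0 : ℂ)) ?_
    filter_upwards [gt_mem_nhds ht] with x hx
    rw [indicator_of_notMem (by simpa using le_of_lt hx)]
  · rw [ContinuousAt, indicator_of_notMem (by simp)]
    have h1 : Tendsto (fun t : ℝ => C * |t| ^ ρ * Real.exp (-c * t)) (𝓝 0) (𝓝 0) := by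
      have h2 : ContinuousAt (fun t : ℝ => C * |t| ^ ρ * Real.exp (-c * t)) 0 := by
        refine ((continuous_abs.continuousAt.rpow_const (Or.inr hρ.le)).const_mul C).mul
          (by fun_prop)
      have h3 := h2.tendsto
      simpa [Real.zero_rpow hρ.ne'] using h3
    refine squeeze_zero_norm' ?_ h1
    filter_upwards [gt_mem_nhds (zero_lt_one' ℝ)] with x hx
    have hC : 0 ≤ C := by simpa using (norm_nonneg _).trans (hb 1 ⟨one_pos, le_rfl⟩)
    by_cases hx0 : x ∈ Ioi (0 : ℝ)
    · have hx0' : 0 < x := hx0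
      rw [indicator_of_mem hx0, norm_mul, norm_mul, Complex.norm_real, Real.norm_of_nonneg hx0'.le,
        Complex.norm_exp, abs_of_pos hx0']
      have h2 := hb x ⟨hx0, hx.le⟩
      have e : x ^ ρ = x * x ^ (ρ - 1) := by
        rw [Real.rpow_sub_one hx0'.ne']; field_simp
      have e2 : (-(c : ℂ) * x).re = -c * x := by simp
      rw [e2, e]
      calc _ ≤ x * Real.exp (-c * x) * (C * x ^ (ρ - 1)) := by gcongr
        _ = _ := by ring
    · rw [indicator_of_notMem hx0, norm_zero]
      positivity
  · refine (hcont.continuousAt (Ioi_mem_nhds ht)).congr ?_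
    filter_upwards [Ioi_mem_nhds ht] with x hx
    rw [indicator_of_mem hx]

/-- Laplace inversion on a vertical line to the right of the abscissa of convergence, for the
derivative of the transform. -/
theorem mul_eq_integral_deriv_laplace {V : ℝ → ℂ} {G : ℂ → ℂ} {c₀ c ρ C : ℝ} (hρ : 0 < ρ)
    (hV : ContinuousOn V (Ioi 0)) (hb : ∀ t ∈ Ioc (0 : ℝ) 1, ‖V t‖ ≤ C * t ^ (ρ - 1))
    (hint : IntegrableOn (fun t : ℝ => Complex.exp (-(c₀ : ℂ) * t) * V t) (Ioi 0))
    (hG : ∀ s : ℂ, c₀ < s.re → ∫ t in Ioi (0 : ℝ), Complex.exp (-s * t) * V t = G s)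
    (hc : c₀ < c) (hdec : Integrable fun y : ℝ => deriv G (c + y * Complex.I)) {t : ℝ}
    (ht : 0 < t) :
    (t : ℂ) * V t = -(2 * Real.pi : ℂ)⁻¹ *
      ∫ y : ℝ, Complex.exp ((c + y * Complex.I) * t) * deriv G (c + y * Complex.I) := by
  -- Multiplying V by t corresponds to passing from G to -G'. For the resolvent, G' is O(|s|^{-1-ρ})
  -- and integrable on vertical lines, whereas the available bound O(|s|^{-ρ}) for G is not.
  set f : ℝ → ℂ := (Ioi (0 : ℝ)).indicator fun t => (t : ℂ) * Complex.exp (-c * t) * V t with hf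
  have hfc : Continuous f := continuous_indicator_mul_of_bound hV hρ hb c
  have hint' : IntegrableOn (fun t : ℝ => (Real.exp (-(c₀ * t)) : ℂ) * V t) (Ioi 0) := by
    refine hint.congr_fun (fun t _ => ?_) measurableSet_Ioi
    push_cast
    rw [neg_mul]
  have hder : ∀ s : ℂ, c₀ < s.re →
      IntegrableOn (fun t : ℝ => -(t : ℂ) * Complex.exp (-s * t) * V t) (Ioi 0) ∧
      ∫ t in Ioi (0 : ℝ), -(t : ℂ) * Complex.exp (-s * t) * V t = deriv G s := by
    intro s hs
    obtain ⟨h1, h2⟩ := hasDerivAt_laplace hint' hs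
    refine ⟨h1, (HasDerivAt.deriv (h2.congr_of_eventuallyEq ?_)).symm⟩
    filter_upwards [(isOpen_re_gt c₀).mem_nhds hs] with s' hs'
    exact (hG s' hs').symm
  have hfi : Integrable f := by
    rw [hf, integrable_indicator_iff measurableSet_Ioi]
    refine (hder (c : ℂ) (by simpa)).1.neg.congr (Eventually.of_forall fun t => ?_)
    simp
  -- The Fourier variable w corresponds to the point c + 2πiw of the vertical line.
  have hFf : ∀ w : ℝ, FourierTransform.fourier f w =
      -deriv G (c + (2 * Real.pi * w : ℝ) * Complex.I) := by
    intro w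
    rw [Real.fourier_real_eq_integral_exp_smul, ← (hder _ (by simpa using hc)).2, ← integral_neg,
      ← integral_indicator measurableSet_Ioi]
    congr 1
    ext v
    by_cases hv : v ∈ Ioi (0 : ℝ)
    · rw [hf, indicator_of_mem hv, indicator_of_mem hv, smul_eq_mul]
      have e : Complex.exp (((-2 * Real.pi * v * w : ℝ) : ℂ) * Complex.I) *
          Complex.exp (-c * v) =
          Complex.exp (-(c + (2 * Real.pi * w : ℝ) * Complex.I) * v) := by
        rw [← Complex.exp_add]; congr 1; push_cast; ring
      rw [← e]
      ring
    · rw [hf, indicator_of_notMem hv, indicator_of_notMem hv, smul_zero]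
  have hπ : (2 * Real.pi) ≠ 0 := by positivity
  have hFi : Integrable (FourierTransform.fourier f) := by
    rw [funext hFf]
    exact (hdec.comp_mul_left' hπ).neg
  have hinv := congrFun (hfc.fourierInv_fourier_eq hfi hFi) t
  have hft : f t = (t : ℂ) * Complex.exp (-c * t) * V t := indicator_of_mem (mem_Ioi.2 ht) _
  rw [Real.fourierInv_eq', hft] at hinv
  simp_rw [hFf] at hinv
  have hch := Measure.integral_comp_mul_left (fun y : ℝ =>
    Complex.exp ((c + y * Complex.I) * t) * deriv G (c + y * Complex.I)) (2 * Real.pi)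
  rw [abs_of_pos (by positivity), Complex.real_smul] at hch
  have e1 : Complex.exp (c * t) * Complex.exp (-c * t) = 1 := by
    rw [← Complex.exp_add]; simp
  have e2 : (t : ℂ) * V t = Complex.exp (c * t) * ((t : ℂ) * Complex.exp (-c * t) * V t) := by
    linear_combination (-(t : ℂ) * V t) * e1
  rw [e2, ← hinv, ← integral_const_mul]
  push_cast at hch
  rw [neg_mul, ← hch, ← integral_neg]
  congr 1
  ext w
  have e3 : Complex.exp ((c + (2 * Real.pi * w : ℂ) * Complex.I) * t) =
      Complex.exp (c * t) * Complex.exp (((2 * Real.pi * inner ℝ w t : ℝ) : ℂ) * Complex.I) := by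
    rw [← Complex.exp_add]; congr 1
    simp only [RCLike.inner_apply, conj_trivial]
    push_cast; ring
  rw [e3, smul_eq_mul]
  push_cast
  ring

/-! ### The resolvent bound, uniform over the left half-plane. -/

/-- The resolvent kernel is bounded, uniformly with respect to parameters in the closed left
half-plane. -/
theorem norm_resolvent_le {α ρ γ : ℝ} (hα : 0 < α) (hρ0 : 0 < ρ) (hρ1 : ρ < 1) (hγ : 0 ≤ γ)
    (ω T : ℝ) :
    ∃ C, ∀ z : ℂ, z.re ≤ 0 → ∀ t ∈ Ioc 0 T,
      ‖prabhakarSeries α ρ γ ω ρ γ z t‖ ≤ C * t ^ (ρ - 1) := by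
  obtain ⟨a₀, κ, D, ha₀, hκ, hD, hsym⟩ := exists_symbol_bounds hα hρ0 hρ1 hγ ω
  set J := ∫ y : ℝ, (1 + ‖y‖ ^ 2) ^ (-(1 + ρ) / 2) with hJ
  have hJ0 : 0 ≤ J := integral_nonneg fun y => by positivity
  refine ⟨Real.exp (a₀ * T + 1) * (D / κ ^ 2) * J, fun z hz t ht => ?_⟩
  have ht0 : 0 < t := ht.1
  set Φ := prabhakarSymbol α ρ γ ω
  set G : ℂ → ℂ := fun s => (Φ s - z)⁻¹ with hG
  -- Here Re z ≤ 0 enters: subtracting z can only increase the real part, so the lower bound for Re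
  -- Φ is uniform in z.
  have hlow : ∀ s : ℂ, a₀ < s.re → κ * ‖s‖ ^ ρ ≤ ‖Φ s - z‖ := by
    intro s hs
    refine ((hsym s hs).1.trans ?_).trans (Complex.re_le_norm _)
    rw [Complex.sub_re]; linarith
  have hspos : ∀ s : ℂ, a₀ < s.re → 0 < ‖s‖ := fun s hs =>
    (ha₀.trans hs).trans_le (Complex.re_le_norm s)
  have hne : ∀ s : ℂ, a₀ < s.re → Φ s - z ≠ 0 := fun s hs =>
    norm_pos_iff.1 (lt_of_lt_of_le (mul_pos hκ (Real.rpow_pos_of_pos (hspos s hs) _)) (hlow s hs))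
  have hGd : ∀ s : ℂ, a₀ < s.re →
      DifferentiableAt ℂ G s ∧ ‖deriv G s‖ ≤ D / κ ^ 2 * ‖s‖ ^ (-(1 + ρ)) := by
    intro s hs
    obtain ⟨d, hd, hdn⟩ := (hsym s hs).2
    have h1 := (hd.sub_const z).inv (hne s hs)
    refine ⟨h1.differentiableAt, ?_⟩
    have h2 : deriv G s = -d / (Φ s - z) ^ 2 := h1.deriv
    rw [h2, norm_div, norm_neg, norm_pow]
    have hsp := hspos s hs
    have hp : 0 < κ * ‖s‖ ^ ρ := by positivity
    calc ‖d‖ / ‖Φ s - z‖ ^ 2 ≤ (D * ‖s‖ ^ (ρ - 1)) / (κ * ‖s‖ ^ ρ) ^ 2 := by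
          gcongr
          exact hlow s hs
      _ = _ := by
          have e : ‖s‖ ^ (ρ - 1) = ‖s‖ ^ (-(1 + ρ)) * (‖s‖ ^ ρ) ^ 2 := by
            rw [← Real.rpow_mul_natCast hsp.le, ← Real.rpow_add hsp]
            congr 1; push_cast; ring
          rw [e]
          field_simp
  have hGon : DifferentiableOn ℂ (deriv G) {s | a₀ < s.re} :=
    DifferentiableOn.deriv (fun s hs => (hGd s hs).1.differentiableWithinAt) (isOpen_re_gt a₀)
  -- The abscissa is tied to t so that e^{at} ≤ e^{a₀T+1} and a^{-ρ} ≤ t^ρ hold together.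
  set a := a₀ + 1 / t with ha
  have h1t : 0 < 1 / t := by positivity
  have haa : a₀ < a := by linarith
  have ha0 : 0 < a := by linarith
  -- The Laplace integral is known to converge only beyond c₁, which depends on z. Inversion is
  -- carried out at c > max(c₁, a); G' is holomorphic for Re s > a₀, so the line can then be moved
  -- back to the z-independent abscissa a.
  obtain ⟨c₁, hc₁⟩ := eventually_atTop.1 (laplace_prabhakarSeries hα hρ0 hγ ω z)
  set c₀ := max c₁ a with hc₀
  set c := c₀ + 1 with hc
  have hac : a ≤ c := (le_max_right c₁ a).trans (by linarith)
  have hc0 : 0 < c := ha0.trans_le hac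
  have hre : ∀ x y : ℝ, ((x : ℂ) + y * Complex.I).re = x := fun x y => by simp
  obtain ⟨C, hC⟩ := norm_prabhakarSeries_le hα hρ0 hγ hρ0 γ ω (norm_nonneg z) one_pos
  have hline : ∀ x : ℝ, a ≤ x → ∀ y : ℝ, ‖deriv G (x + y * Complex.I)‖ ≤
      D / κ ^ 2 * ‖(a : ℂ) + y * Complex.I‖ ^ (-(1 + ρ)) := by
    intro x hx y
    refine ((hGd _ (by rw [hre]; linarith)).2).trans ?_
    refine mul_le_mul_of_nonneg_left ?_ (by positivity)
    exact Real.rpow_le_rpow_of_nonpos (hspos _ (by rw [hre]; exact haa))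
      (norm_vertical_mono ha0 hx y) (by linarith)
  have hBint := integrable_rpow_norm_vertical ha0 (r := 1 + ρ) (by linarith)
  have hrep := mul_eq_integral_deriv_laplace (G := G) (c₀ := c₀) (c := c) hρ0
    (continuousOn_prabhakarSeries_time hα hρ0 hγ hρ0 γ ω z) (hC z le_rfl)
    (hc₁ c₀ (le_max_left _ _) (c₀ : ℂ) (by simp)).1
    (fun s hs => (hc₁ s.re ((le_max_left _ _).trans hs.le) s rfl).2) (by linarith)
    (Integrable.mono' (hBint.const_mul (D / κ ^ 2))
      (hGon.continuousOn.comp_continuous (by fun_prop) fun y => by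
        simp only [mem_ofPred_eq, hre]; linarith).aestronglyMeasurable
      (Eventually.of_forall (hline c hac))) ht0
  have hexp : ∀ x y : ℝ, ‖Complex.exp (((x : ℂ) + y * Complex.I) * t)‖ = Real.exp (x * t) := by
    intro x y
    rw [Complex.norm_exp]; simp
  have hshift := integral_vertical_eq
    (f := fun s => Complex.exp (s * t) * deriv G s) hac
    (DifferentiableOn.mul (by fun_prop) (hGon.mono fun s hs => haa.trans_le hs.1))
    (B := fun y => Real.exp (c * t) * (D / κ ^ 2 * ‖(a : ℂ) + y * Complex.I‖ ^ (-(1 + ρ))))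
    ((hBint.const_mul _).const_mul _)
    (by simpa using ((tendsto_rpow_norm_vertical a (r := 1 + ρ) (by linarith)).const_mul
      (D / κ ^ 2)).const_mul (Real.exp (c * t)))
    (fun x hx y => by
      rw [norm_mul, hexp]
      have := hx.2
      exact mul_le_mul (Real.exp_le_exp.2 (by gcongr)) (hline x hx.1 y) (norm_nonneg _)
        (Real.exp_pos _).le)
  rw [← hshift] at hrep
  have hbound : ‖∫ y : ℝ, Complex.exp (((a : ℂ) + y * Complex.I) * t) *
      deriv G (a + y * Complex.I)‖ ≤
      Real.exp (a * t) * (D / κ ^ 2 * (a ^ (1 - (1 + ρ)) * J)) := by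
    rw [hJ, ← integral_rpow_norm_vertical ha0, ← integral_const_mul, ← integral_const_mul]
    refine norm_integral_le_of_norm_le ((hBint.const_mul _).const_mul _)
      (Eventually.of_forall fun y => ?_)
    rw [norm_mul, hexp]
    exact mul_le_mul_of_nonneg_left (hline a le_rfl y) (Real.exp_pos _).le
  have h2π : ‖(-(2 * Real.pi : ℂ)⁻¹)‖ ≤ 1 := by
    rw [norm_neg, norm_inv, norm_mul, Complex.norm_real, Real.norm_of_nonneg Real.pi_pos.le]
    refine inv_le_one_of_one_le₀ ?_
    have := Real.pi_gt_three
    norm_num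
    linarith
  have hfin : t * ‖prabhakarSeries α ρ γ ω ρ γ z t‖ ≤
      Real.exp (a₀ * T + 1) * (D / κ ^ 2) * J * t ^ ρ := by
    have e := congrArg norm hrep
    rw [norm_mul, Complex.norm_real, Real.norm_of_nonneg ht0.le, norm_mul] at e
    rw [e]
    refine (mul_le_mul h2π hbound (norm_nonneg _) zero_le_one).trans ?_
    have h1 : Real.exp (a * t) ≤ Real.exp (a₀ * T + 1) := by
      refine Real.exp_le_exp.2 ?_
      rw [ha, add_mul, one_div, inv_mul_cancel₀ ht0.ne']
      have := ht.2
      gcongr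
    have h2 : a ^ (1 - (1 + ρ)) ≤ t ^ ρ := by
      have h3 : a ^ (1 - (1 + ρ)) ≤ (1 / t) ^ (1 - (1 + ρ)) :=
        Real.rpow_le_rpow_of_nonpos h1t (by linarith) (by linarith)
      refine h3.trans (le_of_eq ?_)
      rw [one_div, Real.inv_rpow ht0.le, ← Real.rpow_neg ht0.le]
      congr 1; ring
    calc _ ≤ 1 * (Real.exp (a₀ * T + 1) * (D / κ ^ 2 * (t ^ ρ * J))) := by gcongr
      _ = _ := by ring
  rw [Real.rpow_sub_one ht0.ne', mul_div_assoc', le_div_iff₀ ht0]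
  linarith

/-! ### Superpositions over the frequency and time regularity. -/

/-- A superposition `∫ w(k) ∑_n z(k)^n e^{γ n + c}_{α, ρ n + β, ω}(t) dk`. -/
noncomputable def prabhakarMixture (α ρ γ ω β c : ℝ) (z w : ℝ → ℂ) (t : ℝ) : ℂ :=
  ∫ k : ℝ, w k * prabhakarSeries α ρ γ ω β c (z k) t

section Mixture

variable {α ρ γ β c : ℝ} {z w : ℝ → ℂ}

/-- For β > ρ the series is the convolution of e^{c-γ}_{β-ρ} with the resolvent kernel, and the Beta
integral turns τ^{ρ-1} into t^{β-1}. For β = ρ there is no kernel left to convolve with, which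
forces c = γ. -/
theorem norm_prabhakarSeries_le_of_re_nonpos (hα : 0 < α) (hρ0 : 0 < ρ) (hρ1 : ρ < 1) (hγ : 0 ≤ γ)
    (hβ : ρ < β ∨ β = ρ ∧ c = γ) (ω T : ℝ) :
    ∃ C, ∀ z : ℂ, z.re ≤ 0 → ∀ t ∈ Ioc 0 T,
      ‖prabhakarSeries α ρ γ ω β c z t‖ ≤ C * t ^ (β - 1) := by
  obtain ⟨C, hC⟩ := norm_resolvent_le hα hρ0 hρ1 hγ ω T
  rcases hβ with hβ | ⟨rfl, rfl⟩
  swap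
  · exact ⟨C, hC⟩
  have hb : 0 < β - ρ := by linarith
  refine ⟨prabhakarE α (β - ρ) |c - γ| (|ω| * T ^ α) * C *
    (Real.Gamma (β - ρ) * Real.Gamma ρ / Real.Gamma (β - ρ + ρ)), fun z hz t ht => ?_⟩
  have h := (intervalIntegrable_conv_of_bound hb hρ0 ht.1
    (measurable_prabhakarKernel hα hb (c - γ) ω)
    (aestronglyMeasurable_prabhakarSeries hα hρ0 hγ hρ0 γ ω z t)
    (fun τ hτ => abs_prabhakarKernel_le_rpow hα hb (c - γ) ω hτ.1 (hτ.2.trans ht.2))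
    (fun τ hτ => hC z hz τ ⟨hτ.1, hτ.2.trans ht.2⟩)).2
  rw [integral_kernel_conv_prabhakarSeries hα hρ0 hγ hρ0 hb γ (c - γ) ω z ht.1, sub_add_cancel,
    sub_add_cancel] at h
  rw [sub_add_cancel]
  refine h.trans (le_of_eq ?_)
  ring

theorem pos_of_admissible (hρ0 : 0 < ρ) (hβ : ρ < β ∨ β = ρ ∧ c = γ) : 0 < β := by
  rcases hβ with h | h
  · linarith
  · linarith [h.1]

theorem continuous_prabhakarSeries_param (hα : 0 < α) (hρ : 0 < ρ) (hγ : 0 ≤ γ) (hβ : 0 < β)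
    (c ω : ℝ) (hz : Continuous z) {t : ℝ} (ht : 0 < t) :
    Continuous fun k => prabhakarSeries α ρ γ ω β c (z k) t :=
  (continuousOn_prabhakarSeries hα hρ hγ hβ c ω).comp_continuous
    (f := fun k => (z k, t)) (by fun_prop) fun _ => ⟨mem_univ _, ht⟩

theorem integrable_mixture (hα : 0 < α) (hρ0 : 0 < ρ) (hρ1 : ρ < 1) (hγ : 0 ≤ γ)
    (hβ : ρ < β ∨ β = ρ ∧ c = γ) (ω : ℝ) (hz : Continuous z) (hz0 : ∀ k, (z k).re ≤ 0)
    (hw : Integrable w) {t : ℝ} (ht : 0 < t) :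
    Integrable fun k => w k * prabhakarSeries α ρ γ ω β c (z k) t := by
  obtain ⟨C, hC⟩ := norm_prabhakarSeries_le_of_re_nonpos hα hρ0 hρ1 hγ hβ ω t
  exact hw.mul_bdd (c := C * t ^ (β - 1))
    (continuous_prabhakarSeries_param hα hρ0 hγ (pos_of_admissible hρ0 hβ) c ω hz
      ht).aestronglyMeasurable
    (Eventually.of_forall fun k => hC (z k) (hz0 k) t ⟨ht, le_rfl⟩)

theorem norm_mixture_le (hα : 0 < α) (hρ0 : 0 < ρ) (hρ1 : ρ < 1) (hγ : 0 ≤ γ)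
    (hβ : ρ < β ∨ β = ρ ∧ c = γ) (ω : ℝ) (hz0 : ∀ k, (z k).re ≤ 0)
    (hw : Integrable w) (T : ℝ) :
    ∃ C, ∀ t ∈ Ioc 0 T, ‖prabhakarMixture α ρ γ ω β c z w t‖ ≤ C * t ^ (β - 1) := by
  obtain ⟨C, hC⟩ := norm_prabhakarSeries_le_of_re_nonpos hα hρ0 hρ1 hγ hβ ω T
  refine ⟨(∫ k, ‖w k‖) * C, fun t ht => ?_⟩
  rw [mul_assoc, ← integral_mul_const]
  refine norm_integral_le_of_norm_le (hw.norm.mul_const _) (Eventually.of_forall fun k => ?_)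
  rw [norm_mul]
  exact mul_le_mul_of_nonneg_left (hC _ (hz0 k) t ht) (norm_nonneg _)

theorem rpow_le_rpow_add_rpow {a t T e : ℝ} (ha : 0 < a) (hat : a ≤ t) (htT : t ≤ T) :
    t ^ e ≤ a ^ e + T ^ e := by
  have ht := ha.trans_le hat
  have hT := ht.trans_le htT
  rcases le_total 0 e with h | h
  · exact (Real.rpow_le_rpow ht.le htT h).trans (le_add_of_nonneg_left (by positivity))
  · exact (Real.rpow_le_rpow_of_nonpos ha hat h).trans (le_add_of_nonneg_right (by positivity))

/-- A bound constant near a fixed t, as needed to pass limits and derivatives in t under the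
k-integral. -/
theorem norm_prabhakarSeries_le_local (hα : 0 < α) (hρ0 : 0 < ρ) (hρ1 : ρ < 1) (hγ : 0 ≤ γ)
    (hβ : ρ < β ∨ β = ρ ∧ c = γ) (ω : ℝ) {t : ℝ} (ht : 0 < t) :
    ∃ C, ∀ z : ℂ, z.re ≤ 0 → ∀ τ ∈ Ioo (t / 2) (2 * t),
      ‖prabhakarSeries α ρ γ ω β c z τ‖ ≤ C := by
  obtain ⟨C, hC⟩ := norm_prabhakarSeries_le_of_re_nonpos hα hρ0 hρ1 hγ hβ ω (2 * t)
  have hC0 : 0 ≤ C := by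
    have := (norm_nonneg _).trans (hC 0 (by simp) t ⟨ht, by linarith⟩)
    exact nonneg_of_mul_nonneg_left this (Real.rpow_pos_of_pos ht _)
  refine ⟨C * ((t / 2) ^ (β - 1) + (2 * t) ^ (β - 1)), fun z hz τ hτ => ?_⟩
  refine (hC z hz τ ⟨by linarith [hτ.1], hτ.2.le⟩).trans ?_
  exact mul_le_mul_of_nonneg_left (rpow_le_rpow_add_rpow (by positivity) hτ.1.le hτ.2.le) hC0

theorem continuousOn_mixture (hα : 0 < α) (hρ0 : 0 < ρ) (hρ1 : ρ < 1) (hγ : 0 ≤ γ)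
    (hβ : ρ < β ∨ β = ρ ∧ c = γ) (ω : ℝ) (hz : Continuous z) (hz0 : ∀ k, (z k).re ≤ 0)
    (hw : Integrable w) : ContinuousOn (prabhakarMixture α ρ γ ω β c z w) (Ioi 0) := by
  intro t ht
  have ht : 0 < t := ht
  have hβ0 := pos_of_admissible hρ0 hβ
  obtain ⟨C, hC⟩ := norm_prabhakarSeries_le_local hα hρ0 hρ1 hγ hβ ω ht
  have hmem : Ioo (t / 2) (2 * t) ∈ 𝓝 t := Ioo_mem_nhds (by linarith) (by linarith)
  refine ContinuousAt.continuousWithinAt (continuousAt_of_dominated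
    (bound := fun k => ‖w k‖ * C) ?_ ?_ (hw.norm.mul_const _) ?_)
  · filter_upwards [Ioi_mem_nhds ht] with τ hτ
    exact (integrable_mixture hα hρ0 hρ1 hγ hβ ω hz hz0 hw hτ).aestronglyMeasurable
  · filter_upwards [hmem] with τ hτ
    refine Eventually.of_forall fun k => ?_
    rw [norm_mul]
    exact mul_le_mul_of_nonneg_left (hC _ (hz0 k) τ hτ) (norm_nonneg _)
  · refine Eventually.of_forall fun k => continuousAt_const.mul ?_
    exact (continuousOn_prabhakarSeries_time hα hρ0 hγ hβ0 c ω (z k)).continuousAt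
      (Ioi_mem_nhds ht)

theorem intervalIntegrable_of_norm_le_rpow {f : ℝ → ℂ} {C b T : ℝ} (hb : 0 < b) (hT : 0 < T)
    (hf : ContinuousOn f (Ioi 0)) (hC : ∀ t ∈ Ioc 0 T, ‖f t‖ ≤ C * t ^ (b - 1)) :
    IntervalIntegrable f volume 0 T := by
  have h := (intervalIntegral.intervalIntegrable_rpow' (a := 0) (b := T) (r := b - 1)
    (by linarith)).const_mul C
  rw [intervalIntegrable_iff_integrableOn_Ioc_of_le hT.le] at h ⊢
  refine Integrable.mono' h ((hf.mono fun x hx => hx.1).aestronglyMeasurable measurableSet_Ioc) ?_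
  exact (ae_restrict_iff' measurableSet_Ioc).2 (Eventually.of_forall hC)

/-- Fubini carries the index shift of a single mode over to the superposition. Since the series
bound is independent of k, the product of a Beta kernel in τ and |w| in k is an integrable majorant.
-/
theorem mixture_conv (hα : 0 < α) (hρ0 : 0 < ρ) (hρ1 : ρ < 1) (hγ : 0 ≤ γ)
    (hβ : ρ < β ∨ β = ρ ∧ c = γ) (ω : ℝ) (hz : Continuous z) (hz0 : ∀ k, (z k).re ≤ 0)
    (hw : Integrable w) {b : ℝ} (hb : 0 < b) (d : ℝ) {t : ℝ} (ht : 0 < t) :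
    IntervalIntegrable (fun τ => (prabhakarKernel α b d ω (t - τ) : ℂ) *
      prabhakarMixture α ρ γ ω β c z w τ) volume 0 t ∧
    ∫ τ in (0 : ℝ)..t, (prabhakarKernel α b d ω (t - τ) : ℂ) *
      prabhakarMixture α ρ γ ω β c z w τ = prabhakarMixture α ρ γ ω (b + β) (d + c) z w t := by
  have hβ0 := pos_of_admissible hρ0 hβ
  have hkm := measurable_prabhakarKernel hα hb d ω
  refine ⟨?_, ?_⟩
  · obtain ⟨C, hC⟩ := norm_mixture_le hα hρ0 hρ1 hγ hβ ω hz0 hw t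
    exact (intervalIntegrable_conv_of_bound hb hβ0 ht hkm
      (((continuousOn_mixture hα hρ0 hρ1 hγ hβ ω hz hz0 hw).mono
        fun _ hx => hx.1).aestronglyMeasurable measurableSet_Ioc)
      (fun τ hτ => abs_prabhakarKernel_le_rpow hα hb d ω hτ.1 hτ.2) hC).1
  obtain ⟨C, hC⟩ := norm_prabhakarSeries_le_of_re_nonpos hα hρ0 hρ1 hγ hβ ω t
  set A := prabhakarE α b |d| (|ω| * t ^ α)
  set F : ℝ → ℝ → ℂ := fun τ k => (prabhakarKernel α b d ω (t - τ) : ℂ) *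
    (w k * prabhakarSeries α ρ γ ω β c (z k) τ) with hF
  have hmeas : AEStronglyMeasurable (Function.uncurry F)
      ((volume.restrict (Ioc 0 t)).prod volume) := by
    have h1 : AEStronglyMeasurable (fun q : ℝ × ℝ => prabhakarSeries α ρ γ ω β c (z q.2) q.1)
        ((volume.restrict (Ioc 0 t)).prod volume) := by
      have h2 : ContinuousOn (fun q : ℝ × ℝ => prabhakarSeries α ρ γ ω β c (z q.2) q.1)
          (Ioc 0 t ×ˢ univ) :=
        (continuousOn_prabhakarSeries hα hρ0 hγ hβ0 c ω).comp
          (f := fun q : ℝ × ℝ => (z q.2, q.1)) (by fun_prop)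
          fun q hq => ⟨mem_univ _, hq.1.1⟩
      have h3 := h2.aestronglyMeasurable (μ := (volume : Measure ℝ).prod volume)
        (measurableSet_Ioc.prod MeasurableSet.univ)
      rwa [← Measure.prod_restrict, Measure.restrict_univ] at h3
    exact ((hkm.comp (measurable_const.sub measurable_fst)).complex_ofReal
      |>.aestronglyMeasurable).mul (hw.aestronglyMeasurable.comp_snd.mul h1)
  have hint : Integrable (Function.uncurry F) ((volume.restrict (Ioc 0 t)).prod volume) := by
    have h1 := (intervalIntegrable_betaKernel hb hβ0 ht).const_mul (A * C)
    rw [intervalIntegrable_iff_integrableOn_Ioc_of_le ht.le] at h1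
    refine Integrable.mono' (h1.mul_prod hw.norm) hmeas ?_
    have h2 : ∀ᵐ τ ∂(volume.restrict (Ioc 0 t)), τ ∈ Ioo 0 t := by
      filter_upwards [ae_restrict_mem measurableSet_Ioc, ae_restrict_of_ae (volume.ae_ne t)]
        with τ hτ hne
      exact ⟨hτ.1, lt_of_le_of_ne hτ.2 hne⟩
    filter_upwards [Measure.quasiMeasurePreserving_fst.ae h2] with q hq
    have h3 := abs_prabhakarKernel_le_rpow hα hb d ω (t := t - q.1) (T := t)
      (by linarith [hq.2]) (by linarith [hq.1])
    have h4 := hC (z q.2) (hz0 _) q.1 ⟨hq.1, hq.2.le⟩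
    simp only [Function.uncurry, hF, norm_mul, Complex.norm_real, Real.norm_eq_abs]
    calc _ ≤ (A * (t - q.1) ^ (b - 1)) * (‖w q.2‖ * (C * q.1 ^ (β - 1))) :=
          mul_le_mul h3 (mul_le_mul_of_nonneg_left h4 (norm_nonneg _))
            (by positivity) ((abs_nonneg _).trans h3)
      _ = _ := by ring
  rw [intervalIntegral.integral_of_le ht.le]
  have e1 : ∀ τ, (prabhakarKernel α b d ω (t - τ) : ℂ) * prabhakarMixture α ρ γ ω β c z w τ =
      ∫ k, F τ k := fun τ => by rw [prabhakarMixture, ← integral_const_mul]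
  simp_rw [e1]
  rw [integral_integral_swap hint, prabhakarMixture]
  refine integral_congr_ae (Eventually.of_forall fun k => ?_)
  simp only [hF]
  rw [← integral_kernel_conv_prabhakarSeries hα hρ0 hγ hβ0 hb c d ω (z k) ht,
    intervalIntegral.integral_of_le ht.le, ← integral_const_mul]
  refine integral_congr_ae (Eventually.of_forall fun τ => ?_)
  simp only
  ring

/-- The series with `β = 1`, `c = 0` is `1 + z ∫_0^t V`, where `V` is the resolvent kernel. -/
theorem prabhakarSeries_one_zero (hα : 0 < α) (hρ : 0 < ρ) (hγ : 0 ≤ γ) (ω : ℝ) (z : ℂ) {t : ℝ}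
    (ht : 0 < t) :
    prabhakarSeries α ρ γ ω 1 0 z t =
      1 + z * ∫ τ in (0 : ℝ)..t, prabhakarSeries α ρ γ ω ρ γ z τ := by
  have h1 : ∫ τ in (0 : ℝ)..t, prabhakarSeries α ρ γ ω ρ γ z τ =
      prabhakarSeries α ρ γ ω (1 + ρ) (0 + γ) z t := by
    rw [← integral_kernel_conv_prabhakarSeries hα hρ hγ hρ one_pos γ 0 ω z ht,
      intervalIntegral.integral_of_le ht.le, intervalIntegral.integral_of_le ht.le]
    refine setIntegral_congr_ae measurableSet_Ioc ?_
    filter_upwards [volume.ae_ne t] with τ hne hτ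
    have : 0 < t - τ := by have := lt_of_le_of_ne hτ.2 hne; linarith
    rw [prabhakarKernel_zero_one α ω this, Complex.ofReal_one, one_mul]
  -- The n = 0 term is e^0_1 = 1; one factor z taken out of the remaining terms leaves the
  -- integrated resolvent.
  rw [h1, prabhakarSeries,
    (summable_norm_seriesTerm hα hρ hγ one_pos 0 ω z ht).of_norm.tsum_eq_zero_add,
    prabhakarSeries, ← tsum_mul_left]
  congr 1
  · simp [prabhakarKernel_zero_one α ω ht]
  · refine tsum_congr fun n => ?_
    rw [pow_succ', mul_assoc]
    congr 4 <;> push_cast <;> ring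

theorem intervalIntegrable_resolvent (hα : 0 < α) (hρ : 0 < ρ) (hγ : 0 ≤ γ) (ω : ℝ) (z : ℂ)
    {t : ℝ} (ht : 0 < t) :
    IntervalIntegrable (prabhakarSeries α ρ γ ω ρ γ z) volume 0 t := by
  obtain ⟨C, hC⟩ := norm_prabhakarSeries_le hα hρ hγ hρ γ ω (norm_nonneg z) ht
  exact intervalIntegrable_of_norm_le_rpow hρ ht
    (continuousOn_prabhakarSeries_time hα hρ hγ hρ γ ω z) (hC z le_rfl)

theorem hasDerivAt_prabhakarSeries_one_zero (hα : 0 < α) (hρ : 0 < ρ) (hγ : 0 ≤ γ) (ω : ℝ)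
    (z : ℂ) {t : ℝ} (ht : 0 < t) :
    HasDerivAt (prabhakarSeries α ρ γ ω 1 0 z) (z * prabhakarSeries α ρ γ ω ρ γ z t) t := by
  have hc := continuousOn_prabhakarSeries_time hα hρ hγ hρ γ ω z
  have h1 := intervalIntegral.integral_hasDerivAt_right
    (intervalIntegrable_resolvent hα hρ hγ ω z ht)
    (hc.stronglyMeasurableAtFilter isOpen_Ioi t ht) (hc.continuousAt (Ioi_mem_nhds ht))
  refine ((h1.const_mul z).const_add 1).congr_of_eventuallyEq ?_
  filter_upwards [Ioi_mem_nhds ht] with τ hτ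
  exact prabhakarSeries_one_zero hα hρ hγ ω z hτ

theorem tendsto_prabhakarSeries_one_zero (hα : 0 < α) (hρ : 0 < ρ) (hγ : 0 ≤ γ) (ω : ℝ)
    (z : ℂ) : Tendsto (prabhakarSeries α ρ γ ω 1 0 z) (𝓝[>] 0) (𝓝 1) := by
  have hi := intervalIntegrable_resolvent hα hρ hγ ω z (one_pos)
  have h1 : ContinuousWithinAt (fun t => ∫ τ in (0 : ℝ)..t, prabhakarSeries α ρ γ ω ρ γ z τ)
      (Icc 0 1) 0 := by
    refine intervalIntegral.continuousWithinAt_primitive (by simp) ?_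
    simpa using hi
  have h2 : Tendsto (fun t => 1 + z * ∫ τ in (0 : ℝ)..t, prabhakarSeries α ρ γ ω ρ γ z τ)
      (𝓝[>] 0) (𝓝 1) := by
    have h3 := ((h1.tendsto.mono_left (nhdsWithin_mono 0 Ioc_subset_Icc_self)).const_mul
      z).const_add 1
    rw [intervalIntegral.integral_same, mul_zero, add_zero,
      nhdsWithin_Ioc_eq_nhdsGT one_pos] at h3
    exact h3
  refine h2.congr' ?_
  filter_upwards [self_mem_nhdsWithin] with t ht
  exact (prabhakarSeries_one_zero hα hρ hγ ω z ht).symm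

/-- Each mode contributes the derivative zV. The possibly unbounded factor z passes into the weight,
and V is bounded uniformly in k near t. -/
theorem hasDerivAt_mixture_one_zero (hα : 0 < α) (hρ0 : 0 < ρ) (hρ1 : ρ < 1) (hγ : 0 ≤ γ)
    (ω : ℝ) (hz : Continuous z) (hz0 : ∀ k, (z k).re ≤ 0) (hw : Integrable w)
    (hzw : Integrable fun k => z k * w k) {t : ℝ} (ht : 0 < t) :
    HasDerivAt (prabhakarMixture α ρ γ ω 1 0 z w)
      (prabhakarMixture α ρ γ ω ρ γ z (fun k => z k * w k) t) t := by
  obtain ⟨C, hC⟩ := norm_prabhakarSeries_le_local hα hρ0 hρ1 hγ (Or.inr ⟨rfl, rfl⟩) ω ht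
  refine (hasDerivAt_integral_of_dominated_loc_of_deriv_le
    (F := fun τ k => w k * prabhakarSeries α ρ γ ω 1 0 (z k) τ)
    (F' := fun τ k => z k * w k * prabhakarSeries α ρ γ ω ρ γ (z k) τ)
    (bound := fun k => ‖z k * w k‖ * C)
    (Ioo_mem_nhds (by linarith : t / 2 < t) (by linarith : t < 2 * t)) ?_ ?_ ?_ ?_
    (hzw.norm.mul_const C) ?_).2
  · filter_upwards [Ioi_mem_nhds ht] with τ hτ
    exact (integrable_mixture hα hρ0 hρ1 hγ (Or.inl hρ1) ω hz hz0 hw hτ).aestronglyMeasurable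
  · exact integrable_mixture hα hρ0 hρ1 hγ (Or.inl hρ1) ω hz hz0 hw ht
  · exact (integrable_mixture hα hρ0 hρ1 hγ (Or.inr ⟨rfl, rfl⟩) ω hz hz0 hzw
      ht).aestronglyMeasurable
  · refine Eventually.of_forall fun k τ hτ => ?_
    rw [norm_mul]
    exact mul_le_mul_of_nonneg_left (hC _ (hz0 k) τ hτ) (norm_nonneg _)
  · refine Eventually.of_forall fun k τ hτ => ?_
    refine ((hasDerivAt_prabhakarSeries_one_zero hα hρ0 hγ ω (z k)
      (by linarith [hτ.1] : 0 < τ)).const_mul (w k)).congr_deriv ?_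
    ring

theorem tendsto_mixture_one_zero (hα : 0 < α) (hρ0 : 0 < ρ) (hρ1 : ρ < 1) (hγ : 0 ≤ γ)
    (ω : ℝ) (hz : Continuous z) (hz0 : ∀ k, (z k).re ≤ 0) (hw : Integrable w) :
    Tendsto (prabhakarMixture α ρ γ ω 1 0 z w) (𝓝[>] 0) (𝓝 (∫ k, w k)) := by
  obtain ⟨C, hC⟩ := norm_prabhakarSeries_le_of_re_nonpos (c := 0) hα hρ0 hρ1 hγ (Or.inl hρ1) ω 1
  refine tendsto_integral_filter_of_dominated_convergence (fun k => ‖w k‖ * C) ?_ ?_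
    (hw.norm.mul_const _) ?_
  · filter_upwards [self_mem_nhdsWithin] with t ht
    exact (integrable_mixture hα hρ0 hρ1 hγ (Or.inl hρ1) ω hz hz0 hw ht).aestronglyMeasurable
  · filter_upwards [Ioc_mem_nhdsGT (zero_lt_one' ℝ)] with t ht
    refine Eventually.of_forall fun k => ?_
    rw [norm_mul]
    have h := hC _ (hz0 k) t ht
    -- For β = 1 the bound C t^{β-1} is constant, so it dominates all the way down to t = 0.
    rw [sub_self, Real.rpow_zero, mul_one] at h
    exact mul_le_mul_of_nonneg_left h (norm_nonneg _)
  · refine Eventually.of_forall fun k => ?_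
    simpa using (tendsto_prabhakarSeries_one_zero hα hρ0 hγ ω (z k)).const_mul (w k)

end Mixture

/-! ### Fourier integrals in the space variable. -/

theorem norm_cexp_neg_I_mul (k x : ℝ) : ‖Complex.exp (-Complex.I * k * x)‖ = 1 := by
  rw [Complex.norm_exp]; simp

theorem integrable_mul_cexp {h : ℝ → ℂ} (hh : Integrable h) (x : ℝ) :
    Integrable fun k : ℝ => h k * Complex.exp (-Complex.I * k * x) :=
  hh.mul_bdd (c := 1) (by fun_prop : Continuous fun k : ℝ =>
    Complex.exp (-Complex.I * k * x)).aestronglyMeasurable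
    (Eventually.of_forall fun k => (norm_cexp_neg_I_mul k x).le)

theorem hasDerivAt_integral_mul_cexp {h : ℝ → ℂ} (hh : Integrable h)
    (hkh : Integrable fun k : ℝ => (k : ℂ) * h k) (x : ℝ) :
    HasDerivAt (fun x : ℝ => ∫ k : ℝ, h k * Complex.exp (-Complex.I * k * x))
      (∫ k : ℝ, -Complex.I * k * h k * Complex.exp (-Complex.I * k * x)) x := by
  have hm : Integrable fun k : ℝ => -Complex.I * k * h k := by
    simpa only [mul_assoc] using hkh.const_mul (-Complex.I)
  refine (hasDerivAt_integral_of_dominated_loc_of_deriv_le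
    (F := fun (x : ℝ) (k : ℝ) => h k * Complex.exp (-Complex.I * k * x))
    (F' := fun (x : ℝ) (k : ℝ) => -Complex.I * k * h k * Complex.exp (-Complex.I * k * x))
    (bound := fun k => ‖-Complex.I * k * h k‖) univ_mem
    (Eventually.of_forall fun x => (integrable_mul_cexp hh x).aestronglyMeasurable)
    (integrable_mul_cexp hh x) (integrable_mul_cexp hm x).aestronglyMeasurable
    ?_ hm.norm ?_).2
  · refine Eventually.of_forall fun k x _ => ?_
    rw [norm_mul _ (Complex.exp _), norm_cexp_neg_I_mul, mul_one]
  · refine Eventually.of_forall fun k x _ => ?_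
    have h1 : HasDerivAt (fun x : ℝ => -Complex.I * k * (x : ℂ)) (-Complex.I * k * 1) x :=
      (Complex.ofRealCLM.hasDerivAt (x := x)).const_mul _
    refine (h1.cexp.const_mul (h k)).congr_deriv ?_
    ring

theorem integral_mul_cexp_eq_fourier (h : ℝ → ℂ) (x : ℝ) :
    ∫ k : ℝ, h k * Complex.exp (-Complex.I * k * x) =
      FourierTransform.fourier h ((2 * Real.pi)⁻¹ * x) := by
  rw [Real.fourier_real_eq_integral_exp_smul]
  congr 1
  ext k
  rw [smul_eq_mul, mul_comm]
  congr 2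
  push_cast
  have : (Real.pi : ℂ) ≠ 0 := by exact_mod_cast Real.pi_ne_zero
  field_simp

/-- The Riemann-Lebesgue lemma. -/
theorem tendsto_integral_mul_cexp (h : ℝ → ℂ) :
    Tendsto (fun x : ℝ => ∫ k : ℝ, h k * Complex.exp (-Complex.I * k * x)) (cocompact ℝ)
      (𝓝 0) := by
  simp_rw [integral_mul_cexp_eq_fourier]
  refine (Real.zero_at_infty_fourier h).comp ?_
  exact Filter.tendsto_cocompact_mul_left₀ (by positivity)

/-- The two conventions differ by the sign of the exponent and the factor 2π. -/
theorem fourierStar_eq_fourier (g : ℝ → ℂ) (k : ℝ) :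
    fourierStar g k = FourierTransform.fourier g (-(2 * Real.pi)⁻¹ * k) := by
  rw [Real.fourier_real_eq_integral_exp_smul, fourierStar]
  congr 1
  ext x
  rw [smul_eq_mul, mul_comm]
  congr 2
  push_cast
  have : (Real.pi : ℂ) ≠ 0 := by exact_mod_cast Real.pi_ne_zero
  field_simp

theorem integral_fourierStar_inversion {g : ℝ → ℂ} (hg : Continuous g) (hgi : Integrable g)
    (hgf : Integrable (fourierStar g)) (x : ℝ) :
    ∫ k : ℝ, (1 / (2 * Real.pi) : ℂ) * (Complex.exp (-Complex.I * k * x) * fourierStar g k) =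
      g x := by
  have hπ : (-(2 * Real.pi)) ≠ 0 := neg_ne_zero.2 (by positivity)
  have e : ∀ v : ℝ, FourierTransform.fourier g v = fourierStar g (-(2 * Real.pi) * v) := by
    intro v
    have := Real.pi_ne_zero
    rw [fourierStar_eq_fourier]
    field_simp
  have hF : Integrable (FourierTransform.fourier g) := by
    rw [funext e]
    exact hgf.comp_mul_left' hπ
  have hinv := congrFun (hg.fourierInv_fourier_eq hgi hF) x
  rw [Real.fourierInv_eq'] at hinv
  -- The substitution k = -2πv produces the prefactor 1/(2π).
  have hch := Measure.integral_comp_mul_left (fun k : ℝ =>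
    Complex.exp (-Complex.I * k * x) * fourierStar g k) (-(2 * Real.pi))
  rw [inv_neg, abs_neg, abs_of_pos (by positivity), Complex.real_smul] at hch
  rw [integral_const_mul, ← hinv]
  have e2 : (1 / (2 * Real.pi) : ℂ) = (((2 * Real.pi)⁻¹ : ℝ) : ℂ) := by push_cast; rw [one_div]
  rw [e2, ← hch]
  congr 1
  ext v
  rw [e, smul_eq_mul]
  congr 2
  simp only [RCLike.inner_apply, conj_trivial]
  push_cast
  ring

/-! ### The fractional Laplacian of a Fourier integral. -/

/-- The second difference quotient of `x ↦ e^{-ikx}`. -/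
noncomputable def expSecondDiff (lam x : ℝ) (k y : ℝ) : ℂ :=
  (Complex.exp (-Complex.I * k * ((x + y : ℝ) : ℂ)) +
    Complex.exp (-Complex.I * k * ((x - y : ℝ) : ℂ)) -
      2 * Complex.exp (-Complex.I * k * x)) / ((y ^ (1 + lam) : ℝ) : ℂ)

theorem expSecondDiff_eq (lam x k y : ℝ) :
    expSecondDiff lam x k y = -Complex.exp (-Complex.I * k * x) *
      (((2 - 2 * Real.cos (k * y)) / y ^ (1 + lam) : ℝ) : ℂ) := by
  have e1 : -Complex.I * (k : ℂ) * ((x + y : ℝ) : ℂ) =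
      -Complex.I * k * x + -(k * y) * Complex.I := by push_cast; ring
  have e2 : -Complex.I * (k : ℂ) * ((x - y : ℝ) : ℂ) =
      -Complex.I * k * x + (k * y) * Complex.I := by push_cast; ring
  rw [expSecondDiff, e1, e2, Complex.exp_add, Complex.exp_add]
  push_cast
  rw [Complex.cos]
  ring

theorem integral_expSecondDiff {lam : ℝ} (h0 : 0 < lam) (h2 : lam < 2) (x k : ℝ) :
    ∫ y in Ioi (0 : ℝ), expSecondDiff lam x k y =
      -(fracLaplacianNorm lam * |k| ^ lam : ℝ) * Complex.exp (-Complex.I * k * x) := by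
  have h := fracLaplacian_exp h0 h2 k x
  have hN : ((fracLaplacianNorm lam : ℝ) : ℂ) ≠ 0 := by
    exact_mod_cast (fracLaplacianNorm_pos h0 h2).ne'
  rw [fracLaplacian, inv_mul_eq_iff_eq_mul₀ hN] at h
  simp only [expSecondDiff]
  rw [h]
  push_cast
  ring

theorem integral_secondDiff_cos {lam : ℝ} (h0 : 0 < lam) (h2 : lam < 2) (k : ℝ) :
    ∫ y in Ioi (0 : ℝ), (2 - 2 * Real.cos (k * y)) / y ^ (1 + lam) =
      fracLaplacianNorm lam * |k| ^ lam := by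
  have h := integral_expSecondDiff h0 h2 0 k
  simp_rw [expSecondDiff_eq] at h
  rw [integral_const_mul, integral_complex_ofReal] at h
  simp only [Complex.ofReal_zero, mul_zero, Complex.exp_zero] at h
  have h3 := congrArg Complex.re h
  simp only [neg_mul, one_mul, mul_one, Complex.neg_re, Complex.ofReal_re] at h3
  linarith

/-- A non-integrable function has integral 0 by convention, whereas this integral is positive for k
≠ 0. -/
theorem integrableOn_secondDiff_cos {lam : ℝ} (h0 : 0 < lam) (h2 : lam < 2) (k : ℝ) :
    IntegrableOn (fun y : ℝ => (2 - 2 * Real.cos (k * y)) / y ^ (1 + lam)) (Ioi 0) := by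
  rcases eq_or_ne k 0 with rfl | hk
  · simp
  by_contra hcon
  have h := integral_secondDiff_cos h0 h2 k
  rw [integral_undef hcon] at h
  have hpos : 0 < fracLaplacianNorm lam * |k| ^ lam :=
    mul_pos (fracLaplacianNorm_pos h0 h2) (Real.rpow_pos_of_pos (abs_pos.2 hk) _)
  exact hpos.ne h

/-- By Tonelli: integrating the norm over y gives exactly N_λ|k|^λ|h(k)|, which is integrable by
assumption. -/
theorem integrable_mul_expSecondDiff {lam : ℝ} (h0 : 0 < lam) (h2 : lam < 2) {h : ℝ → ℂ}
    (hh : Integrable h) (hlam : Integrable fun k : ℝ => ((|k| ^ lam : ℝ) : ℂ) * h k) (x : ℝ) :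
    Integrable (fun q : ℝ × ℝ => h q.1 * expSecondDiff lam x q.1 q.2)
      (volume.prod (volume.restrict (Ioi 0))) := by
  have hmeas : AEStronglyMeasurable (fun q : ℝ × ℝ => h q.1 * expSecondDiff lam x q.1 q.2)
      (volume.prod (volume.restrict (Ioi 0))) := by
    refine hh.aestronglyMeasurable.comp_fst.mul (Measurable.aestronglyMeasurable ?_)
    unfold expSecondDiff
    fun_prop
  have hnorm : ∀ k, ∀ y ∈ Ioi (0 : ℝ), ‖h k * expSecondDiff lam x k y‖ =
      ‖h k‖ * ((2 - 2 * Real.cos (k * y)) / y ^ (1 + lam)) := by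
    intro k y hy
    have hy : 0 < y := hy
    rw [expSecondDiff_eq, norm_mul, norm_mul, norm_neg, norm_cexp_neg_I_mul, one_mul,
      Complex.norm_real, Real.norm_of_nonneg]
    exact div_nonneg (by linarith [Real.cos_le_one (k * y)]) (by positivity)
  rw [integrable_prod_iff hmeas]
  refine ⟨Eventually.of_forall fun k => ?_, ?_⟩
  · simp_rw [expSecondDiff_eq]
    exact ((integrableOn_secondDiff_cos h0 h2 k).ofReal.const_mul _).const_mul _
  · have e : ∀ k, ∫ y in Ioi (0 : ℝ), ‖h k * expSecondDiff lam x k y‖ =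
        fracLaplacianNorm lam * ‖((|k| ^ lam : ℝ) : ℂ) * h k‖ := by
      intro k
      rw [setIntegral_congr_fun measurableSet_Ioi (hnorm k), integral_const_mul,
        integral_secondDiff_cos h0 h2, norm_mul, Complex.norm_real,
        Real.norm_of_nonneg (by positivity)]
      ring
    simp_rw [e]
    exact hlam.norm.const_mul _

/-- The second difference of a Fourier integral is the Fourier integral of the second differences.
After Fubini, each exponential is multiplied by its symbol -|k|^λ. -/
theorem fracLaplacian_integral_mul_cexp {lam : ℝ} (h0 : 0 < lam) (h2 : lam < 2) {h : ℝ → ℂ}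
    (hh : Integrable h) (hlam : Integrable fun k : ℝ => ((|k| ^ lam : ℝ) : ℂ) * h k) (x : ℝ) :
    FracLaplacianIntegrableAt lam
      (fun x : ℝ => ∫ k : ℝ, h k * Complex.exp (-Complex.I * k * x)) x ∧
    fracLaplacian lam (fun x : ℝ => ∫ k : ℝ, h k * Complex.exp (-Complex.I * k * x)) x =
      ∫ k : ℝ, -((|k| ^ lam : ℝ) : ℂ) * h k * Complex.exp (-Complex.I * k * x) := by
  have hint := integrable_mul_expSecondDiff h0 h2 hh hlam x
  have e : ∀ y : ℝ, ((∫ k : ℝ, h k * Complex.exp (-Complex.I * k * ((x + y : ℝ) : ℂ))) +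
      (∫ k : ℝ, h k * Complex.exp (-Complex.I * k * ((x - y : ℝ) : ℂ))) -
      2 * ∫ k : ℝ, h k * Complex.exp (-Complex.I * k * x)) / ((y ^ (1 + lam) : ℝ) : ℂ) =
      ∫ k : ℝ, h k * expSecondDiff lam x k y := by
    intro y
    have h12 : Integrable fun k : ℝ => h k * Complex.exp (-Complex.I * k * ((x + y : ℝ) : ℂ)) +
        h k * Complex.exp (-Complex.I * k * ((x - y : ℝ) : ℂ)) :=
      (integrable_mul_cexp hh _).add (integrable_mul_cexp hh _)
    rw [← integral_const_mul, ← integral_add (integrable_mul_cexp hh _) (integrable_mul_cexp hh _),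
      ← integral_sub h12 ((integrable_mul_cexp hh _).const_mul 2), ← integral_div]
    congr 1
    ext k
    simp only [expSecondDiff]
    ring
  refine ⟨?_, ?_⟩
  · rw [FracLaplacianIntegrableAt]
    simp_rw [e]
    exact hint.integral_prod_right
  · rw [fracLaplacian]
    simp_rw [e]
    rw [← integral_integral_swap hint, ← integral_const_mul]
    congr 1
    ext k
    have hN : ((fracLaplacianNorm lam : ℝ) : ℂ) ≠ 0 := by
      exact_mod_cast (fracLaplacianNorm_pos h0 h2).ne'
    rw [integral_const_mul, integral_expSecondDiff h0 h2]
    push_cast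
    field_simp

/-! ### The solution formula as a superposition of modes. -/

/-- The Fourier symbol `ipk - ϑ|k|^lam` of `-p ∂_x + ϑ Δ^{lam/2}`. -/
noncomputable def advectionSymbol (p ϑ lam k : ℝ) : ℂ :=
  Complex.I * p * k - ϑ * ((|k| ^ lam : ℝ) : ℂ)

theorem continuous_advectionSymbol (p ϑ : ℝ) {lam : ℝ} (hlam : 0 < lam) :
    Continuous (advectionSymbol p ϑ lam) := by
  unfold advectionSymbol
  have : Continuous fun k : ℝ => |k| ^ lam :=
    continuous_abs.rpow_const fun _ => Or.inr hlam.le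
  fun_prop

/-- Advection contributes only an imaginary part, and ϑ ≥ 0 makes the dispersive part nonpositive.
Every mode thus falls under the uniform bound. -/
theorem advectionSymbol_re_nonpos (p lam : ℝ) {ϑ : ℝ} (hϑ : 0 ≤ ϑ) (k : ℝ) :
    (advectionSymbol p ϑ lam k).re ≤ 0 := by
  have : (advectionSymbol p ϑ lam k).re = -(ϑ * |k| ^ lam) := by
    simp only [advectionSymbol, Complex.sub_re, ← Complex.ofReal_mul, Complex.ofReal_re]
    simp [mul_assoc, ← Complex.ofReal_mul]
  rw [this]
  have := Real.rpow_nonneg (abs_nonneg k) lam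
  nlinarith

theorem solutionTerm_eq (α γ ρ ν ω p ϑ lam k t : ℝ) (n : ℕ) :
    solutionTerm α γ ρ ν ω p ϑ lam k t n = advectionSymbol p ϑ lam k ^ n *
      (prabhakarKernel α (ρ * n + (ν * (1 - ρ) + ρ)) (γ * n + (γ - γ * ν)) ω t : ℂ) := by
  have e1 : ν * (1 - ρ) + ρ * (n + 1) = ρ * n + (ν * (1 - ρ) + ρ) := by ring
  have e2 : γ * (n + 1) - γ * ν = γ * n + (γ - γ * ν) := by ring
  have e3 : ν * (1 - ρ) + n * ρ + ρ - 1 = ρ * n + (ν * (1 - ρ) + ρ) - 1 := by ring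
  rw [solutionTerm, prabhakarKernel, advectionSymbol, e1, e2, e3]
  push_cast
  ring

theorem tsum_solutionTerm (α γ ρ ν ω p ϑ lam k t : ℝ) :
    ∑' n : ℕ, solutionTerm α γ ρ ν ω p ϑ lam k t n =
      prabhakarSeries α ρ γ ω (ν * (1 - ρ) + ρ) (γ - γ * ν) (advectionSymbol p ϑ lam k) t :=
  tsum_congr (solutionTerm_eq α γ ρ ν ω p ϑ lam k t)

/-- The weight `e^{-ikx} g*(k) / 2π` of the Fourier inversion formula. -/
noncomputable def fourierWeight (g : ℝ → ℂ) (x k : ℝ) : ℂ :=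
  (1 / (2 * Real.pi) : ℂ) * (Complex.exp (-Complex.I * k * x) * fourierStar g k)

theorem solutionFormula_eq (α γ ρ ν ω p ϑ lam : ℝ) (g : ℝ → ℂ) (x t : ℝ) :
    solutionFormula α γ ρ ν ω p ϑ lam g x t =
      prabhakarMixture α ρ γ ω (ν * (1 - ρ) + ρ) (γ - γ * ν) (advectionSymbol p ϑ lam)
        (fourierWeight g x) t := by
  rw [solutionFormula, prabhakarMixture, ← integral_const_mul]
  refine integral_congr_ae (Eventually.of_forall fun k => ?_)
  simp only [solutionIntegrand, tsum_solutionTerm, fourierWeight]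
  ring

section Weight

variable {lam : ℝ} {g : ℝ → ℂ}

/-- Division by the weight 1+|k|+|k|^λ turns m into a bounded multiplier. It serves for m = 1, k,
|k|^λ and the symbol itself. -/
theorem integrable_mul_fourierStar (hlam : 0 < lam)
    (hg : Integrable (fun k : ℝ => ((1 + |k| + |k| ^ lam : ℝ) : ℂ) * fourierStar g k))
    {m : ℝ → ℂ} (hm : Continuous m) {C : ℝ}
    (hC : ∀ k, ‖m k‖ ≤ C * (1 + |k| + |k| ^ lam)) :
    Integrable fun k => m k * fourierStar g k := by
  have hpos : ∀ k : ℝ, 0 < 1 + |k| + |k| ^ lam := fun k => by positivity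
  have hcont : Continuous fun k : ℝ => |k| ^ lam :=
    continuous_abs.rpow_const fun _ => Or.inr hlam.le
  have hne : ∀ k : ℝ, ((1 + |k| + |k| ^ lam : ℝ) : ℂ) ≠ 0 := fun k => by
    exact_mod_cast (hpos k).ne'
  have h := hg.bdd_mul (c := C) (f := fun k => m k / ((1 + |k| + |k| ^ lam : ℝ) : ℂ))
    (hm.div (by fun_prop) hne).aestronglyMeasurable (Eventually.of_forall fun k => by
      rw [norm_div, Complex.norm_real, Real.norm_of_nonneg (hpos k).le, div_le_iff₀ (hpos k)]
      exact hC k)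
  refine h.congr (Eventually.of_forall fun k => ?_)
  simp only
  rw [← mul_assoc, div_mul_cancel₀ _ (hne k)]

theorem integrable_mul_fourierWeight (hlam : 0 < lam)
    (hg : Integrable (fun k : ℝ => ((1 + |k| + |k| ^ lam : ℝ) : ℂ) * fourierStar g k))
    {m : ℝ → ℂ} (hm : Continuous m) {C : ℝ}
    (hC : ∀ k, ‖m k‖ ≤ C * (1 + |k| + |k| ^ lam)) (x : ℝ) :
    Integrable fun k => m k * fourierWeight g x k := by
  refine ((integrable_mul_cexp (integrable_mul_fourierStar hlam hg hm hC) x).const_mul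
    (1 / (2 * Real.pi) : ℂ)).congr (Eventually.of_forall fun k => ?_)
  simp only [fourierWeight]
  ring

end Weight

/-! ### The Hilfer-Prabhakar derivative of the superposition and the Cauchy problem. -/

section Solution

variable {α γ ρ ν ω p ϑ lam : ℝ} {g : ℝ → ℂ}

/-- For ν = 0 the series is the resolvent kernel itself; for ν > 0 it is a convolution of it. -/
theorem admissible_solution (hρ1 : ρ < 1) (hν : 0 ≤ ν) :
    ρ < ν * (1 - ρ) + ρ ∨ ν * (1 - ρ) + ρ = ρ ∧ γ - γ * ν = γ := by
  rcases hν.eq_or_lt with rfl | h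
  · right; simp
  · left; nlinarith

/-- The inner integral of the Hilfer-Prabhakar derivative of a superposition. -/
theorem hilferPrabhakarInner_mixture (hα : 0 < α) (hγ : 0 < γ) (hρ0 : 0 < ρ) (hρ1 : ρ < 1)
    (hν : ν ∈ Icc (0 : ℝ) 1) {z w : ℝ → ℂ} (hz : Continuous z) (hz0 : ∀ k, (z k).re ≤ 0)
    (hw : Integrable w) {t : ℝ} (ht : 0 < t) :
    PrabhakarIntegrableAt α ((1 - ν) * (1 - ρ)) (-γ * (1 - ν)) ω
      (prabhakarMixture α ρ γ ω (ν * (1 - ρ) + ρ) (γ - γ * ν) z w) t ∧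
    hilferPrabhakarInner α γ ρ ν ω
      (prabhakarMixture α ρ γ ω (ν * (1 - ρ) + ρ) (γ - γ * ν) z w) t =
      prabhakarMixture α ρ γ ω 1 0 z w t := by
  rw [hilferPrabhakarInner, prabhakarIntegral, PrabhakarIntegrableAt]
  -- For ν = 1 the inner operator is the identity by convention, and the indices already equal (1,
  -- 0).
  rcases hν.2.eq_or_lt with rfl | h1
  · simp
  have hb : 0 < (1 - ν) * (1 - ρ) := mul_pos (by linarith) (by linarith)
  obtain ⟨h2, h3⟩ := mixture_conv hα hρ0 hρ1 hγ.le (admissible_solution (γ := γ) hρ1 hν.1) ω hz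
    hz0 hw hb (-γ * (1 - ν)) ht
  refine ⟨Or.inr h2, ?_⟩
  rw [if_neg fun h => hb.ne' h.1, h3]
  congr 1 <;> ring

/-- The outer integral of the Hilfer-Prabhakar derivative of a superposition. -/
theorem prabhakarIntegral_outer_mixture (hα : 0 < α) (hγ : 0 < γ) (hρ0 : 0 < ρ) (hρ1 : ρ < 1)
    (hν : ν ∈ Icc (0 : ℝ) 1) {z w : ℝ → ℂ} (hz : Continuous z) (hz0 : ∀ k, (z k).re ≤ 0)
    (hw : Integrable w) {f : ℝ → ℂ}
    (hf : ∀ t > 0, f t = prabhakarMixture α ρ γ ω ρ γ z w t) {t : ℝ} (ht : 0 < t) :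
    PrabhakarIntegrableAt α (ν * (1 - ρ)) (-γ * ν) ω f t ∧
    prabhakarIntegral α (ν * (1 - ρ)) (-γ * ν) ω f t =
      prabhakarMixture α ρ γ ω (ν * (1 - ρ) + ρ) (γ - γ * ν) z w t := by
  rw [prabhakarIntegral, PrabhakarIntegrableAt]
  -- For ν = 0 the outer operator is the identity. Otherwise the values of f on (0,t] suffice; f
  -- will be a `deriv` that is controlled only at positive times.
  rcases hν.1.eq_or_lt with rfl | h1
  · simp [hf t ht]
  have hb : 0 < ν * (1 - ρ) := mul_pos h1 (by linarith)
  obtain ⟨h2, h3⟩ := mixture_conv hα hρ0 hρ1 hγ.le (Or.inr ⟨rfl, rfl⟩) ω hz hz0 hw hb (-γ * ν) ht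
  refine ⟨Or.inr (h2.congr fun τ hτ => ?_), ?_⟩
  · rw [uIoc_of_le ht.le] at hτ
    rw [hf τ hτ.1]
  · rw [if_neg fun h => hb.ne' h.1]
    have e : ∫ τ in (0 : ℝ)..t, (prabhakarKernel α (ν * (1 - ρ)) (-γ * ν) ω (t - τ) : ℂ) * f τ =
        ∫ τ in (0 : ℝ)..t, (prabhakarKernel α (ν * (1 - ρ)) (-γ * ν) ω (t - τ) : ℂ) *
          prabhakarMixture α ρ γ ω ρ γ z w τ := by
      rw [intervalIntegral.integral_of_le ht.le, intervalIntegral.integral_of_le ht.le]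
      refine setIntegral_congr_fun measurableSet_Ioc fun τ hτ => ?_
      rw [hf τ hτ.1]
    rw [e, h3]
    congr 1
    ring

end Solution

theorem mainTheorem7 (α γ ρ ν ω p ϑ lam : ℝ)
    (hα : 0 < α) (hγ : 0 < γ) (hρ : ρ ∈ Ioo (0 : ℝ) 1) (hν : ν ∈ Icc (0 : ℝ) 1)
    (hlam : lam ∈ Ioo (0 : ℝ) 2) (hϑ : 0 ≤ ϑ)
    (g : ℝ → ℂ) (hg_cont : Continuous g) (hg_int : Integrable g volume)
    (hg_fourier : Integrable
      (fun k : ℝ => ((1 + |k| + |k| ^ lam : ℝ) : ℂ) * fourierStar g k) volume) :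
    (∀ k : ℝ, ∀ t > 0, Summable (solutionTerm α γ ρ ν ω p ϑ lam k t)) ∧
    (∀ x : ℝ, ∀ t > 0,
      Integrable (solutionIntegrand α γ ρ ν ω p ϑ lam g x t) volume) ∧
    IsAdvectionDispersionSolution α γ ρ ν ω p ϑ lam g
      (solutionFormula α γ ρ ν ω p ϑ lam g) := by
  obtain ⟨hρ0, hρ1⟩ := hρ
  obtain ⟨hl0, hl2⟩ := hlam
  set b := ν * (1 - ρ) + ρ with hb
  set c := γ - γ * ν with hc
  set z := advectionSymbol p ϑ lam with hzdef
  have hadm : ρ < b ∨ b = ρ ∧ c = γ := admissible_solution hρ1 hν.1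
  have hb0 : 0 < b := pos_of_admissible hρ0 hadm
  have hz : Continuous z := continuous_advectionSymbol p ϑ hl0
  have hz0 : ∀ k, (z k).re ≤ 0 := advectionSymbol_re_nonpos p lam hϑ
  have hlamc : Continuous fun k : ℝ => ((|k| ^ lam : ℝ) : ℂ) :=
    Complex.continuous_ofReal.comp (continuous_abs.rpow_const fun _ => Or.inr hl0.le)
  have hlamb : ∀ k : ℝ, ‖((|k| ^ lam : ℝ) : ℂ)‖ ≤ 1 * (1 + |k| + |k| ^ lam) := fun k => by
    rw [Complex.norm_real, Real.norm_of_nonneg (by positivity)]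
    linarith [abs_nonneg k]
  have hkb : ∀ k : ℝ, ‖(k : ℂ)‖ ≤ 1 * (1 + |k| + |k| ^ lam) := fun k => by
    rw [Complex.norm_real, Real.norm_eq_abs]
    linarith [Real.rpow_nonneg (abs_nonneg k) lam]
  have h1b : ∀ k : ℝ, ‖(1 : ℂ)‖ ≤ 1 * (1 + |k| + |k| ^ lam) := fun k => by
    rw [norm_one]
    linarith [Real.rpow_nonneg (abs_nonneg k) lam, abs_nonneg k]
  have hzb : ∀ k : ℝ, ‖z k‖ ≤ (|p| + ϑ) * (1 + |k| + |k| ^ lam) := fun k => by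
    have h1 := Real.rpow_nonneg (abs_nonneg k) lam
    refine (norm_sub_le _ _).trans ?_
    simp only [norm_mul, Complex.norm_I, one_mul, Complex.norm_real, Real.norm_eq_abs,
      abs_of_nonneg hϑ, abs_of_nonneg h1]
    nlinarith [abs_nonneg k, abs_nonneg p, mul_nonneg (abs_nonneg p) h1,
      mul_nonneg hϑ (abs_nonneg k)]
  have hgs : Integrable (fourierStar g) := by
    simpa using integrable_mul_fourierStar hl0 hg_fourier (m := fun _ => 1) continuous_const h1b
  have hw : ∀ x, Integrable (fourierWeight g x) := fun x => by
    simpa using integrable_mul_fourierWeight hl0 hg_fourier (m := fun _ => 1) continuous_const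
      h1b x
  -- Integrability of z times the weight makes the inner integral differentiable in time; it follows
  -- from |z(k)| ≤ (|p|+ϑ)(1+|k|+|k|^λ).
  have hzw : ∀ x, Integrable fun k => z k * fourierWeight g x k := fun x =>
    integrable_mul_fourierWeight hl0 hg_fourier hz hzb x
  have hψ : ∀ x, (fun t => solutionFormula α γ ρ ν ω p ϑ lam g x t) =
      prabhakarMixture α ρ γ ω b c z (fourierWeight g x) := fun x =>
    funext fun t => solutionFormula_eq α γ ρ ν ω p ϑ lam g x t
  have hinner : ∀ x, ∀ t > 0, hilferPrabhakarInner α γ ρ ν ω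
      (prabhakarMixture α ρ γ ω b c z (fourierWeight g x)) t =
      prabhakarMixture α ρ γ ω 1 0 z (fourierWeight g x) t := fun x t ht =>
    (hilferPrabhakarInner_mixture hα hγ hρ0 hρ1 hν hz hz0 (hw x) ht).2
  have hinner' : ∀ x, ∀ t > 0, HasDerivAt (hilferPrabhakarInner α γ ρ ν ω
      (prabhakarMixture α ρ γ ω b c z (fourierWeight g x)))
      (prabhakarMixture α ρ γ ω ρ γ z (fun k => z k * fourierWeight g x k) t) t := fun x t ht => by
    refine (hasDerivAt_mixture_one_zero hα hρ0 hρ1 hγ.le ω hz hz0 (hw x) (hzw x)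
      ht).congr_of_eventuallyEq ?_
    filter_upwards [Ioi_mem_nhds ht] with τ hτ
    exact hinner x τ hτ
  have houter := fun (x t : ℝ) (ht : t > 0) => prabhakarIntegral_outer_mixture (ω := ω) hα hγ hρ0
    hρ1 hν hz hz0 (hzw x) (fun t ht => (hinner' x t ht).deriv) ht
  -- the solution as a Fourier integral in the space variable
  set h : ℝ → ℝ → ℂ := fun t k => (1 / (2 * Real.pi) : ℂ) * (fourierStar g k *
    prabhakarSeries α ρ γ ω b c (z k) t) with hh
  have hψh : ∀ t, (fun x => solutionFormula α γ ρ ν ω p ϑ lam g x t) =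
      fun x : ℝ => ∫ k : ℝ, h t k * Complex.exp (-Complex.I * k * x) := fun t => by
    ext x
    rw [solutionFormula_eq, prabhakarMixture]
    refine integral_congr_ae (Eventually.of_forall fun k => ?_)
    simp only [hh, fourierWeight]
    ring
  have hhm : ∀ t > 0, ∀ (m : ℝ → ℂ) (C : ℝ), Continuous m →
      (∀ k, ‖m k‖ ≤ C * (1 + |k| + |k| ^ lam)) → Integrable fun k => m k * h t k :=
    fun t ht m C hm hC => by
    refine ((integrable_mixture hα hρ0 hρ1 hγ.le hadm ω hz hz0
      (integrable_mul_fourierStar hl0 hg_fourier hm hC) ht).const_mul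
      (1 / (2 * Real.pi) : ℂ)).congr (Eventually.of_forall fun k => ?_)
    simp only [hh]
    ring
  have hhi : ∀ t > 0, Integrable (h t) := fun t ht => by
    simpa using hhm t ht (fun _ => 1) 1 continuous_const h1b
  have hhk : ∀ t > 0, Integrable fun k : ℝ => (k : ℂ) * h t k := fun t ht =>
    hhm t ht _ 1 Complex.continuous_ofReal hkb
  have hhl : ∀ t > 0, Integrable fun k : ℝ => ((|k| ^ lam : ℝ) : ℂ) * h t k := fun t ht =>
    hhm t ht _ 1 hlamc hlamb
  refine ⟨fun k t ht => ?_, fun x t ht => ?_, ?_⟩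
  · rw [funext (solutionTerm_eq α γ ρ ν ω p ϑ lam k t)]
    exact (summable_norm_seriesTerm hα hρ0 hγ.le hb0 c ω (z k) ht).of_norm
  · refine (integrable_mul_cexp ((hhi t ht).const_mul (2 * Real.pi)) x).congr
      (Eventually.of_forall fun k => ?_)
    have hπ : (Real.pi : ℂ) ≠ 0 := by exact_mod_cast Real.pi_ne_zero
    have h2π : (2 * Real.pi : ℂ) * (1 / (2 * Real.pi)) = 1 := by field_simp
    simp only [solutionIntegrand, tsum_solutionTerm, hh, hb, hc, hzdef]
    linear_combination (fourierStar g k * prabhakarSeries α ρ γ ω (ν * (1 - ρ) + ρ) (γ - γ * ν)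
      (advectionSymbol p ϑ lam k) t * Complex.exp (-Complex.I * k * x)) * h2π
  refine ⟨fun x => ?_, fun t ht => ?_, fun t ht x => ?_, fun t ht x => ?_, fun x => ?_,
    fun t ht => ?_⟩
  · rw [hψ x]
    refine ⟨fun T hT => ?_, fun t ht => ?_, fun t ht => (hinner' x t ht).differentiableAt,
      fun T hT => ?_, fun t ht => (houter x t ht).1⟩
    · obtain ⟨C, hC⟩ := norm_mixture_le hα hρ0 hρ1 hγ.le hadm ω hz0 (hw x) T
      exact intervalIntegrable_of_norm_le_rpow hb0 hT
        (continuousOn_mixture hα hρ0 hρ1 hγ.le hadm ω hz hz0 (hw x)) hC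
    · exact (hilferPrabhakarInner_mixture hα hγ hρ0 hρ1 hν hz hz0 (hw x) ht).1
    · obtain ⟨C, hC⟩ := norm_mixture_le hα hρ0 hρ1 hγ.le (Or.inr ⟨rfl, rfl⟩) ω hz0 (hzw x) T
      refine (intervalIntegrable_of_norm_le_rpow hρ0 hT (continuousOn_mixture hα hρ0 hρ1 hγ.le
        (Or.inr ⟨rfl, rfl⟩) ω hz hz0 (hzw x)) hC).congr fun t ht => ?_
      rw [uIoc_of_le hT.le] at ht
      exact (hinner' x t ht.1).deriv.symm
  · rw [hψh t]
    exact fun x => (hasDerivAt_integral_mul_cexp (hhi t ht) (hhk t ht) x).differentiableAt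
  · rw [hψh t]
    exact (fracLaplacian_integral_mul_cexp hl0 hl2 (hhi t ht) (hhl t ht) x).1
  -- Both sides become Fourier integrals of the same function, because -p(-ik) + ϑ(-|k|^λ) = z(k).
  · rw [hψ x, hψh t, (hasDerivAt_integral_mul_cexp (hhi t ht) (hhk t ht) x).deriv,
      (fracLaplacian_integral_mul_cexp hl0 hl2 (hhi t ht) (hhl t ht) x).2, hilferPrabhakarDeriv,
      (houter x t ht).2, ← integral_const_mul, ← integral_const_mul, ← integral_add]
    · rw [prabhakarMixture]
      refine integral_congr_ae (Eventually.of_forall fun k => ?_)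
      simp only [hh, fourierWeight, hzdef, advectionSymbol]
      ring
    · refine Integrable.const_mul (integrable_mul_cexp ?_ x) _
      simpa only [mul_assoc] using (hhk t ht).const_mul (-Complex.I)
    · refine Integrable.const_mul (integrable_mul_cexp ?_ x) _
      exact (hhl t ht).neg.congr (Eventually.of_forall fun k => by simp)
  · rw [hψ x]
    -- As t → 0+ every mode of the inner integral tends to 1, which leaves the Fourier inversion
    -- integral of g.
    have h1 := tendsto_mixture_one_zero hα hρ0 hρ1 hγ.le ω hz hz0 (hw x)
    have h2 : ∫ k, fourierWeight g x k = g x :=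
      integral_fourierStar_inversion hg_cont hg_int hgs x
    rw [h2] at h1
    refine h1.congr' ?_
    filter_upwards [self_mem_nhdsWithin] with t ht
    exact (hinner x t ht).symm
  · rw [hψh t]
    exact tendsto_integral_mul_cexp (h t)
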